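/- **Setting.** Let $\omega=e^{2\pi i/3}$ and $|M(\omega)\rangle=|0\rangle(|00\rangle+\omega|11\rangle+\omega^2|22\rangle)+|1\rangle(|00\rangle+|11\rangle+|22\rangle)\in\mathbb C^2\otimes\mathbb C^3\otimes\mathbb C^3$. For $b\in GL(3,\mathbb C)$ let $|A_b\rangle=(\mathbb 1\otimes b\otimes\mathbb 1)|M(\omega)\rangle=\sum_{i,j,k}(A_b^i)_{jk}|ijk\rangle$, and let $G_b$ be the set of all $h=g\otimes x\otimes y^T$ with $g\in GL(2,\mathbb C)$, $x,y\in GL(3,\mathbb C)$ and $h|A_b\rangle=|A_b\rangle$. An *$N$-cycle* in $G_b$ ($N\ge1$) is a sequence $h_k=g_k\otimes x_k\otimes y_k^T\in G_b$, $k=0,\dots,N-1$, with $y_kx_{k+1}\propto\mathbb 1$ for all $k$ (indices modulo $N$). For a permutation $\sigma=(\sigma(0),\sigma(1),\sigma(2))\in S_3$ put $g_{(0,1,2)}=\mathbb 1$, $g_{(0,2,1)}=\begin{pmatrix}0&1\\1&0\end{pmatrix}$, $g_{(2,1,0)}=\begin{pmatrix}0&\omega^2\\1&0\end{pmatrix}$,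 $g_{(1,0,2)}=\begin{pmatrix}0&\omega\\1&0\end{pmatrix}$, $g_{(2,0,1)}=\operatorname{diag}(\omega,1)$, $g_{(1,2,0)}=\operatorname{diag}(\omega^2,1)$, and write $\tau=(0,2,1)$, $\epsilon=(1,0,2)$, $\kappa=(2,1,0)$, $S=(1,2,0)$, $S^2=(2,0,1)$. A string $\sigma=(\sigma_0,\dots,\sigma_{N-1})\in S_3^N$ is a *repetition* of $w\in S_3^m$ if $m\mid N$ and $\sigma_k=w_{k\bmod m}$ for all $k$; its *minimal length* is the least $m\ge1$ for which it is a repetition of some $w\in S_3^m$. For $w\in S_3^m$ let $\Gamma(w)\le S_3^m$ be the subgroup (site-wise product) generated by the cyclic translates of $w$. "The $m$-cycle $w$ is in $G_b$" means that $G_b$ has an $m$-cycle with $g_k=g_{w_k}$ for all $k$. **Table** (strings written as words): * length 1: $C_0=S$, $T_0^\tau=\tau$, $T_0^\epsilon=\epsilon$, $T_0^\kappa=\kappa$; * length 2: $C_1=S\,S^2$, $T_1^\tau=\mathbb 1\tau$, $T_1^\epsilon=\mathbb 1\epsilon$, $T_1^\kappa=\mathbb 1\kappa$, $T_2^\tau=\epsilon\kappa$,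 $T_2^\epsilon=\tau\kappa$, $T_2^\kappa=\tau\epsilon$; * length 3: $C_2=\mathbb 1\,S\,S^2$, $T_3^\tau=\mathbb 1\tau\tau$, $T_3^\epsilon=\mathbb 1\epsilon\epsilon$, $T_3^\kappa=\mathbb 1\kappa\kappa$, $T_4^{\circlearrowleft}=\tau\kappa\epsilon$, $T_4^{\circlearrowright}=\tau\epsilon\kappa$, $T_5^{\circlearrowleft}=\tau\tau\kappa$, $T_5^{\circlearrowright}=\tau\tau\epsilon$; * length 4: $C_3=\mathbb 1\,S\,\mathbb 1\,S^2$, $T_6^\tau=\kappa\tau\epsilon\tau$, $T_6^\epsilon=\tau\epsilon\kappa\epsilon$, $T_6^\kappa=\epsilon\kappa\tau\kappa$; * length 6: $C_4=\mathbb 1\,S\,S\,\mathbb 1\,S^2\,S^2$, $T_7^\tau=\kappa\tau\epsilon\epsilon\tau\kappa$, $T_7^\epsilon=\tau\epsilon\kappa\kappa\epsilon\tau$, $T_7^\kappa=\epsilon\kappa\tau\tau\kappa\epsilon$. **Theorem.** 1. Let $b\in GL(3,\mathbb C)$ and let $h_0,\dots,h_{N-1}$ be an $N$-cycle in $G_b$.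 Then there is $\sigma\in S_3^N$ with $g_k\propto g_{\sigma_k}$ for all $k$, and either $\sigma$ is trivial ($\sigma_k=\mathbb 1$ for all $k$), or $\sigma$ is a repetition of a string $w$ with $\Gamma(w)=\Gamma(X)$ for an entry $X$ of the table of the same length as $w$. The minimal length of $\sigma$ lies in $\{1,2,3,4,6\}$. 2. Conversely, each entry $X$ of the table has its listed length as its minimal length, and there is $b\in GL(3,\mathbb C)$ such that $A_b$ is normal and the cycle $X$ is in $G_b$. 3. Let $b\in GL(3,\mathbb C)$ and $L$ be such that $X\mapsto\big(\operatorname{tr}(XA_b^{j_1}\cdots A_b^{j_L})\big)_{j_1,\dots,j_L}$ is injective on $3\times3$ matrices (so $A_b$ is normal), let $N\ge 2L+1$, and let $|\Psi\rangle=\sum_{i_0,\dots,i_{N-1}}\operatorname{tr}(A_b^{i_0}\cdots A_b^{i_{N-1}})|i_0\dots i_{N-1}\rangle$. Then the group $\mathcal S_\Psi$ of operators $O=O_0\otimes\dots\otimes O_{N-1}$, $O_k\in GL(2,\mathbb C)$, with $O|\Psi\rangle=|\Psi\rangle$ is finite, and each of its elements is unitary and a scalar multiple of $g_{\sigma_0}\otimes\dots\otimes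 g_{\sigma_{N-1}}$ for some $\sigma\in S_3^N$. For $\sigma\in S_3^N$, some scalar multiple of $g_{\sigma_0}\otimes\dots\otimes g_{\sigma_{N-1}}$ belongs to $\mathcal S_\Psi$ if and only if $\sigma$ is trivial or there is an entry $X$ of the table such that the cycle $X$ is in $G_b$ and $\sigma$ is a repetition of an element of $\Gamma(X)$. -/

import Mathlib

open scoped Matrix Kronecker

noncomputable section

namespace PencilMPS

/-! ### Tripartite (fiducial) states and their local symmetries -/

/-- The cube root of unity `exp (2πi/3)`. -/
def ω : ℂ := Complex.exp (2 * Real.pi * Complex.I / 3)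

/-- Vectors of `ℂ² ⊗ ℂ³ ⊗ ℂ³`, by their coordinates in the standard basis `|i j k⟩`. -/
abbrev TriState : Type := Fin 2 × Fin 3 × Fin 3 → ℂ

/-- `|M(ω)⟩ = |0⟩(|00⟩ + ω|11⟩ + ω²|22⟩) + |1⟩(|00⟩ + |11⟩ + |22⟩)`. -/
def stateM : TriState := fun p =>
  if p.2.1 = p.2.2 then (if p.1 = 0 then ω ^ (p.2.1 : ℕ) else 1) else 0

/-- The fiducial state `(1 ⊗ b ⊗ 1)|M(ω)⟩`. -/
def fiducial (b : GL (Fin 3) ℂ) : TriState :=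
  ((1 : Matrix (Fin 2) (Fin 2) ℂ) ⊗ₖ
    ((b : Matrix (Fin 3) (Fin 3) ℂ) ⊗ₖ (1 : Matrix (Fin 3) (Fin 3) ℂ))) *ᵥ stateM

/-- A triple `(g, x, y)` of invertible matrices, standing for the operator `g ⊗ x ⊗ yᵀ`. -/
structure LocalTriple where
  g : GL (Fin 2) ℂ
  x : GL (Fin 3) ℂ
  y : GL (Fin 3) ℂ

/-- The operator `g ⊗ x ⊗ yᵀ` on `ℂ² ⊗ ℂ³ ⊗ ℂ³`. -/
def LocalTriple.op (h : LocalTriple) :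
    Matrix (Fin 2 × Fin 3 × Fin 3) (Fin 2 × Fin 3 × Fin 3) ℂ :=
  (h.g : Matrix (Fin 2) (Fin 2) ℂ) ⊗ₖ
    ((h.x : Matrix (Fin 3) (Fin 3) ℂ) ⊗ₖ (h.y : Matrix (Fin 3) (Fin 3) ℂ)ᵀ)

/-- The set `G_A` of local symmetries `g ⊗ x ⊗ yᵀ` of a tripartite state. -/
def symmetrySet (A : TriState) : Set LocalTriple := {h | h.op *ᵥ A = A}

/-- `h → h'`: the matrix `y x'` is proportional to the identity. -/
def Concatenates (h h' : LocalTriple) : Prop :=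
  ∃ c : ℂ, c ≠ 0 ∧
    (h.y : Matrix (Fin 3) (Fin 3) ℂ) * (h'.x : Matrix (Fin 3) (Fin 3) ℂ) = c • 1

/-- `h₀ → h₁ → ⋯ → h_{N-1} → h₀` in `G_A` (the addition `k + 1` in `Fin N` is cyclic). -/
def IsCycle (A : TriState) {N : ℕ} [NeZero N] (h : Fin N → LocalTriple) : Prop :=
  (∀ k, h k ∈ symmetrySet A) ∧ ∀ k, Concatenates (h k) (h (k + 1))

/-! ### The six qubit operators, and strings of them -/

/-- Permutations of `{0, 1, 2}`. -/
abbrev S3 : Type := Equiv.Perm (Fin 3)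

/-- The transposition `(0,2,1)`. -/
def τ : S3 := Equiv.swap 1 2
/-- The transposition `(1,0,2)`. -/
def ε : S3 := Equiv.swap 0 1
/-- The transposition `(2,1,0)`. -/
def κ : S3 := Equiv.swap 0 2
/-- The three-cycle `(1,2,0)`, that is `0 ↦ 1`, `1 ↦ 2`, `2 ↦ 0`. -/
def S : S3 := finRotate 3
/-- The three-cycle `(2,0,1)`, that is `0 ↦ 2`, `1 ↦ 0`, `2 ↦ 1`. -/
def S2 : S3 := S * S

/-- The qubit operators `g_σ`. -/
def qubitOp (σ : S3) : Matrix (Fin 2) (Fin 2) ℂ :=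
  if σ = τ then !![0, 1; 1, 0]
  else if σ = κ then !![0, ω ^ 2; 1, 0]
  else if σ = ε then !![0, ω; 1, 0]
  else if σ = S2 then !![ω, 0; 0, 1]
  else if σ = S then !![ω ^ 2, 0; 0, 1]
  else 1

/-- There is an `N`-cycle in `G_A` with physical operators `g_{σ 0}, …, g_{σ (N-1)}`. -/
def HasCycle (A : TriState) {N : ℕ} [NeZero N] (σ : Fin N → S3) : Prop :=
  ∃ h : Fin N → LocalTriple, IsCycle A h ∧
    ∀ k, ((h k).g : Matrix (Fin 2) (Fin 2) ℂ) = qubitOp (σ k)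

/-- The string `s` of length `N` is the string `w` of length `m`, repeated `N / m` times. -/
def IsRepetition {m N : ℕ} (w : Fin m → S3) (s : Fin N → S3) : Prop :=
  m ∣ N ∧ ∀ (k : Fin N) (j : Fin m), (k : ℕ) % m = j → s k = w j

/-- `m` is the length of the shortest string of which `s` is a repetition. -/
def IsMinimalLength {N : ℕ} (s : Fin N → S3) (m : ℕ) : Prop :=
  IsLeast {m : ℕ | 0 < m ∧ ∃ w : Fin m → S3, IsRepetition w s} m

/-- The group generated, under site-wise multiplication, by a string and all its cyclic
translates. -/
def generatedGroup {m : ℕ} (w : Fin m → S3) : Subgroup (Fin m → S3) :=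
  Subgroup.closure (Set.range fun j : Fin m => fun k : Fin m => w (k + j))

/-! ### The table of cycles -/

/-- The labels of the table; `ccw` and `cw` stand for `↺` and `↻`. -/
inductive CycleLabel where
  | C0 | T0τ | T0ε | T0κ
  | C1 | T1τ | T1ε | T1κ | T2τ | T2ε | T2κ
  | C2 | T3τ | T3ε | T3κ | T4ccw | T4cw | T5ccw | T5cw
  | C3 | T6τ | T6ε | T6κ
  | C4 | T7τ | T7ε | T7κ

/-- The entries of the table, as lists. -/
def CycleLabel.list : CycleLabel → List S3
  | .C0 => [S]
  | .T0τ => [τ]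
  | .T0ε => [ε]
  | .T0κ => [κ]
  | .C1 => [S, S2]
  | .T1τ => [1, τ]
  | .T1ε => [1, ε]
  | .T1κ => [1, κ]
  | .T2τ => [ε, κ]
  | .T2ε => [τ, κ]
  | .T2κ => [τ, ε]
  | .C2 => [1, S, S2]
  | .T3τ => [1, τ, τ]
  | .T3ε => [1, ε, ε]
  | .T3κ => [1, κ, κ]
  | .T4ccw => [τ, κ, ε]
  | .T4cw => [τ, ε, κ]
  | .T5ccw => [τ, τ, κ]
  | .T5cw => [τ, τ, ε]
  | .C3 => [1, S, 1, S2]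
  | .T6τ => [κ, τ, ε, τ]
  | .T6ε => [τ, ε, κ, ε]
  | .T6κ => [ε, κ, τ, κ]
  | .C4 => [1, S, S, 1, S2, S2]
  | .T7τ => [κ, τ, ε, ε, τ, κ]
  | .T7ε => [τ, ε, κ, κ, ε, τ]
  | .T7κ => [ε, κ, τ, τ, κ, ε]

/-- The length of a cycle of the table. -/
abbrev CycleLabel.length (X : CycleLabel) : ℕ := X.list.length

/-- A cycle of the table, as a string of permutations. -/
def CycleLabel.word (X : CycleLabel) : Fin X.length → S3 := X.list.get

instance CycleLabel.instNeZeroLength (X : CycleLabel) : NeZero X.length :=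
  ⟨by cases X <;> simp [CycleLabel.length, CycleLabel.list]⟩

/-! ### Matrix product states -/

/-- The matrices `A⁰, A¹` of a tripartite state `∑ A^i_{jk} |i j k⟩`. -/
def tensor (A : TriState) (i : Fin 2) : Matrix (Fin 3) (Fin 3) ℂ :=
  Matrix.of fun j k => A (i, j, k)

/-- The product `A^{s 0} A^{s 1} ⋯ A^{s (N-1)}`. -/
def tensorProd (A : TriState) {N : ℕ} (s : Fin N → Fin 2) : Matrix (Fin 3) (Fin 3) ℂ :=
  (List.ofFn fun k => tensor A (s k)).prod

/-- The coordinates `tr (A^{s 0} ⋯ A^{s (N-1)})` of the translationally invariant matrix product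
state on `N` qubits generated by `A`. -/
def mps (A : TriState) (N : ℕ) : (Fin N → Fin 2) → ℂ := fun s => (tensorProd A s).trace

/-- Blocking `L` sites gives an injective tensor. -/
def IsInjectivityLength (A : TriState) (L : ℕ) : Prop :=
  Function.Injective fun (X : Matrix (Fin 3) (Fin 3) ℂ) (s : Fin L → Fin 2) =>
    (X * tensorProd A s).trace

/-- Normality of the tensor `A`. -/
def IsNormal (A : TriState) : Prop := ∃ L, IsInjectivityLength A L

/-- The operator `g₀ ⊗ ⋯ ⊗ g_{N-1}` on `N` qubits. -/
def localOp {N : ℕ} (g : Fin N → Matrix (Fin 2) (Fin 2) ℂ) :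
    Matrix (Fin N → Fin 2) (Fin N → Fin 2) ℂ :=
  Matrix.of fun s t => ∏ k, g k (s k) (t k)

/-- The invertible local symmetries of a state of `N` qubits. -/
def localSymmetries {N : ℕ} (Ψ : (Fin N → Fin 2) → ℂ) :
    Set (Matrix (Fin N → Fin 2) (Fin N → Fin 2) ℂ) :=
  {O | (∃ g : Fin N → GL (Fin 2) ℂ,
    O = localOp fun k => (g k : Matrix (Fin 2) (Fin 2) ℂ)) ∧ O *ᵥ Ψ = Ψ}

end PencilMPS

end

namespace PencilMPS

/-! ### The cube root of unity -/

/-! With Ω = diag(1, ω, ω²) the tensors are A⁰ = bΩ and A¹ = b. A symmetry g ⊗ x ⊗ yᵀ must respect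
the pencil spanned by Ω and 1, so M = b⁻¹xb can have a nonzero entry at (i, j) only if the
fractional linear map of g sends ω^j to ω^i. Hence M is monomial, g is a multiple of some g_σ, and M
determines the symmetry up to scalars (`exists_isMono_core`). The condition y x' ∝ 1 becomes M' ∝ c
M c⁻¹ with c = b⁻¹Ω, the `driver`. Cycles are thus periodic sequences of monomial matrices, each the
conjugate of the previous one by a fixed c (`hasCycle_iff`).

It remains to find the possible sequences of permutation patterns. If c is monomial, its pattern
conjugates each one to the next. Otherwise c cannot map axis-separating diagonal matrices to
diagonal ones. Patterns that are all rotations have diagonal commutators, which c maps to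
commutators; the ones needed are therefore scalar, and Heisenberg-type relations give a recurrence
n(k+2) = t n(k+1) − n(k) over ℤ/3 (`rotation_recurrence`). If all patterns are reflections, the same
applies to successive quotients. If both kinds occur, traces exclude nontrivial rotations,
eigenvalues exclude a second reflection (`reflection_unique`), and the matrices fall into at most
three classes modulo diagonal matrices commuting with c, which forces period two or three
(`mixed_period`). All these sequences have period 12, so a finite computation compares them with the
table (`HasString.classification`).

For existence, Fourier and chirp matrices, times Heisenberg matrices, act on reflections by affine
maps of (ℤ/3)²; this realizes T4 to T7, and most other entries lie in the groups of these. T1 and T3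
come from real matrices c that permute reflections of ℂ³.

For the state Ψ, uniqueness of injective matrix product representations turns a local symmetry into
a cycle (`exists_cycle_of_symmetry`), and a cycle telescopes back to a symmetry. Normality moreover
makes a sequence close up, to a scalar, as soon as its patterns repeat (`HasString.of_repetition`).
Since Ψ ≠ 0 and each symmetry is a multiple of a unitary fixing Ψ, the group is finite and unitary.
-/

lemma omega_primitive : IsPrimitiveRoot ω 3 := by
  have h := Complex.isPrimitiveRoot_exp 3 (by norm_num)
  simpa [ω] using h

lemma omega_pow_three : ω ^ 3 = 1 := omega_primitive.pow_eq_one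

lemma omega_ne_zero : ω ≠ 0 := omega_primitive.ne_zero (by norm_num)

lemma omega_sq : ω ^ 2 = -1 - ω := by
  have h := omega_primitive.geom_sum_eq_zero (by norm_num)
  simp [Finset.sum_range_succ] at h
  linear_combination h

lemma norm_omega : ‖ω‖ = 1 := omega_primitive.norm'_eq_one (by norm_num)

lemma star_omega : star ω = ω ^ 2 := by
  have h : ω * star ω = 1 := by
    rw [Complex.star_def, Complex.mul_conj, Complex.normSq_eq_norm_sq, norm_omega]; simp
  linear_combination (ω ^ 2) * h - (star ω) * omega_pow_three

/-! ### Three by three matrices -/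

/-- Three by three complex matrices. -/
abbrev Mat3 : Type := Matrix (Fin 3) (Fin 3) ℂ

/-- The clock matrix `diag (1, ω, ω²)`. -/
noncomputable def clock : Mat3 := Matrix.diagonal fun i => ω ^ (i : ℕ)

lemma clock_apply (i j : Fin 3) : clock i j = if i = j then ω ^ (i : ℕ) else 0 := by
  simp [clock, Matrix.diagonal_apply]

lemma det_clock : clock.det = 1 := by
  simp only [clock, Matrix.det_diagonal, Fin.prod_univ_three]
  simp [← pow_succ', omega_pow_three]

lemma clock_pow_three : clock ^ 3 = 1 := by
  rw [clock, Matrix.diagonal_pow]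
  ext i j
  by_cases h : i = j
  · subst h
    rw [Matrix.diagonal_apply_eq, Matrix.one_apply_eq, Pi.pow_apply, pow_right_comm,
      omega_pow_three, one_pow]
  · simp [h]

/-- `M` is monomial with nonzero entries exactly at the places `(i, σ i)`. -/
def IsMono (M : Mat3) (σ : S3) : Prop := ∀ i j, M i j ≠ 0 ↔ σ i = j

/-- `c M c⁻¹` and `M'` are proportional. -/
def ConjTo (c M M' : Mat3) : Prop := ∃ z : ℂ, z ≠ 0 ∧ c * M = z • (M' * c)

namespace IsMono

variable {M M' : Mat3} {σ ρ : S3}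

lemma apply_ne_zero (h : IsMono M σ) (i : Fin 3) : M i (σ i) ≠ 0 := (h i _).2 rfl

lemma apply_eq_zero (h : IsMono M σ) {i j : Fin 3} (hij : σ i ≠ j) : M i j = 0 := by
  by_contra h0
  exact hij ((h i j).1 h0)

lemma apply (h : IsMono M σ) (i j : Fin 3) : M i j = if σ i = j then M i (σ i) else 0 := by
  split_ifs with hij
  · rw [hij]
  · exact h.apply_eq_zero hij

lemma mul_apply_left (h : IsMono M σ) (X : Mat3) (i j : Fin 3) :
    (M * X) i j = M i (σ i) * X (σ i) j := by
  rw [Matrix.mul_apply, Finset.sum_eq_single (σ i)]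
  · intro k _ hk
    rw [h.apply_eq_zero (Ne.symm hk), zero_mul]
  · simp

lemma mul_apply_right (h : IsMono M σ) (X : Mat3) (i j : Fin 3) :
    (X * M) i (σ j) = X i j * M j (σ j) := by
  rw [Matrix.mul_apply, Finset.sum_eq_single j]
  · intro k _ hk
    rw [h.apply_eq_zero (fun e => hk (σ.injective e)), mul_zero]
  · simp

lemma mul (h : IsMono M σ) (h' : IsMono M' ρ) : IsMono (M * M') (ρ * σ) := by
  intro i j
  rw [h.mul_apply_left, mul_ne_zero_iff, h' (σ i) j]
  simp [h.apply_ne_zero]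

lemma smul (h : IsMono M σ) {z : ℂ} (hz : z ≠ 0) : IsMono (z • M) σ := by
  intro i j
  simp [hz, ← h i j]

lemma unique (h : IsMono M σ) (h' : IsMono M ρ) : σ = ρ := by
  ext1 i
  exact ((h' i _).1 (h.apply_ne_zero i)).symm

/-- The inverse of a monomial matrix, explicitly. -/
lemma exists_inv (h : IsMono M σ) : ∃ K : Mat3, IsMono K σ⁻¹ ∧ M * K = 1 := by
  refine ⟨Matrix.of fun i j => if σ j = i then (M j (σ j))⁻¹ else 0, ?_, ?_⟩
  · intro i j
    simp only [Matrix.of_apply, ne_eq, ite_eq_right_iff, inv_eq_zero, Classical.not_imp]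
    rw [Equiv.Perm.inv_def, Equiv.symm_apply_eq]
    constructor
    · exact fun h' => h'.1.symm
    · exact fun h' => ⟨h'.symm, h.apply_ne_zero j⟩
  · ext i j
    rw [h.mul_apply_left]
    by_cases hij : i = j
    · subst hij
      simp [h.apply_ne_zero]
    · simp [hij, Ne.symm hij]

lemma isUnit_det (h : IsMono M σ) : IsUnit M.det := by
  obtain ⟨K, -, hK⟩ := h.exists_inv
  exact Matrix.isUnit_det_of_right_inverse hK

lemma inv (h : IsMono M σ) : IsMono M⁻¹ σ⁻¹ := by
  obtain ⟨K, hK, hK'⟩ := h.exists_inv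
  rwa [Matrix.inv_eq_right_inv hK']

lemma one : IsMono 1 1 := by
  intro i j
  simp [Matrix.one_apply]

lemma pow (h : IsMono M σ) : ∀ n : ℕ, IsMono (M ^ n) (σ ^ n)
  | 0 => by simpa using one
  | n + 1 => by
    rw [pow_succ, pow_succ']
    exact (h.pow n).mul h

end IsMono

lemma isMono_diagonal {d : Fin 3 → ℂ} (hd : ∀ i, d i ≠ 0) : IsMono (Matrix.diagonal d) 1 := by
  intro i j
  by_cases h : i = j
  · subst h; simp [hd]
  · simp [h]

lemma isMono_clock : IsMono clock 1 :=
  isMono_diagonal fun _ => pow_ne_zero _ omega_ne_zero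

lemma IsMono.eq_diagonal {M : Mat3} (h : IsMono M 1) : M = Matrix.diagonal fun i => M i i := by
  ext i j
  rw [h.apply]
  by_cases hij : i = j <;> simp [hij]

/-- An invertible matrix has a permutation of nonzero entries. -/
lemma exists_perm_apply_ne_zero {M : Mat3} (h : M.det ≠ 0) : ∃ σ : S3, ∀ i, M i (σ i) ≠ 0 := by
  rw [← Matrix.det_transpose, Matrix.det_apply] at h
  obtain ⟨σ, -, hσ⟩ := Finset.exists_ne_zero_of_sum_ne_zero h
  refine ⟨σ, fun i hi => hσ ?_⟩
  rw [Finset.prod_eq_zero (Finset.mem_univ i) hi, smul_zero]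

namespace ConjTo

variable {c M M' K K' : Mat3}

lemma one (c : Mat3) : ConjTo c 1 1 := ⟨1, one_ne_zero, by simp⟩

lemma mul (h : ConjTo c M M') (h' : ConjTo c K K') : ConjTo c (M * K) (M' * K') := by
  obtain ⟨z, hz, e⟩ := h
  obtain ⟨w, hw, e'⟩ := h'
  refine ⟨z * w, mul_ne_zero hz hw, ?_⟩
  rw [← mul_assoc, e, smul_mul_assoc, mul_assoc, e', mul_smul_comm, smul_smul, mul_assoc]

lemma inv (hM : IsUnit M.det) (hM' : IsUnit M'.det) (h : ConjTo c M M') : ConjTo c M⁻¹ M'⁻¹ := by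
  obtain ⟨z, hz, e⟩ := h
  refine ⟨z⁻¹, inv_ne_zero hz, ?_⟩
  have h1 : M'⁻¹ * (c * M) * M⁻¹ = M'⁻¹ * (z • (M' * c)) * M⁻¹ := by rw [e]
  rw [mul_smul_comm, ← mul_assoc M'⁻¹ M', Matrix.nonsing_inv_mul _ hM', one_mul, ← mul_assoc,
    mul_assoc _ M, Matrix.mul_nonsing_inv _ hM, mul_one, smul_mul_assoc] at h1
  rw [h1, smul_smul, inv_mul_cancel₀ hz, one_smul]

lemma pow (h : ConjTo c M M') : ∀ n : ℕ, ConjTo c (M ^ n) (M' ^ n)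
  | 0 => by simpa using one c
  | n + 1 => by
    rw [pow_succ, pow_succ]
    exact (h.pow n).mul h

lemma smul_left (h : ConjTo c M M') {z : ℂ} (hz : z ≠ 0) : ConjTo c (z • M) M' := by
  obtain ⟨w, hw, e⟩ := h
  exact ⟨z * w, mul_ne_zero hz hw, by rw [mul_smul_comm, e, smul_smul]⟩

lemma smul_right (h : ConjTo c M M') {z : ℂ} (hz : z ≠ 0) : ConjTo c M (z • M') := by
  obtain ⟨w, hw, e⟩ := h
  refine ⟨w / z, div_ne_zero hw hz, ?_⟩
  rw [e, smul_mul_assoc, smul_smul, div_mul_cancel₀ _ hz]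

/-- `M'` is determined by `M` up to a factor. -/
lemma right_unique (hc : IsUnit c.det) (h : ConjTo c M M') (h' : ConjTo c M K') :
    ∃ z : ℂ, z ≠ 0 ∧ K' = z • M' := by
  obtain ⟨z, hz, e⟩ := h
  obtain ⟨w, hw, e'⟩ := h'
  refine ⟨z / w, div_ne_zero hz hw, ?_⟩
  have h1 : (w • K') * c * c⁻¹ = (z • M') * c * c⁻¹ := by
    rw [smul_mul_assoc w, smul_mul_assoc z, ← e, ← e']
  rw [Matrix.mul_nonsing_inv_cancel_right _ _ hc, Matrix.mul_nonsing_inv_cancel_right _ _ hc] at h1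
  rw [div_eq_inv_mul, ← smul_smul, ← h1, smul_smul, inv_mul_cancel₀ hw, one_smul]

/-- `M` is determined by `M'` up to a factor. -/
lemma left_unique (hc : IsUnit c.det) (h : ConjTo c M M') (h' : ConjTo c K M') :
    ∃ z : ℂ, z ≠ 0 ∧ K = z • M := by
  obtain ⟨z, hz, e⟩ := h
  obtain ⟨w, hw, e'⟩ := h'
  refine ⟨w / z, div_ne_zero hw hz, ?_⟩
  have h1 : c⁻¹ * (c * K) = c⁻¹ * (c * ((w / z) • M)) := by
    rw [e', Matrix.mul_smul c (w / z) M, e, smul_smul, div_mul_cancel₀ _ hz]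
  rwa [Matrix.nonsing_inv_mul_cancel_left _ _ hc, Matrix.nonsing_inv_mul_cancel_left _ _ hc] at h1

lemma comp {c' M'' : Mat3} (h : ConjTo c M M') (h' : ConjTo c' M' M'') :
    ConjTo (c' * c) M M'' := by
  obtain ⟨z, hz, e⟩ := h
  obtain ⟨w, hw, e'⟩ := h'
  refine ⟨z * w, mul_ne_zero hz hw, ?_⟩
  rw [mul_assoc, e, mul_smul_comm, ← mul_assoc, e', smul_mul_assoc, smul_smul, mul_assoc]

end ConjTo

end PencilMPS

namespace PencilMPS

/-! ### Symmetries of the fiducial state as monomial matrices -/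

lemma S3_cases (σ : S3) : σ = 1 ∨ σ = S ∨ σ = S2 ∨ σ = τ ∨ σ = ε ∨ σ = κ := by
  revert σ; decide

lemma qubitOp_one : qubitOp 1 = 1 := by
  rw [qubitOp, if_neg (by decide), if_neg (by decide), if_neg (by decide), if_neg (by decide),
    if_neg (by decide)]

lemma qubitOp_S : qubitOp S = !![ω ^ 2, 0; 0, 1] := by
  rw [qubitOp, if_neg (by decide), if_neg (by decide), if_neg (by decide), if_neg (by decide),
    if_pos rfl]

lemma qubitOp_S2 : qubitOp S2 = !![ω, 0; 0, 1] := by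
  rw [qubitOp, if_neg (by decide), if_neg (by decide), if_neg (by decide), if_pos rfl]

lemma qubitOp_τ : qubitOp τ = !![0, 1; 1, 0] := by rw [qubitOp, if_pos rfl]

lemma qubitOp_ε : qubitOp ε = !![0, ω; 1, 0] := by
  rw [qubitOp, if_neg (by decide), if_neg (by decide), if_pos rfl]

lemma qubitOp_κ : qubitOp κ = !![0, ω ^ 2; 1, 0] := by
  rw [qubitOp, if_neg (by decide), if_pos rfl]

lemma det_qubitOp_ne_zero (σ : S3) : (qubitOp σ).det ≠ 0 := by
  rcases S3_cases σ with rfl | rfl | rfl | rfl | rfl | rfl <;>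
    simp [qubitOp_one, qubitOp_S, qubitOp_S2, qubitOp_τ, qubitOp_ε, qubitOp_κ, omega_ne_zero]

/-- The permutations of the powers of `ω` that are induced by fractional linear maps. -/
def MobiusRel (g : Matrix (Fin 2) (Fin 2) ℂ) (σ : S3) : Prop :=
  ∀ i, g 0 0 * ω ^ (σ i : ℕ) + g 0 1 = ω ^ (i : ℕ) * (g 1 0 * ω ^ (σ i : ℕ) + g 1 1)

lemma perm_values : (S 0 = 1 ∧ S 1 = 2 ∧ S 2 = 0) ∧ (S2 0 = 2 ∧ S2 1 = 0 ∧ S2 2 = 1) ∧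
    (τ 0 = 0 ∧ τ 1 = 2 ∧ τ 2 = 1) ∧ (ε 0 = 1 ∧ ε 1 = 0 ∧ ε 2 = 2) ∧
    (κ 0 = 2 ∧ κ 1 = 1 ∧ κ 2 = 0) := by decide

lemma mobiusRel_qubitOp (σ : S3) : MobiusRel (qubitOp σ) σ := by
  obtain ⟨⟨s0, s1, s2⟩, ⟨r0, r1, r2⟩, ⟨t0, t1, t2⟩, ⟨e0, e1, e2⟩, ⟨k0, k1, k2⟩⟩ := perm_values
  have hw := omega_sq
  rcases S3_cases σ with rfl | rfl | rfl | rfl | rfl | rfl <;> intro i <;> fin_cases i <;>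
    simp [qubitOp_one, qubitOp_S, qubitOp_S2, qubitOp_τ, qubitOp_ε, qubitOp_κ, s0, s1, s2, r0, r1,
      r2, t0, t1, t2, e0, e1, e2, k0, k1, k2] <;> grind

/-- A fractional linear map is determined by its values at three points. The scalar is the
bottom-row entry of g at the place where g_σ has the entry 1. -/
lemma MobiusRel.eq_smul {g : Matrix (Fin 2) (Fin 2) ℂ} {σ : S3} (h : MobiusRel g σ) :
    ∃ z : ℂ, g = z • qubitOp σ := by
  obtain ⟨⟨s0, s1, s2⟩, ⟨r0, r1, r2⟩, ⟨t0, t1, t2⟩, ⟨e0, e1, e2⟩, ⟨k0, k1, k2⟩⟩ := perm_values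
  have hw := omega_sq
  have h0 := h 0
  have h1 := h 1
  have h2 := h 2
  rcases S3_cases σ with rfl | rfl | rfl | rfl | rfl | rfl
  · refine ⟨g 1 1, ?_⟩
    simp at h0 h1 h2
    rw [qubitOp_one]
    ext i j; fin_cases i <;> fin_cases j <;> simp <;> grind
  · refine ⟨g 1 1, ?_⟩
    simp [s0, s1, s2] at h0 h1 h2
    rw [qubitOp_S]
    ext i j; fin_cases i <;> fin_cases j <;> simp <;> grind
  · refine ⟨g 1 1, ?_⟩
    simp [r0, r1, r2] at h0 h1 h2
    rw [qubitOp_S2]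
    ext i j; fin_cases i <;> fin_cases j <;> simp <;> grind
  · refine ⟨g 1 0, ?_⟩
    simp [t0, t1, t2] at h0 h1 h2
    rw [qubitOp_τ]
    ext i j; fin_cases i <;> fin_cases j <;> simp <;> grind
  · refine ⟨g 1 0, ?_⟩
    simp [e0, e1, e2] at h0 h1 h2
    rw [qubitOp_ε]
    ext i j; fin_cases i <;> fin_cases j <;> simp <;> grind
  · refine ⟨g 1 0, ?_⟩
    simp [k0, k1, k2] at h0 h1 h2
    rw [qubitOp_κ]
    ext i j; fin_cases i <;> fin_cases j <;> simp <;> grind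

lemma qubitOp_unique {σ ρ : S3} {z : ℂ} (h : qubitOp σ = z • qubitOp ρ) : σ = ρ := by
  have hz : z ≠ 0 := by
    rintro rfl
    exact det_qubitOp_ne_zero σ (by rw [h]; simp)
  have h1 := mobiusRel_qubitOp σ
  have hu : ∀ i, qubitOp σ 1 0 * ω ^ (i : ℕ) + qubitOp σ 1 1 ≠ 0 := by
    intro i
    rcases S3_cases σ with rfl | rfl | rfl | rfl | rfl | rfl <;>
      simp [qubitOp_one, qubitOp_S, qubitOp_S2, qubitOp_τ, qubitOp_ε, qubitOp_κ, omega_ne_zero]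
  have h2 := mobiusRel_qubitOp ρ
  have h3 : MobiusRel (qubitOp σ) ρ := by
    intro i
    rw [h]
    simp only [Matrix.smul_apply, smul_eq_mul]
    linear_combination z * h2 i
  ext1 i
  have h4 := h1 (σ⁻¹ (ρ i))
  have hs : σ (σ⁻¹ (ρ i)) = ρ i := by simp
  rw [hs, h3 i] at h4
  have h5 := mul_right_cancel₀ (hu _) h4
  have h6 := omega_primitive.pow_inj i.2 (σ⁻¹ (ρ i)).2 h5
  have h7 : i = σ⁻¹ (ρ i) := Fin.ext h6
  rw [h7, hs, ← h7]

/-- The diagonal matrix `g₁₀ Ω + g₁₁` of the qubit operator `g = g_σ`. -/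
noncomputable def twist (σ : S3) : Mat3 := qubitOp σ 1 0 • clock + qubitOp σ 1 1 • 1

lemma twist_eq (σ : S3) :
    twist σ = Matrix.diagonal fun i : Fin 3 => qubitOp σ 1 0 * ω ^ (i : ℕ) + qubitOp σ 1 1 := by
  ext i j
  by_cases h : i = j
  · subst h; simp [twist, clock]
  · simp [twist, clock, h]

lemma isMono_twist (σ : S3) : IsMono (twist σ) 1 := by
  rw [twist_eq]
  refine isMono_diagonal fun i => ?_
  rcases S3_cases σ with rfl | rfl | rfl | rfl | rfl | rfl <;>
    simp [qubitOp_one, qubitOp_S, qubitOp_S2, qubitOp_τ, qubitOp_ε, qubitOp_κ, omega_ne_zero]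

/-- On cube roots of unity X, the map of g_σ is a multiple of X (σ a rotation, denominator 1) or of
X⁻¹ = X² (σ a reflection, denominator X). In both cases it is proportional to X times the
denominator, and this lets Ω absorb the twist. -/
lemma twist_exponents (σ : S3) : ∃ z : ℂ, z ≠ 0 ∧ ∀ i : Fin 3, ω ^ (i : ℕ) =
    z * ((qubitOp σ 1 0 * ω ^ (σ i : ℕ) + qubitOp σ 1 1) * ω ^ (σ i : ℕ)) := by
  obtain ⟨⟨s0, s1, s2⟩, ⟨r0, r1, r2⟩, ⟨t0, t1, t2⟩, ⟨e0, e1, e2⟩, ⟨k0, k1, k2⟩⟩ := perm_values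
  have hn := omega_ne_zero
  have hw := omega_sq
  rcases S3_cases σ with rfl | rfl | rfl | rfl | rfl | rfl
  · refine ⟨1, by simp, fun i => ?_⟩
    simp [qubitOp_one]
  · refine ⟨ω ^ 2, by simpa, fun i => ?_⟩
    fin_cases i <;> simp [qubitOp_S, s0, s1, s2] <;> grind
  · refine ⟨ω, by simpa, fun i => ?_⟩
    fin_cases i <;> simp [qubitOp_S2, r0, r1, r2] <;> grind
  · refine ⟨1, by simp, fun i => ?_⟩
    fin_cases i <;> simp [qubitOp_τ, t0, t1, t2] <;> grind
  · refine ⟨ω, by simpa, fun i => ?_⟩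
    fin_cases i <;> simp [qubitOp_ε, e0, e1, e2] <;> grind
  · refine ⟨ω ^ 2, by simpa, fun i => ?_⟩
    fin_cases i <;> simp [qubitOp_κ, k0, k1, k2] <;> grind

lemma IsMono.clock_mul {M : Mat3} {σ : S3} (h : IsMono M σ) :
    ∃ z : ℂ, z ≠ 0 ∧ clock * M = z • (M * twist σ * clock) := by
  obtain ⟨z, hz, e⟩ := twist_exponents σ
  refine ⟨z, hz, ?_⟩
  ext i j
  rw [mul_assoc, twist_eq, clock, Matrix.diagonal_mul, Matrix.diagonal_mul_diagonal,
    Matrix.smul_apply, Matrix.mul_diagonal, h.apply]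
  split_ifs with hij
  · subst hij
    rw [smul_eq_mul, e i]; ring
  · simp

/-- The diagonal matrices `Ω, 1` of the pencil. -/
noncomputable def pencil (i : Fin 2) : Mat3 := if i = 0 then clock else 1

lemma tensor_fiducial (b : GL (Fin 3) ℂ) (i : Fin 2) :
    tensor (fiducial b) i = (b : Mat3) * pencil i := by
  ext j k
  simp only [tensor, fiducial, Matrix.of_apply, Matrix.mulVec, dotProduct, Matrix.kroneckerMap_apply,
    stateM, Fintype.sum_prod_type, pencil, Matrix.mul_apply, clock]
  fin_cases i <;> fin_cases k <;> simp [Matrix.one_apply, Fin.sum_univ_three]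

lemma mem_symmetrySet {A : TriState} {h : LocalTriple} : h ∈ symmetrySet A ↔
    ∀ i, (h.x : Mat3) * (∑ j, (h.g : Matrix (Fin 2) (Fin 2) ℂ) i j • tensor A j) * (h.y : Mat3) =
      tensor A i := by
  have key : ∀ i j k, (h.op *ᵥ A) (i, j, k) = ((h.x : Mat3) *
      (∑ i', (h.g : Matrix (Fin 2) (Fin 2) ℂ) i i' • tensor A i') * (h.y : Mat3)) j k := by
    intro i j k
    simp only [LocalTriple.op, Matrix.mulVec, dotProduct, Matrix.kroneckerMap_apply,
      Fintype.sum_prod_type, Matrix.mul_apply, Matrix.transpose_apply, tensor, Fin.sum_univ_two,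
      Fin.sum_univ_three, Matrix.add_apply, Matrix.smul_apply, Matrix.of_apply, smul_eq_mul]
    ring
  constructor
  · intro hh i
    ext j k
    rw [← key, show h.op *ᵥ A = A from hh]
    rfl
  · intro hh
    funext ⟨i, j, k⟩
    rw [key, hh]
    rfl

/-- The matrix `b⁻¹ Ω`, conjugation by which drives the cycles in `G_b`. -/
noncomputable def driver (b : GL (Fin 3) ℂ) : Mat3 := ((b⁻¹ : GL (Fin 3) ℂ) : Mat3) * clock

lemma isUnit_det_driver (b : GL (Fin 3) ℂ) : IsUnit (driver b).det := by
  rw [driver, Matrix.det_mul, det_clock, mul_one]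
  exact (Matrix.isUnit_iff_isUnit_det _).1 (b⁻¹).isUnit

lemma GL_mul_inv (b : GL (Fin 3) ℂ) : (b : Mat3) * ((b⁻¹ : GL (Fin 3) ℂ) : Mat3) = 1 := by
  rw [← Units.val_mul, mul_inv_cancel, Units.val_one]

lemma GL_inv_mul (b : GL (Fin 3) ℂ) : ((b⁻¹ : GL (Fin 3) ℂ) : Mat3) * (b : Mat3) = 1 := by
  rw [← Units.val_mul, inv_mul_cancel, Units.val_one]

/-- The conjugate `b⁻¹ x b` of the second factor of a symmetry. -/
noncomputable def LocalTriple.core (h : LocalTriple) (b : GL (Fin 3) ℂ) : Mat3 :=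
  ((b⁻¹ * h.x * b : GL (Fin 3) ℂ) : Mat3)

lemma sum_smul_pencil (g : Matrix (Fin 2) (Fin 2) ℂ) (i : Fin 2) :
    ∑ j, g i j • pencil j =
      Matrix.diagonal fun k : Fin 3 => g i 0 * ω ^ (k : ℕ) + g i 1 := by
  ext j k
  by_cases h : j = k
  · subst h; simp [pencil, clock]
  · simp [pencil, clock, h]

lemma mem_symmetrySet_fiducial {b : GL (Fin 3) ℂ} {h : LocalTriple} :
    h ∈ symmetrySet (fiducial b) ↔ ∀ i, h.core b *
      (∑ j, (h.g : Matrix (Fin 2) (Fin 2) ℂ) i j • pencil j) * (h.y : Mat3) = pencil i := by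
  rw [mem_symmetrySet]
  refine forall_congr' fun i => ?_
  have h1 : (h.x : Mat3) * (∑ j, (h.g : Matrix (Fin 2) (Fin 2) ℂ) i j • tensor (fiducial b) j) *
      (h.y : Mat3) = (b : Mat3) * (h.core b *
      (∑ j, (h.g : Matrix (Fin 2) (Fin 2) ℂ) i j • pencil j) * (h.y : Mat3)) := by
    simp only [tensor_fiducial, LocalTriple.core, Units.val_mul, ← mul_smul_comm,
      ← Finset.mul_sum]
    simp only [← mul_assoc, GL_mul_inv, one_mul]
  rw [h1, tensor_fiducial]
  exact (Units.mul_right_inj b)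

/-- The core of a symmetry is monomial, and determines the symmetry up to scalars. -/
lemma exists_isMono_core {b : GL (Fin 3) ℂ} {h : LocalTriple}
    (hh : h ∈ symmetrySet (fiducial b)) : ∃ (σ : S3) (z : ℂ), z ≠ 0 ∧ IsMono (h.core b) σ ∧
      (h.g : Matrix (Fin 2) (Fin 2) ℂ) = z • qubitOp σ ∧
      h.core b * twist σ * (z • (h.y : Mat3)) = 1 := by
  rw [mem_symmetrySet_fiducial] at hh
  set g := (h.g : Matrix (Fin 2) (Fin 2) ℂ) with hg
  set M := h.core b with hM
  have e0 := hh 0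
  have e1 := hh 1
  rw [sum_smul_pencil] at e0 e1
  have hE : M * Matrix.diagonal (fun k : Fin 3 => g 0 0 * ω ^ (k : ℕ) + g 0 1) =
      clock * (M * Matrix.diagonal fun k : Fin 3 => g 1 0 * ω ^ (k : ℕ) + g 1 1) := by
    have h2 : M * Matrix.diagonal (fun k : Fin 3 => g 0 0 * ω ^ (k : ℕ) + g 0 1) * (h.y : Mat3) =
        clock * (M * Matrix.diagonal fun k : Fin 3 => g 1 0 * ω ^ (k : ℕ) + g 1 1) *
          (h.y : Mat3) := by
      rw [e0, mul_assoc clock, e1]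
      simp [pencil]
    exact (Units.mul_left_inj h.y).1 h2
  -- Every nonzero entry of M records a value of the fractional linear map of g. Injectivity of that
  -- map on the powers of ω will leave one entry in each row and column.
  have hent : ∀ i k, M i k ≠ 0 → g 0 0 * ω ^ (k : ℕ) + g 0 1 =
      ω ^ (i : ℕ) * (g 1 0 * ω ^ (k : ℕ) + g 1 1) := by
    intro i k hik
    have h2 := congrFun (congrFun hE i) k
    rw [clock, Matrix.diagonal_mul, Matrix.mul_diagonal, Matrix.mul_diagonal] at h2
    exact mul_left_cancel₀ hik (by linear_combination h2)
  have hdetM : IsUnit M.det :=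
    (Matrix.isUnit_iff_isUnit_det _).1 (b⁻¹ * h.x * b : GL (Fin 3) ℂ).isUnit
  obtain ⟨σ, hσ⟩ := exists_perm_apply_ne_zero hdetM.ne_zero
  have hmob : MobiusRel g σ := fun i => hent i (σ i) (hσ i)
  obtain ⟨z, hz⟩ := hmob.eq_smul
  have hz0 : z ≠ 0 := by
    rintro rfl
    have h2 : IsUnit g.det := (Matrix.isUnit_iff_isUnit_det _).1 h.g.isUnit
    rw [hz] at h2
    simp at h2
  have hE1 : (Matrix.diagonal fun k : Fin 3 => g 1 0 * ω ^ (k : ℕ) + g 1 1) = z • twist σ := by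
    ext i j
    by_cases hij : i = j
    · subst hij; simp [twist_eq, hz]; ring
    · simp [twist_eq, hij]
  refine ⟨σ, z, hz0, ?_, hz, ?_⟩
  · intro i j
    constructor
    · intro hij
      have h2 := hent i j hij
      have h3 := hmob (σ⁻¹ j)
      have hs : σ (σ⁻¹ j) = j := by simp
      rw [hs, h2] at h3
      have h4 : g 1 0 * ω ^ (j : ℕ) + g 1 1 ≠ 0 := by
        have h5 := congrFun (congrFun hE1 j) j
        rw [Matrix.diagonal_apply_eq] at h5
        rw [h5]
        exact mul_ne_zero hz0 ((isMono_twist σ).apply_ne_zero j)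
      have h5 := omega_primitive.pow_inj i.2 (σ⁻¹ j).2 (mul_right_cancel₀ h4 h3)
      rw [Fin.ext h5, hs]
    · rintro rfl
      exact hσ i
  · rw [hE1] at e1
    simpa [pencil] using e1

/-- There are monomial matrices of the given patterns, each of which is mapped to the next by
conjugation with `c`, up to scalars. -/
def HasString (c : Mat3) {N : ℕ} [NeZero N] (σ : Fin N → S3) : Prop :=
  ∃ M : Fin N → Mat3, (∀ k, IsMono (M k) (σ k)) ∧ ∀ k, ConjTo c (M k) (M (k + 1))

/-- Concatenation gives x' ∝ y⁻¹ ∝ M · twist, where M is the core. Since ΩM ∝ M · twist · Ω, the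
twist disappears in b⁻¹ΩM ∝ M' b⁻¹Ω. -/
lemma IsCycle.exists_string {b : GL (Fin 3) ℂ} {N : ℕ} [NeZero N] {h : Fin N → LocalTriple}
    (hh : IsCycle (fiducial b) h) : ∃ σ : Fin N → S3,
      (∀ k, ∃ z : ℂ, z ≠ 0 ∧ ((h k).g : Matrix (Fin 2) (Fin 2) ℂ) = z • qubitOp (σ k)) ∧
      HasString (driver b) σ := by
  choose σ z hz hM hg hy using fun k => exists_isMono_core (hh.1 k)
  refine ⟨σ, fun k => ⟨z k, hz k, hg k⟩, fun k => (h k).core b, hM, fun k => ?_⟩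
  obtain ⟨w, hw, e⟩ := hh.2 k
  obtain ⟨u, hu, e'⟩ := (hM k).clock_mul
  have hx : ((h (k + 1)).x : Mat3) = (b : Mat3) * (h (k + 1)).core b *
      ((b⁻¹ : GL (Fin 3) ℂ) : Mat3) := by
    rw [LocalTriple.core, ← Units.val_mul, ← Units.val_mul]
    congr 1; group
  have h1 : (w * z k) • ((h k).core b * twist (σ k)) = ((h (k + 1)).x : Mat3) := by
    have h2 := congrArg (fun Y => (h k).core b * twist (σ k) * (z k • Y)) e
    rw [← smul_mul_assoc, ← mul_assoc, hy k, one_mul] at h2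
    rw [h2, mul_smul_comm, mul_smul_comm, mul_one, smul_smul, mul_comm]
  refine ⟨u * (w * z k)⁻¹, mul_ne_zero hu (inv_ne_zero (mul_ne_zero hw (hz k))), ?_⟩
  have h3 : (h k).core b * twist (σ k) = (w * z k)⁻¹ • ((h (k + 1)).x : Mat3) := by
    rw [← h1, smul_smul, inv_mul_cancel₀ (mul_ne_zero hw (hz k)), one_smul]
  rw [driver, mul_assoc, e', h3, hx]
  simp only [mul_smul_comm, smul_mul_assoc, smul_smul]
  simp only [← mul_assoc, GL_inv_mul, one_mul]

/-- The computation of `IsCycle.exists_string` is reversed, with x = b M b⁻¹ and y = (M · twist)⁻¹.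
-/
lemma HasString.hasCycle {b : GL (Fin 3) ℂ} {N : ℕ} [NeZero N] {σ : Fin N → S3}
    (h : HasString (driver b) σ) : HasCycle (fiducial b) σ := by
  obtain ⟨M, hM, hc⟩ := h
  let m : Fin N → GL (Fin 3) ℂ := fun k => Matrix.GeneralLinearGroup.mk'' (M k) (hM k).isUnit_det
  let t : Fin N → GL (Fin 3) ℂ := fun k =>
    Matrix.GeneralLinearGroup.mk'' (twist (σ k)) (isMono_twist _).isUnit_det
  have hm : ∀ k, (m k : Mat3) = M k := fun k => rfl
  have ht : ∀ k, (t k : Mat3) = twist (σ k) := fun k => rfl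
  refine ⟨fun k => ⟨Matrix.GeneralLinearGroup.mk'' (qubitOp (σ k))
    (isUnit_iff_ne_zero.2 (det_qubitOp_ne_zero _)), b * m k * b⁻¹, (m k * t k)⁻¹⟩,
    ⟨fun k => ?_, fun k => ?_⟩, fun k => rfl⟩
  · rw [mem_symmetrySet_fiducial]
    have hcore : LocalTriple.core ⟨Matrix.GeneralLinearGroup.mk'' (qubitOp (σ k))
        (isUnit_iff_ne_zero.2 (det_qubitOp_ne_zero _)), b * m k * b⁻¹, (m k * t k)⁻¹⟩ b = M k := by
      rw [← hm, LocalTriple.core]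
      congr 1
      simp only
      group
    intro i
    rw [hcore]
    change M k * (∑ j, qubitOp (σ k) i j • pencil j) * (((m k * t k)⁻¹ : GL (Fin 3) ℂ) : Mat3) = _
    have h1 : M k * (∑ j, qubitOp (σ k) i j • pencil j) =
        pencil i * ((m k * t k : GL (Fin 3) ℂ) : Mat3) := by
      rw [Units.val_mul, hm, ht, twist_eq, sum_smul_pencil]
      fin_cases i
      · ext i j
        simp only [pencil, clock, Matrix.mul_diagonal, Matrix.diagonal_mul, Fin.zero_eta, if_true]
        rw [(hM k).apply]
        split_ifs with hij
        · subst hij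
          rw [mobiusRel_qubitOp (σ k) i]; ring
        · simp
      · simp [pencil]
    rw [h1, mul_assoc, GL_mul_inv, mul_one]
  · obtain ⟨z, hz, e⟩ := hc k
    obtain ⟨u, hu, e'⟩ := (hM k).clock_mul
    refine ⟨u / z, div_ne_zero hu hz, ?_⟩
    change (((m k * t k)⁻¹ : GL (Fin 3) ℂ) : Mat3) *
      ((b * m (k + 1) * b⁻¹ : GL (Fin 3) ℂ) : Mat3) = _
    have h1 : z • ((b * m (k + 1) * b⁻¹ : GL (Fin 3) ℂ) : Mat3) =
        u • ((m k * t k : GL (Fin 3) ℂ) : Mat3) := by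
      have hk : clock * clock ^ 2 = 1 := by rw [← pow_succ', clock_pow_three]
      have h2 := congrArg (fun Y => (b : Mat3) * Y * clock ^ 2) e
      simp only [driver] at h2
      rw [mul_assoc _ clock, e'] at h2
      simp only [mul_smul_comm, smul_mul_assoc, ← mul_assoc, GL_mul_inv, one_mul] at h2
      rw [mul_assoc _ clock, mul_assoc _ clock, hk, mul_one, mul_one] at h2
      rw [Units.val_mul, Units.val_mul, Units.val_mul, hm, hm, ht, h2]
    have h2 : ((b * m (k + 1) * b⁻¹ : GL (Fin 3) ℂ) : Mat3) =
        (u / z) • ((m k * t k : GL (Fin 3) ℂ) : Mat3) := by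
      rw [div_eq_inv_mul, ← smul_smul, ← h1, smul_smul, inv_mul_cancel₀ hz, one_smul]
    rw [h2, mul_smul_comm, GL_inv_mul]

lemma hasCycle_iff {b : GL (Fin 3) ℂ} {N : ℕ} [NeZero N] {σ : Fin N → S3} :
    HasCycle (fiducial b) σ ↔ HasString (driver b) σ := by
  refine ⟨?_, HasString.hasCycle⟩
  rintro ⟨h, hc, hg⟩
  obtain ⟨ρ, hρ, hs⟩ := hc.exists_string
  suffices σ = ρ by rwa [this]
  funext k
  obtain ⟨z, -, e⟩ := hρ k
  exact qubitOp_unique ((hg k).symm.trans e)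

end PencilMPS

namespace PencilMPS

/-! ### Periodic sequences -/

/-- The periodic sequence that repeats a string. -/
def unroll {α : Type*} {N : ℕ} [NeZero N] (s : Fin N → α) (n : ℕ) : α := s (Fin.ofNat N n)

section unroll

variable {α : Type*} {N m : ℕ} [NeZero N] [NeZero m]

lemma unroll_val (s : Fin N → α) (k : Fin N) : unroll s k = s k := by
  rw [unroll]; congr 1; ext; simp

lemma unroll_add_self (s : Fin N → α) (n : ℕ) : unroll s (n + N) = unroll s n := by
  rw [unroll, unroll]; congr 1; ext; simp

lemma unroll_mod (s : Fin N → α) (n : ℕ) : unroll s (n % N) = unroll s n := by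
  rw [unroll, unroll]; congr 1; ext; simp

lemma unroll_periodic (s : Fin N → α) : Function.Periodic (unroll s) N := unroll_add_self s

lemma ofNat_succ (n : ℕ) : Fin.ofNat N (n + 1) = Fin.ofNat N n + 1 := by
  ext; simp [Fin.val_add, Nat.add_mod]

lemma unroll_succ (s : Fin N → α) (n : ℕ) : unroll s (n + 1) = s (Fin.ofNat N n + 1) := by
  rw [unroll, ofNat_succ]

lemma isRepetition_iff {w : Fin m → S3} {s : Fin N → S3} :
    IsRepetition w s ↔ m ∣ N ∧ ∀ n, unroll s n = unroll w n := by
  refine and_congr_right fun hd => ⟨fun h n => ?_, fun h k j hkj => ?_⟩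
  · rw [unroll, h _ (Fin.ofNat m n), unroll]
    simp [Nat.mod_mod_of_dvd _ hd]
  · rw [← unroll_val s, h, ← unroll_mod, hkj, unroll_val]

lemma periodic_add_mul {f : ℕ → α} {p : ℕ} (h : Function.Periodic f p) (n q : ℕ) :
    f (n + q * p) = f n := by
  simpa using h.nat_mul q n

lemma unroll_restrict {f : ℕ → α} (h : Function.Periodic f N) :
    unroll (fun k : Fin N => f k) = f := by
  funext n
  simpa [unroll] using h.map_mod_nat n

end unroll

/-! ### The group of strings -/

namespace HasString

variable {c : Mat3} {N m : ℕ} [NeZero N] [NeZero m] {σ ρ : Fin N → S3}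

lemma one : HasString c (1 : Fin N → S3) :=
  ⟨fun _ => 1, fun _ => IsMono.one, fun _ => ConjTo.one c⟩

lemma mul (h : HasString c σ) (h' : HasString c ρ) : HasString c (σ * ρ) := by
  obtain ⟨M, hM, hc⟩ := h
  obtain ⟨K, hK, hd⟩ := h'
  exact ⟨fun k => K k * M k, fun k => (hK k).mul (hM k), fun k => (hd k).mul (hc k)⟩

lemma inv (h : HasString c σ) : HasString c σ⁻¹ := by
  obtain ⟨M, hM, hc⟩ := h
  exact ⟨fun k => (M k)⁻¹, fun k => (hM k).inv,
    fun k => (hc k).inv (hM k).isUnit_det (hM _).isUnit_det⟩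

lemma translate (h : HasString c σ) (j : Fin N) : HasString c fun k => σ (k + j) := by
  obtain ⟨M, hM, hc⟩ := h
  refine ⟨fun k => M (k + j), fun k => hM _, fun k => ?_⟩
  simpa only [add_right_comm] using hc (k + j)

lemma of_mem_generatedGroup (h : HasString c σ) (hρ : ρ ∈ generatedGroup σ) : HasString c ρ := by
  induction hρ using Subgroup.closure_induction with
  | mem x hx => obtain ⟨j, rfl⟩ := hx; exact h.translate j
  | one => exact one
  | mul x y _ _ hx hy => exact hx.mul hy
  | inv x _ hx => exact hx.inv

/-- Indices in ℕ free the later arguments from the wrap-around at N. -/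
lemma iff_unroll : HasString c σ ↔ ∃ M : ℕ → Mat3, Function.Periodic M N ∧
    (∀ n, IsMono (M n) (unroll σ n)) ∧ ∀ n, ConjTo c (M n) (M (n + 1)) := by
  constructor
  · rintro ⟨M, hM, hc⟩
    refine ⟨unroll M, unroll_periodic M, fun n => hM _, fun n => ?_⟩
    rw [unroll_succ]
    exact hc _
  · rintro ⟨M, hp, hM, hc⟩
    have hu := unroll_restrict hp
    refine ⟨fun k => M k, fun k => unroll_val σ k ▸ hM k, fun k => ?_⟩
    have h1 : M ((k + 1 : Fin N) : ℕ) = M ((k : ℕ) + 1) := by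
      rw [← hu, unroll_succ, unroll_val]
      congr 2; ext; simp
    change ConjTo c (M k) (M ((k + 1 : Fin N) : ℕ))
    exact h1 ▸ hc k

lemma repetition {w : Fin m → S3} (h : HasString c w) (hr : IsRepetition w σ) :
    HasString c σ := by
  rw [isRepetition_iff] at hr
  obtain ⟨⟨q, rfl⟩, hr⟩ := hr
  obtain ⟨M, hp, hM, hc⟩ := iff_unroll.1 h
  refine iff_unroll.2 ⟨M, fun n => ?_, fun n => hr n ▸ hM n, hc⟩
  rw [mul_comm]
  exact periodic_add_mul hp n q

end HasString

lemma mem_generatedGroup_self {m : ℕ} [NeZero m] (w : Fin m → S3) : w ∈ generatedGroup w :=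
  Subgroup.subset_closure ⟨0, by simp⟩

/-! ### Conjugation of diagonal matrices -/

/-- If conjugation by `c` maps diagonal matrices that separate the axes to diagonal matrices,
then `c` is monomial. -/
lemma exists_isMono_of_separating {c : Mat3} (hc : IsUnit c.det)
    (h : ∀ i j, i ≠ j → ∃ d d' : Fin 3 → ℂ, c * Matrix.diagonal d = Matrix.diagonal d' * c ∧
      d i ≠ d j) : ∃ ρ, IsMono c ρ := by
  obtain ⟨ρ, hρ⟩ := exists_perm_apply_ne_zero hc.ne_zero
  refine ⟨ρ, fun i j => ⟨fun hij => ?_, fun e => e ▸ hρ i⟩⟩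
  by_contra hne
  obtain ⟨d, d', e, hd⟩ := h _ _ hne
  have key : ∀ k, c i k ≠ 0 → d k = d' i := by
    intro k hk
    have h1 := congrFun (congrFun e i) k
    rw [Matrix.mul_diagonal, Matrix.diagonal_mul] at h1
    exact mul_left_cancel₀ hk (by rw [h1, mul_comm])
  exact hd ((key _ (hρ i)).trans (key _ hij).symm)

lemma ConjTo.pattern_eq {c M M' : Mat3} {ρ σ σ' : S3} (h : ConjTo c M M') (hc : IsMono c ρ)
    (hM : IsMono M σ) (hM' : IsMono M' σ') : σ' = ρ⁻¹ * σ * ρ := by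
  obtain ⟨z, hz, e⟩ := h
  have h1 := (hc.mul hM).unique (e ▸ (hM'.mul hc).smul hz)
  rw [mul_assoc, h1, inv_mul_cancel_left]

/-- Each scalar occurs together with its inverse, so the commutator is conjugated exactly and not
just up to a factor. -/
lemma ConjTo.commutator {c A A' B B' : Mat3} (hA : IsUnit A.det) (hA' : IsUnit A'.det)
    (hB : IsUnit B.det) (hB' : IsUnit B'.det) (h : ConjTo c A A') (h' : ConjTo c B B') :
    c * (A * B * (A⁻¹ * B⁻¹)) = A' * B' * (A'⁻¹ * B'⁻¹) * c := by
  obtain ⟨z, hz, e⟩ := h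
  obtain ⟨w, hw, e'⟩ := h'
  have inv_eq : ∀ {X X' : Mat3} {u : ℂ}, IsUnit X.det → IsUnit X'.det → u ≠ 0 →
      c * X = u • (X' * c) → c * X⁻¹ = u⁻¹ • (X'⁻¹ * c) := by
    intro X X' u hX hX' hu e
    have h1 : X'⁻¹ * (c * X) * X⁻¹ = X'⁻¹ * (u • (X' * c)) * X⁻¹ := by rw [e]
    rw [mul_smul_comm, Matrix.nonsing_inv_mul_cancel_left _ _ hX', ← mul_assoc,
      Matrix.mul_nonsing_inv_cancel_right _ _ hX, smul_mul_assoc] at h1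
    rw [h1, smul_smul, inv_mul_cancel₀ hu, one_smul]
  have e1 := inv_eq hA hA' hz e
  have e2 := inv_eq hB hB' hw e'
  calc c * (A * B * (A⁻¹ * B⁻¹)) = c * A * B * A⁻¹ * B⁻¹ := by simp only [mul_assoc]
    _ = z • (A' * (c * B) * A⁻¹ * B⁻¹) := by rw [e]; simp only [smul_mul_assoc, mul_assoc]
    _ = (z * w) • (A' * B' * (c * A⁻¹) * B⁻¹) := by
      rw [e']; simp only [smul_mul_assoc, mul_smul_comm, mul_assoc, smul_smul]
    _ = (z * w * z⁻¹) • (A' * B' * A'⁻¹ * (c * B⁻¹)) := by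
      rw [e1]; simp only [smul_mul_assoc, mul_smul_comm, mul_assoc, smul_smul]
    _ = (z * w * z⁻¹ * w⁻¹) • (A' * B' * A'⁻¹ * B'⁻¹ * c) := by
      rw [e2]; simp only [mul_smul_comm, mul_assoc, smul_smul]
    _ = A' * B' * (A'⁻¹ * B'⁻¹) * c := by
      have : z * w * z⁻¹ * w⁻¹ = 1 := by field_simp
      rw [this, one_smul]; simp only [mul_assoc]

end PencilMPS

namespace PencilMPS

/-! ### Rotations and reflections -/

/-- The rotation `i ↦ i + a` of `ℤ/3`. -/
def rot (a : ZMod 3) : S3 := S ^ a.val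

/-- The reflection `i ↦ a - i` of `ℤ/3`. -/
def refl (a : ZMod 3) : S3 := S ^ a.val * τ

lemma rot_add (a b : ZMod 3) : rot (a + b) = rot a * rot b := by revert a b; decide

lemma rot_zero : rot 0 = 1 := by decide

lemma rot_neg (a : ZMod 3) : rot (-a) = (rot a)⁻¹ := by revert a; decide

lemma rot_injective : Function.Injective rot := by decide

lemma refl_injective : Function.Injective refl := by decide

lemma refl_ne_one (a : ZMod 3) : refl a ≠ 1 := by revert a; decide

lemma rot_or_refl (σ : S3) : (∃ a, σ = rot a) ∨ ∃ a, σ = refl a := by revert σ; decide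

lemma refl_inv_mul (a b : ZMod 3) : (refl a)⁻¹ * refl b = rot (a - b) := by revert a b; decide

lemma rot_pow (a : ZMod 3) (n : ℕ) : rot a ^ n = rot (n * a) := by
  induction n with
  | zero => simp [rot_zero]
  | succ n ih => rw [pow_succ, ih, ← rot_add]; congr 1; push_cast; ring

/-- A function that is invariant under a nontrivial rotation is constant. -/
lemma const_of_rot {α : Type*} {f : Fin 3 → α} {d : ZMod 3} (hd : d ≠ 0)
    (h : ∀ i, f (rot d i) = f i) (i j : Fin 3) : f i = f j := by
  have key : ∀ (d : ZMod 3) (i j : Fin 3), d ≠ 0 → j = i ∨ j = rot d i ∨ j = rot d (rot d i) := by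
    decide
  rcases key d i j hd with rfl | rfl | rfl
  · rfl
  · rw [h]
  · rw [h, h]

lemma exists_rot_translate (i j : Fin 3) (hij : i ≠ j) : ∃ d : ZMod 3, d ≠ 0 ∧
    ∀ (y : Fin 3) (m : ZMod 3), m ≠ 0 → ∃ q : Fin 3, rot ((q : ℕ) * m) i = y ∧
      rot ((q : ℕ) * m) j = rot d y := by
  revert i j; decide

/-! ### Sequences of even patterns -/

/-- A commutator of monomial matrices. -/
noncomputable def commutator (A B : Mat3) : Mat3 := A * B * (A⁻¹ * B⁻¹)

lemma isMono_commutator {A B : Mat3} {a b : S3} (hA : IsMono A a) (hB : IsMono B b) :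
    IsMono (commutator A B) (b⁻¹ * a⁻¹ * (b * a)) := (hA.mul hB).mul (hA.inv.mul hB.inv)

lemma commutator_mul_swap {A B : Mat3} (hA : IsUnit A.det) (hB : IsUnit B.det) :
    commutator A B * (B * A) = A * B := by
  rw [commutator, mul_assoc, ← mul_assoc (A⁻¹ * B⁻¹), mul_assoc A⁻¹, Matrix.nonsing_inv_mul _ hB,
    mul_one, Matrix.nonsing_inv_mul _ hA, mul_one]

lemma isMono_rot_commutator {A B : Mat3} {a b : ZMod 3} (hA : IsMono A (rot a))
    (hB : IsMono B (rot b)) : IsMono (commutator A B) 1 := by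
  have h := isMono_commutator hA hB
  rwa [← rot_neg, ← rot_neg, ← rot_add, ← rot_add, ← rot_add,
    show -b + -a + (b + a) = 0 by ring, rot_zero] at h

lemma IsMono.conj_diagonal {M : Mat3} {σ : S3} (h : IsMono M σ) (d : Fin 3 → ℂ) :
    M * Matrix.diagonal d * M⁻¹ = Matrix.diagonal fun i => d (σ i) := by
  have h1 : M * Matrix.diagonal d = (Matrix.diagonal fun i => d (σ i)) * M := by
    ext i j
    rw [Matrix.mul_diagonal, Matrix.diagonal_mul, h.apply]
    split_ifs with hij
    · rw [hij, mul_comm]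
    · simp
  rw [h1, Matrix.mul_nonsing_inv_cancel_right _ _ h.isUnit_det]

/-- Both orders of the product acquire the same scalar, so the commutation factor q is unchanged. -/
lemma ConjTo.comm_of_comm {c A A' B B' : Mat3} (hc : IsUnit c.det) (h : ConjTo c A A')
    (h' : ConjTo c B B') {q : ℂ} (e : A * B = q • (B * A)) : A' * B' = q • (B' * A') := by
  obtain ⟨z, hz, e1⟩ := h
  obtain ⟨w, hw, e2⟩ := h'
  have h1 : (z * w) • (A' * B' * c) = (z * w) • (q • (B' * A') * c) := by
    have e3 : c * (A * B) = (z * w) • (A' * B' * c) := by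
      rw [← mul_assoc, e1, smul_mul_assoc, mul_assoc A', e2, mul_smul_comm, smul_smul, mul_assoc]
    have e4 : c * (B * A) = (z * w) • (B' * A' * c) := by
      rw [← mul_assoc, e2, smul_mul_assoc, mul_assoc B', e1, mul_smul_comm, smul_smul, mul_assoc,
        mul_comm w]
    rw [← e3, e, mul_smul_comm, e4, smul_comm, smul_mul_assoc]
  have h2 := smul_right_injective _ (mul_ne_zero hz hw) h1
  have h3 := congrArg (· * c⁻¹) h2
  simpa only [Matrix.mul_nonsing_inv_cancel_right _ _ hc] using h3

/-- A sequence of matrices with rotation patterns, each mapped to the next by conjugation with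
`c`: either `c` is monomial, or the rotations satisfy a linear recurrence. -/
lemma rotation_recurrence {c : Mat3} (hc : IsUnit c.det) {M : ℕ → Mat3} {n : ℕ → ZMod 3}
    (hM : ∀ k, IsMono (M k) (rot (n k))) (hs : ∀ k, ConjTo c (M k) (M (k + 1))) :
    (∃ ρ, IsMono c ρ) ∨ ∃ k₀ t, ∀ k ≥ k₀, n (k + 2) = t * n (k + 1) - n k := by
  -- Here n 0 may be nonzero, because M is not assumed periodic; hence k₀ = 1.
  by_cases hn : ∀ k, n (k + 1) = 0
  · refine Or.inr ⟨1, 0, fun k hk => ?_⟩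
    obtain ⟨k, rfl⟩ := Nat.exists_eq_add_of_le' hk
    simp [hn]
  push Not at hn
  obtain ⟨p, hp⟩ := hn
  have hE := isMono_rot_commutator (hM p) (hM (p + 1))
  have hE' := isMono_rot_commutator (hM (p + 1)) (hM (p + 2))
  set e : Fin 3 → ℂ := fun i => commutator (M p) (M (p + 1)) i i with he
  set e' : Fin 3 → ℂ := fun i => commutator (M (p + 1)) (M (p + 2)) i i with he'
  have hEd : commutator (M p) (M (p + 1)) = Matrix.diagonal e := hE.eq_diagonal
  have hEd' : commutator (M (p + 1)) (M (p + 2)) = Matrix.diagonal e' := hE'.eq_diagonal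
  by_cases hconst : ∀ i, e i = e 0
  · right
    have hq : M p * M (p + 1) = e 0 • (M (p + 1) * M p) := by
      rw [← commutator_mul_swap (hM p).isUnit_det (hM (p + 1)).isUnit_det, hEd,
        show e = fun _ => e 0 from funext hconst, ← Matrix.smul_eq_diagonal_mul]
    have hq' := (hs p).comm_of_comm hc (hs (p + 1)) hq
    obtain ⟨t, ht⟩ : ∃ t : ℕ, n (p + 2) + n p = t * n (p + 1) := by
      have : ∀ x y : ZMod 3, x ≠ 0 → ∃ t : Fin 3, y = (t : ℕ) * x := by decide
      obtain ⟨t, ht⟩ := this _ (n (p + 2) + n p) hp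
      exact ⟨t, ht⟩
    -- The factors q from passing M (p+1) through M p and M (p+2) cancel, so M (p+1) commutes with
    -- their product. The choice of t makes D diagonal, and a diagonal matrix commuting with a
    -- matrix whose pattern is a three-cycle is scalar.
    have hT : ∃ z : ℂ, z ≠ 0 ∧ M (p + 2) * M p = z • M (p + 1) ^ t := by
      have hmono : IsMono (M (p + 2) * M p * (M (p + 1) ^ t)⁻¹) 1 := by
        have h1 := ((hM (p + 2)).mul (hM p)).mul (((hM (p + 1)).pow t).inv)
        rwa [rot_pow, ← rot_add, ← ht, add_comm (n p), inv_mul_cancel] at h1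
      set D := M (p + 2) * M p * (M (p + 1) ^ t)⁻¹ with hD
      have hu := ((hM (p + 1)).pow t).isUnit_det
      have hcomm : M (p + 1) * D = D * M (p + 1) := by
        have hcT : M (p + 1) * (M (p + 2) * M p) = M (p + 2) * M p * M (p + 1) := by
          rw [← mul_assoc, hq', smul_mul_assoc, mul_assoc, mul_assoc, hq, mul_smul_comm]
        have hci : M (p + 1) * (M (p + 1) ^ t)⁻¹ = (M (p + 1) ^ t)⁻¹ * M (p + 1) := by
          have h1 : M (p + 1) ^ t * M (p + 1) = M (p + 1) * M (p + 1) ^ t := by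
            rw [← pow_succ, pow_succ']
          calc M (p + 1) * (M (p + 1) ^ t)⁻¹
              = (M (p + 1) ^ t)⁻¹ * (M (p + 1) ^ t * M (p + 1)) * (M (p + 1) ^ t)⁻¹ := by
                rw [Matrix.nonsing_inv_mul_cancel_left _ _ hu]
            _ = _ := by
                rw [h1, mul_assoc, Matrix.mul_nonsing_inv_cancel_right _ _ hu]
        rw [hD, ← mul_assoc, hcT, mul_assoc, hci, ← mul_assoc]
      have hDi : ∀ i : Fin 3, D (rot (n (p + 1)) i) (rot (n (p + 1)) i) = D i i := by
        intro i
        have h1 := congrFun (congrFun hcomm i) (rot (n (p + 1)) i)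
        rw [hmono.eq_diagonal, Matrix.mul_diagonal, Matrix.diagonal_mul, mul_comm] at h1
        exact mul_right_cancel₀ ((hM (p + 1)).apply_ne_zero i) h1
      have hDc := const_of_rot (f := fun i => D i i) hp hDi
      refine ⟨D 0 0, hmono.apply_ne_zero 0, ?_⟩
      have h1 : D = D 0 0 • 1 := by
        ext i j
        rw [hmono.eq_diagonal]
        by_cases hij : i = j
        · subst hij; simp [hDc i 0]
        · simp [hij]
      have h2 : M (p + 2) * M p = D * M (p + 1) ^ t := by
        rw [hD, Matrix.nonsing_inv_mul_cancel_right _ _ hu]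
      rw [h2, h1, smul_mul_assoc, one_mul]
      simp
    -- Conjugation by c propagates the relation with the same t to all later indices.
    have hTk : ∀ j, ∃ z : ℂ, z ≠ 0 ∧ M (p + j + 2) * M (p + j) = z • M (p + j + 1) ^ t := by
      intro j
      induction j with
      | zero => exact hT
      | succ j ih =>
        obtain ⟨z, hz, h1⟩ := ih
        have h2 := (hs (p + j + 2)).mul (hs (p + j))
        rw [h1] at h2
        exact (((hs (p + j + 1)).pow t).smul_left hz).right_unique hc h2
    refine ⟨p, t, fun k hk => ?_⟩
    obtain ⟨j, rfl⟩ := Nat.exists_eq_add_of_le hk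
    obtain ⟨z, hz, h1⟩ := hTk j
    have h2 := ((hM (p + j + 2)).mul (hM (p + j))).unique
      (h1 ▸ ((hM (p + j + 1)).pow t).smul hz)
    rw [rot_pow, ← rot_add] at h2
    linear_combination rot_injective h2
  · left
    refine exists_isMono_of_separating hc fun i j hij => ?_
    -- Conjugation by powers of M (p+1) shifts e cyclically. If no shift separated i from j, then e
    -- would be invariant under a nontrivial rotation and constant.
    obtain ⟨q, hq⟩ : ∃ q : ℕ, e (rot (q * n (p + 1)) i) ≠ e (rot (q * n (p + 1)) j) := by
      by_contra hall
      push Not at hall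
      obtain ⟨d, hd, hrot⟩ := exists_rot_translate i j hij
      refine hconst fun x => const_of_rot hd (fun y => ?_) x 0
      obtain ⟨q, hq1, hq2⟩ := hrot y _ hp
      rw [← hq2, ← hq1, hall]
    have hconj := ((hs p).commutator (hM p).isUnit_det (hM (p + 1)).isUnit_det
      (hM (p + 1)).isUnit_det (hM (p + 2)).isUnit_det (hs (p + 1)))
    have hconj' : ConjTo c (Matrix.diagonal e) (Matrix.diagonal e') :=
      ⟨1, one_ne_zero, by rw [one_smul, ← hEd, ← hEd']; exact hconj⟩
    obtain ⟨z, -, h1⟩ := (((hs (p + 1)).pow q).mul hconj').mul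
      (((hs (p + 1)).pow q).inv ((hM (p + 1)).pow q).isUnit_det ((hM (p + 2)).pow q).isUnit_det)
    rw [((hM (p + 1)).pow q).conj_diagonal, ((hM (p + 2)).pow q).conj_diagonal,
      ← smul_mul_assoc, ← Matrix.diagonal_smul, rot_pow] at h1
    exact ⟨_, _, h1, hq⟩

end PencilMPS

namespace PencilMPS

/-! ### Traces and iterated conjugation -/

lemma ConjTo.trace {c A A' : Mat3} (hc : IsUnit c.det) (h : ConjTo c A A') :
    ∃ z : ℂ, z ≠ 0 ∧ A.trace = z * A'.trace := by
  obtain ⟨z, hz, e⟩ := h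
  refine ⟨z, hz, ?_⟩
  have h1 : A = z • (c⁻¹ * (A' * c)) := by
    rw [← mul_smul_comm, ← e, Matrix.nonsing_inv_mul_cancel_left _ _ hc]
  rw [h1, Matrix.trace_smul, Matrix.trace_mul_comm, Matrix.mul_nonsing_inv_cancel_right _ _ hc,
    smul_eq_mul]

/-- One scalar z serves all powers, so homogeneous identities between power sums of eigenvalues pass
from A to A'. -/
lemma ConjTo.trace_pow {c A A' : Mat3} (hc : IsUnit c.det) (h : ConjTo c A A') :
    ∃ z : ℂ, z ≠ 0 ∧ ∀ n : ℕ, (A ^ n).trace = z ^ n * (A' ^ n).trace := by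
  obtain ⟨z, hz, e⟩ := h
  refine ⟨z, hz, fun n => ?_⟩
  have h1 : c * A ^ n = z ^ n • (A' ^ n * c) := by
    induction n with
    | zero => simp
    | succ n ih =>
      rw [pow_succ, ← mul_assoc, ih, smul_mul_assoc, mul_assoc, e, mul_smul_comm, smul_smul,
        ← mul_assoc, ← pow_succ, ← pow_succ]
  have h2 : A ^ n = z ^ n • (c⁻¹ * (A' ^ n * c)) := by
    rw [← mul_smul_comm, ← h1, Matrix.nonsing_inv_mul_cancel_left _ _ hc]
  rw [h2, Matrix.trace_smul, Matrix.trace_mul_comm, Matrix.mul_nonsing_inv_cancel_right _ _ hc,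
    smul_eq_mul]

lemma ConjTo.iterate {c : Mat3} {M : ℕ → Mat3} (hs : ∀ k, ConjTo c (M k) (M (k + 1)))
    (k : ℕ) : ∀ d, ConjTo (c ^ d) (M k) (M (k + d))
  | 0 => ⟨1, one_ne_zero, by simp⟩
  | d + 1 => by
    rw [pow_succ']
    exact (ConjTo.iterate hs k d).comp (hs (k + d))

/-- Adding p * N to an index does not change f and moves the index past p. -/
lemma periodic_of_eventually {α : Type*} {f : ℕ → α} {N a p : ℕ} (hN : 0 < N)
    (hf : Function.Periodic f N) (h : ∀ j, f (p + j + a) = f (p + j)) (k : ℕ) :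
    f (k + a) = f k := by
  have h1 := h (k + p * (N - 1))
  have h2 : p + (k + p * (N - 1)) = k + p * N := by
    obtain ⟨n, rfl⟩ : ∃ n, N = n + 1 := ⟨N - 1, by omega⟩
    simp; ring
  rw [h2, show k + p * N + a = k + a + p * N by ring, periodic_add_mul hf,
    periodic_add_mul hf] at h1
  exact h1

lemma refl_mul (a b : ZMod 3) : refl a * refl b = rot (a - b) := by revert a b; decide

lemma refl_pow_three (a : ZMod 3) : refl a ^ 3 = refl a := by revert a; decide

lemma IsMono.trace_rot {M : Mat3} {a : ZMod 3} (ha : a ≠ 0) (h : IsMono M (rot a)) :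
    M.trace = 0 := by
  have key : ∀ (a : ZMod 3) (i : Fin 3), a ≠ 0 → rot a i ≠ i := by decide
  exact Finset.sum_eq_zero fun i _ => h.apply_eq_zero (key a i ha)

lemma exists_refl_fixed (a : ZMod 3) :
    ∃ f : Fin 3, refl a f = f ∧ ∀ i, i ≠ f → refl a i ≠ i := by
  revert a; decide

lemma IsMono.trace_refl {M : Mat3} {a : ZMod 3} {f : Fin 3} (hf : refl a f = f)
    (h : IsMono M (refl a)) : M.trace = M f f := by
  have key : ∀ (a : ZMod 3) (f i : Fin 3), refl a f = f → i ≠ f → refl a i ≠ i := by decide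
  exact Finset.sum_eq_single f (fun i _ hi => h.apply_eq_zero (key a f i hf hi)) (by simp)

lemma IsMono.trace_refl_ne_zero {M : Mat3} {a : ZMod 3} (h : IsMono M (refl a)) :
    M.trace ≠ 0 := by
  obtain ⟨f, hf, -⟩ := exists_refl_fixed a
  rw [h.trace_refl hf]
  have := h.apply_ne_zero f
  rwa [hf] at this

/-- The eigenvalues are λ, μ, −μ with λ the entry at the fixed point. This identity transports to
diagonal matrices conjugate to M and there says that two entries are opposite. -/
lemma IsMono.trace_refl_pow_three {M : Mat3} {a : ZMod 3} (h : IsMono M (refl a)) :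
    (M ^ 3).trace = M.trace ^ 3 := by
  obtain ⟨f, hf, -⟩ := exists_refl_fixed a
  have h3 : IsMono (M ^ 3) (refl a) := by
    have h1 := h.pow 3
    rwa [refl_pow_three] at h1
  rw [h3.trace_refl hf, h.trace_refl hf, pow_succ, pow_two, mul_assoc, h.mul_apply_left, hf,
    h.mul_apply_left, hf]
  ring

/-- Nonzero numbers two of which add up to zero are not mapped to the cube roots of unity, up to a
scalar, by multiplying them with a permutation of themselves. -/
lemma no_permuted_product {u v : Fin 3 → ℂ} {z : ℂ} (π : S3) (hu : ∀ i, u i ≠ 0)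
    (hv : ∀ i, u (π i) = z * v i)
    (hs : (∑ i, u i) ^ 3 = ∑ i, u i ^ 3) (h1 : ∑ i, u i * v i = 0)
    (h2 : ∑ i, (u i * v i) ^ 2 = 0) : False := by
  have h1' : ∑ i, u i * u (π i) = 0 := by
    simp only [hv, mul_left_comm _ z, ← Finset.mul_sum, h1, mul_zero]
  have h2' : ∑ i, (u i * u (π i)) ^ 2 = 0 := by
    simp only [hv, mul_left_comm _ z, mul_pow z, ← Finset.mul_sum, h2, mul_zero]
  simp only [Fin.sum_univ_three] at hs h1' h2'
  have hx := hu 0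
  have hy := hu 1
  have hw := hu 2
  -- The cube of a sum of three numbers minus the sum of their cubes is three times the product of
  -- the pairwise sums.
  have hs' : (u 0 + u 1) * ((u 1 + u 2) * (u 0 + u 2)) = 0 := by linear_combination hs / 3
  obtain ⟨⟨s0, s1, s2⟩, ⟨r0, r1, r2⟩, ⟨t0, t1, t2⟩, ⟨e0, e1, e2⟩, ⟨k0, k1, k2⟩⟩ := perm_values
  simp only [mul_eq_zero] at hs'
  have e : u 0 = - u 1 ∨ u 1 = - u 2 ∨ u 2 = - u 0 := by
    rcases hs' with h | h | h
    · exact Or.inl (by linear_combination h)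
    · exact Or.inr (Or.inl (by linear_combination h))
    · exact Or.inr (Or.inr (by linear_combination h))
  clear hs hs' h1 h2 hv hu
  rcases S3_cases π with rfl | rfl | rfl | rfl | rfl | rfl <;>
  simp only [Equiv.Perm.coe_one, id_eq, s0, s1, s2, r0, r1, r2, t0, t1, t2, e0, e1, e2, k0, k1,
    k2] at h1' h2' <;> rcases e with e | e | e <;> rw [e] at h1' h2' <;> grind

/-- If reflections and the identity both occur as patterns, then only one reflection does. -/
lemma reflection_unique {c : Mat3} (hc : IsUnit c.det) {M : ℕ → Mat3} {s : ℕ → S3} {N : ℕ}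
    (hN : 0 < N) (hp : Function.Periodic s N)
    (hM : ∀ k, IsMono (M k) (s k)) (hs : ∀ k, ConjTo c (M k) (M (k + 1)))
    (h1 : ∀ k, s k = 1 ∨ ∃ a, s k = refl a) (hex : ∃ k, s k = 1) {i j : ℕ} {a b : ZMod 3}
    (hij : i ≤ j) (hi : s i = refl a) (hj : s j = refl b) : a = b := by
  by_contra hab
  obtain ⟨d, rfl⟩ := Nat.exists_eq_add_of_le hij
  have hQ : ∀ n, ConjTo (c ^ n) (M i * M (i + d)) (M (i + n) * M (i + n + d)) := by
    intro n
    rw [show i + n + d = i + d + n by ring]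
    exact (ConjTo.iterate hs i n).mul (ConjTo.iterate hs (i + d) n)
  have hcn : ∀ n, IsUnit (c ^ n).det := fun n => by rw [Matrix.det_pow]; exact hc.pow n
  have hQ0 : IsMono (M i * M (i + d)) (rot (b - a)) := by
    have h := (hM i).mul (hM (i + d))
    rwa [hi, hj, refl_mul] at h
  have hba : b - a ≠ 0 := sub_ne_zero.2 (Ne.symm hab)
  have hQ2 : IsMono ((M i * M (i + d)) ^ 2) (rot (2 * (b - a))) := by
    simpa [rot_pow] using hQ0.pow 2
  have hba2 : 2 * (b - a) ≠ 0 := by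
    have : ∀ x : ZMod 3, x ≠ 0 → 2 * x ≠ 0 := by decide
    exact this _ hba
  -- The product of two different reflections has a nontrivial rotation as pattern. It and its
  -- square are traceless, and conjugation preserves this along the whole sequence.
  have htr : ∀ n, (M (i + n) * M (i + n + d)).trace = 0 ∧
      ((M (i + n) * M (i + n + d)) ^ 2).trace = 0 := by
    intro n
    obtain ⟨z, hz, e⟩ := (hQ n).trace_pow (hcn n)
    have e1 := e 1
    have e2 := e 2
    rw [pow_one, pow_one, pow_one, hQ0.trace_rot hba] at e1
    rw [hQ2.trace_rot hba2] at e2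
    exact ⟨(mul_eq_zero.1 e1.symm).resolve_left hz,
      (mul_eq_zero.1 e2.symm).resolve_left (pow_ne_zero 2 hz)⟩
  obtain ⟨k, hk⟩ := hex
  obtain ⟨n, hn⟩ : ∃ n, s (i + n) = 1 := by
    refine ⟨k + i * N - i, ?_⟩
    have : i ≤ i * N := Nat.le_mul_of_pos_right i hN
    rw [show i + (k + i * N - i) = k + i * N by omega, periodic_add_mul hp, hk]
  have hu := hM (i + n)
  rw [hn] at hu
  have hv := hM (i + n + d)
  rcases h1 (i + n + d) with hnd | ⟨x, hnd⟩
  -- Both factors are diagonal and conjugate up to a scalar by c ^ d. A nonzero entry of c ^ d in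
  -- each row, along a permutation π, matches their eigenvalues.
  · rw [hnd] at hv
    obtain ⟨z, hz, e⟩ := ConjTo.iterate hs (i + n) d
    rw [hu.eq_diagonal, hv.eq_diagonal] at e
    obtain ⟨π, hπ⟩ := exists_perm_apply_ne_zero (hcn d).ne_zero
    obtain ⟨t1, t2⟩ := htr n
    rw [hu.eq_diagonal, hv.eq_diagonal, Matrix.diagonal_mul_diagonal] at t1 t2
    rw [Matrix.diagonal_pow, Matrix.trace_diagonal] at t2
    rw [Matrix.trace_diagonal] at t1
    refine no_permuted_product (z := z) (u := fun x => M (i + n) x x) (v := fun x => M (i + n + d) x x) π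
      (fun x => hu.apply_ne_zero x) (fun x => ?_) ?_ t1 t2
    · have h3 := congrFun (congrFun e x) (π x)
      rw [Matrix.mul_diagonal, Matrix.smul_apply, Matrix.diagonal_mul, smul_eq_mul] at h3
      exact mul_left_cancel₀ (hπ x) (by rw [h3]; ring)
    · have h3 := hM i
      rw [hi] at h3
      obtain ⟨w, hw, e3⟩ := (ConjTo.iterate hs i n).trace_pow (hcn n)
      have h4 := h3.trace_refl_pow_three
      have e4 := e3 1
      rw [pow_one, pow_one, pow_one] at e4
      rw [e3, e4, mul_pow] at h4
      have h5 := mul_left_cancel₀ (pow_ne_zero 3 hw) h4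
      rw [hu.eq_diagonal, Matrix.diagonal_pow, Matrix.trace_diagonal, Matrix.trace_diagonal] at h5
      exact h5.symm
  -- The product now has a reflection as pattern, so its trace cannot vanish.
  · rw [hnd] at hv
    have h3 := hu.mul hv
    rw [mul_one] at h3
    exact h3.trace_refl_ne_zero (htr n).1

end PencilMPS

namespace PencilMPS

/-! ### Sequences in which the identity and a reflection occur -/

/-- The diagonal matrix with the entry `x` at the place `f` and the entries `y` elsewhere. -/
def axisDiag (f : Fin 3) (x y : ℂ) : Mat3 := Matrix.diagonal fun i => if i = f then x else y

lemma axisDiag_mul (f : Fin 3) (x y x' y' : ℂ) :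
    axisDiag f x y * axisDiag f x' y' = axisDiag f (x * x') (y * y') := by
  rw [axisDiag, axisDiag, axisDiag, Matrix.diagonal_mul_diagonal]
  congr 1
  funext i
  split_ifs <;> rfl

lemma axisDiag_one (f : Fin 3) : axisDiag f 1 1 = 1 := by simp [axisDiag]

lemma axisDiag_eq (f : Fin 3) (x y : ℂ) :
    axisDiag f x y = ((x + y) / 2) • 1 + ((x - y) / 2) • axisDiag f 1 (-1) := by
  ext i j
  by_cases hij : i = j
  · subst hij
    by_cases h : i = f <;> simp [axisDiag, h] <;> ring
  · simp [axisDiag, hij]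

/-- The orbit of a permutation acting on three classes, only one of which lies in the set of
indices with `P`, has period two or three. -/
lemma period_of_three_classes {P : ℕ → Prop} {R : ℕ → ℕ → Prop}
    (hP : ∀ {i j}, R i j → (P i ↔ P j)) (hstep : ∀ i j, R i j ↔ R (i + 1) (j + 1))
    (hpos : ∀ {i j}, P i → P j → R i j)
    (hneg : ∀ {i j k}, ¬ P i → ¬ P j → ¬ P k → R i j ∨ R j k ∨ R i k)
    {p : ℕ} (h0 : P p) (h1 : ¬ P (p + 1)) :
    (∀ j, P (p + j + 2) ↔ P (p + j)) ∨ (¬ P (p + 2) ∧ ∀ j, P (p + j + 3) ↔ P (p + j)) := by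
  have hit : ∀ i j d, R i j → R (i + d) (j + d) := by
    intro i j d h
    induction d with
    | zero => exact h
    | succ d ih => exact (hstep _ _).1 ih
  by_cases h2 : P (p + 2)
  · left
    intro j
    have h := hP (hit _ _ j (hpos h2 h0))
    rwa [add_right_comm] at h
  · right
    refine ⟨h2, ?_⟩
    -- Stepping back would relate p, where P holds, to p + 1, where it fails. The same backward step
    -- below excludes every relation among p + 1, p + 2, p + 3 if P fails at p + 3.
    have h12 : ¬ R (p + 1) (p + 2) := fun h => h1 ((hP ((hstep p (p + 1)).2 h)).1 h0)
    have h3 : P (p + 3) := by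
      by_contra h3
      rcases hneg h1 h2 h3 with h | h | h
      · exact h12 h
      · exact h12 ((hstep (p + 1) (p + 2)).2 h)
      · exact h2 ((hP ((hstep p (p + 2)).2 h)).1 h0)
    intro j
    have h := hP (hit _ _ j (hpos h3 h0))
    rwa [add_right_comm] at h

lemma exists_refl_axes (a : ZMod 3) : ∃ f p q : Fin 3, p ≠ f ∧ q ≠ f ∧ p ≠ q ∧
    (∀ x, x = f ∨ x = p ∨ x = q) ∧ refl a f = f ∧ refl a p = q ∧ refl a q = p := by
  revert a; decide

lemma axes_cases : ∀ f p q : Fin 3, p ≠ f → q ≠ f → p ≠ q →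
    (f = 0 ∧ p = 1 ∧ q = 2) ∨ (f = 0 ∧ p = 2 ∧ q = 1) ∨ (f = 1 ∧ p = 0 ∧ q = 2) ∨
    (f = 1 ∧ p = 2 ∧ q = 0) ∨ (f = 2 ∧ p = 0 ∧ q = 1) ∨ (f = 2 ∧ p = 1 ∧ q = 0) := by
  intro f p q
  fin_cases f <;> fin_cases p <;> fin_cases q <;> simp

lemma sum_axes {f p q : Fin 3} (hpf : p ≠ f) (hqf : q ≠ f) (hpq : p ≠ q) (u : Fin 3 → ℂ) :
    ∑ i, u i = u f + u p + u q := by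
  rw [Fin.sum_univ_three]
  rcases axes_cases _ _ _ hpf hqf hpq with ⟨rfl, rfl, rfl⟩ | ⟨rfl, rfl, rfl⟩ | ⟨rfl, rfl, rfl⟩ |
    ⟨rfl, rfl, rfl⟩ | ⟨rfl, rfl, rfl⟩ | ⟨rfl, rfl, rfl⟩ <;> ring

lemma prod_axes {f p q : Fin 3} (hpf : p ≠ f) (hqf : q ≠ f) (hpq : p ≠ q) (u : Fin 3 → ℂ) :
    ∏ i, u i = u f * u p * u q := by
  rw [Fin.prod_univ_three]
  rcases axes_cases _ _ _ hpf hqf hpq with ⟨rfl, rfl, rfl⟩ | ⟨rfl, rfl, rfl⟩ | ⟨rfl, rfl, rfl⟩ |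
    ⟨rfl, rfl, rfl⟩ | ⟨rfl, rfl, rfl⟩ | ⟨rfl, rfl, rfl⟩ <;> ring

lemma IsMono.ext {A B : Mat3} {σ : S3} (hA : IsMono A σ) (hB : IsMono B σ)
    (h : ∀ i, A i (σ i) = B i (σ i)) : A = B := by
  ext i j
  rw [hA.apply, hB.apply, h]

lemma isMono_axisDiag {f : Fin 3} {x y : ℂ} (hx : x ≠ 0) (hy : y ≠ 0) :
    IsMono (axisDiag f x y) 1 :=
  isMono_diagonal fun i => by split_ifs <;> assumption

lemma ConjTo.of_mul_diag {c A A' B B' D : Mat3} (hc : IsUnit c.det) (hD : c * D = D * c)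
    (h : ConjTo c A A') (h' : ConjTo c B B') (e : ∃ z : ℂ, z ≠ 0 ∧ B = z • (A * D)) :
    ∃ z : ℂ, z ≠ 0 ∧ B' = z • (A' * D) := by
  obtain ⟨z, hz, rfl⟩ := e
  have h1 : ConjTo c (A * D) (A' * D) := h.mul ⟨1, one_ne_zero, by rw [hD, one_smul]⟩
  exact (h1.smul_left hz).right_unique hc h'

lemma ConjTo.of_mul_diag' {c A A' B B' D : Mat3} (hc : IsUnit c.det) (hD : c * D = D * c)
    (h : ConjTo c A A') (h' : ConjTo c B B') (e : ∃ z : ℂ, z ≠ 0 ∧ B' = z • (A' * D)) :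
    ∃ z : ℂ, z ≠ 0 ∧ B = z • (A * D) := by
  obtain ⟨z, hz, rfl⟩ := e
  have h1 : ConjTo c (A * D) (A' * D) := h.mul ⟨1, one_ne_zero, by rw [hD, one_smul]⟩
  exact (h1.smul_right hz).left_unique hc h'

section Mixed

variable {c : Mat3} {M : ℕ → Mat3} {s : ℕ → S3} {N : ℕ} {a : ZMod 3} {f p q : Fin 3}

/-- The commutators of matrices with the patterns `1` and `refl a`. -/
lemma commutator_mixed {A B : Mat3} {x y : S3} (hpf : p ≠ f) (hqf : q ≠ f) (hpq : p ≠ q)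
    (haf : refl a f = f) (hA : IsMono A x) (hB : IsMono B y) (hx : x = 1 ∨ x = refl a)
    (hy : y = 1 ∨ y = refl a) : IsMono (commutator A B) 1 ∧ commutator A B f f = 1 ∧
      commutator A B p p * commutator A B q q = 1 := by
  have hm : IsMono (commutator A B) 1 := by
    have h := isMono_commutator hA hB
    have key : ∀ a : ZMod 3, (refl a)⁻¹ * refl a = 1 := fun a => inv_mul_cancel _
    rcases hx with rfl | rfl <;> rcases hy with rfl | rfl <;> simpa using h
  have hsw := commutator_mul_swap hA.isUnit_det hB.isUnit_det
  have hxf : x f = f := by rcases hx with rfl | rfl <;> simp [haf]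
  have hyf : y f = f := by rcases hy with rfl | rfl <;> simp [haf]
  have hf : commutator A B f f = 1 := by
    have h1 := congrFun (congrFun hsw f) f
    rw [hm.mul_apply_left, Equiv.Perm.one_apply, hB.mul_apply_left, hA.mul_apply_left, hxf,
      hyf] at h1
    have h2 := hA.apply_ne_zero f
    have h3 := hB.apply_ne_zero f
    rw [hxf] at h2
    rw [hyf] at h3
    exact mul_right_cancel₀ (mul_ne_zero h3 h2) (by rw [h1]; ring)
  refine ⟨hm, hf, ?_⟩
  -- A commutator has determinant one and its entry at f is one, so the entries at p and q are
  -- inverse to each other.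
  have hdet : (commutator A B).det = 1 := by
    have h1 := congrArg Matrix.det hsw
    rw [Matrix.det_mul, Matrix.det_mul, Matrix.det_mul, mul_comm B.det] at h1
    exact mul_right_cancel₀ (mul_ne_zero hA.isUnit_det.ne_zero hB.isUnit_det.ne_zero)
      (h1.trans (one_mul _).symm)
  rw [hm.eq_diagonal, Matrix.det_diagonal, prod_axes hpf hqf hpq, hf] at hdet
  linear_combination hdet

/-- Either all commutators are trivial, or `c` preserves an axis and a plane. -/
lemma commutator_eq_or (hc : IsUnit c.det) (hpf : p ≠ f) (hqf : q ≠ f) (hpq : p ≠ q)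
    (hcov : ∀ x, x = f ∨ x = p ∨ x = q) (haf : refl a f = f) (hM : ∀ k, IsMono (M k) (s k))
    (hs : ∀ k, ConjTo c (M k) (M (k + 1))) (h1 : ∀ k, s k = 1 ∨ s k = refl a)
    (hnm : ¬ ∃ ρ, IsMono c ρ) (i j : ℕ) :
    commutator (M i) (M j) = 1 ∨
      (commutator (M i) (M j) = axisDiag f 1 (-1) ∧ c * axisDiag f 1 (-1) = axisDiag f 1 (-1) * c) := by
  have main : ∀ i j, commutator (M i) (M j) = 1 ∨ commutator (M i) (M j) = axisDiag f 1 (-1) := by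
    intro i j
    obtain ⟨hE, hf, hpqE⟩ := commutator_mixed hpf hqf hpq haf (hM i) (hM j) (h1 i) (h1 j)
    obtain ⟨hE', -, -⟩ :=
      commutator_mixed hpf hqf hpq haf (hM (i + 1)) (hM (j + 1)) (h1 (i + 1)) (h1 (j + 1))
    set e := fun x => commutator (M i) (M j) x x with he
    have hEd : commutator (M i) (M j) = Matrix.diagonal e := hE.eq_diagonal
    by_cases hp1 : e p = 1
    · have hq1 : e q = 1 := by
        change e p * e q = 1 at hpqE
        rwa [hp1, one_mul] at hpqE
      left
      rw [hEd, show e = fun _ => 1 from funext fun x => by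
        rcases hcov x with rfl | rfl | rfl <;> assumption, Matrix.diagonal_one]
    by_cases hp2 : e p = -1
    · have hq1 : e q = -1 := by
        change e p * e q = 1 at hpqE
        rw [hp2] at hpqE
        linear_combination -hpqE
      right
      rw [hEd, axisDiag]
      congr 1
      funext x
      rcases hcov x with rfl | rfl | rfl
      · rw [if_pos rfl]; exact hf
      · rw [if_neg hpf, hp2]
      · rw [if_neg hqf, hq1]
    -- The entries 1, e p and (e p)⁻¹ are pairwise distinct, so this single commutator separates all
    -- axes and c would be monomial.
    · exfalso
      apply hnm
      have hef : e f = 1 := hf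
      have hepq : e p * e q = 1 := hpqE
      have hp0 : (e p - 1) * (e p + 1) ≠ 0 :=
        mul_ne_zero (sub_ne_zero.2 hp1) (fun h => hp2 (by linear_combination h))
      have h1f : e f ≠ e p := fun h => hp1 (by rw [← h, hef])
      have h2f : e f ≠ e q := fun h => hp1 (by rw [← hepq, ← h, hef, mul_one])
      have h3f : e p ≠ e q := fun h => hp0 (by rw [← h] at hepq; linear_combination hepq)
      refine exists_isMono_of_separating hc fun x y hxy =>
        ⟨e, fun x => commutator (M (i + 1)) (M (j + 1)) x x, ?_, ?_⟩
      · rw [← hEd, ← hE'.eq_diagonal]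
        exact (hs i).commutator (hM i).isUnit_det (hM _).isUnit_det (hM j).isUnit_det
          (hM _).isUnit_det (hs j)
      · rcases hcov x with rfl | rfl | rfl <;> rcases hcov y with rfl | rfl | rfl <;>
          first | exact absurd rfl hxy | assumption | (apply Ne.symm; assumption)
  refine (main i j).imp_right fun h => ⟨h, ?_⟩
  have hcomm : c * commutator (M i) (M j) = commutator (M (i + 1)) (M (j + 1)) * c :=
    (hs i).commutator (hM i).isUnit_det (hM _).isUnit_det (hM j).isUnit_det
      (hM _).isUnit_det (hs j)
  rw [h] at hcomm
  rcases main (i + 1) (j + 1) with h' | h'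
  -- A commutator conjugate to the identity would itself be the identity, but its entry at p is −1.
  · exfalso
    rw [h', one_mul] at hcomm
    have h2 : axisDiag f 1 (-1) = 1 := by
      have h3 := congrArg (c⁻¹ * ·) hcomm
      simpa only [Matrix.nonsing_inv_mul_cancel_left _ _ hc, Matrix.nonsing_inv_mul _ hc] using h3
    have h3 := congrFun (congrFun h2 p) p
    rw [axisDiag, Matrix.diagonal_apply_eq, if_neg hpf, Matrix.one_apply_eq] at h3
    norm_num at h3
  · rw [hcomm, h']

/-- Equality up to a diagonal matrix that commutes with `c`. -/
def AxisRel (c : Mat3) (f : Fin 3) (A B : Mat3) : Prop :=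
  ∃ x y : ℂ, x ≠ 0 ∧ y ≠ 0 ∧ c * axisDiag f x y = axisDiag f x y * c ∧
    ∃ z : ℂ, z ≠ 0 ∧ B = z • (A * axisDiag f x y)

lemma AxisRel.pattern_eq {A B : Mat3} {x y : S3} (h : AxisRel c f A B) (hA : IsMono A x)
    (hB : IsMono B y) : x = y := by
  obtain ⟨u, v, hu, hv, -, z, hz, rfl⟩ := h
  simpa using ((hA.mul (isMono_axisDiag hu hv)).smul hz).unique hB

/-- The diagonal factor commutes with c, so conjugation by c acts injectively on the classes. -/
lemma AxisRel.step_iff (hc : IsUnit c.det) {A A' B B' : Mat3} (h : ConjTo c A A')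
    (h' : ConjTo c B B') : AxisRel c f A B ↔ AxisRel c f A' B' := by
  constructor
  · rintro ⟨x, y, hx, hy, hcx, e⟩
    exact ⟨x, y, hx, hy, hcx, h.of_mul_diag hc hcx h' e⟩
  · rintro ⟨x, y, hx, hy, hcx, e⟩
    exact ⟨x, y, hx, hy, hcx, h.of_mul_diag' hc hcx h' e⟩

/-- Only the ratio of the entries in rows p and q matters: the entry at f and the common scale on
the plane are absorbed into `axisDiag`. -/
lemma exists_axisDiag_of_ratio {A B : Mat3} {x : S3} (hpf : p ≠ f) (hqf : q ≠ f)
    (hcov : ∀ x, x = f ∨ x = p ∨ x = q) (hA : IsMono A x) (hB : IsMono B x) (hxf : x f = f)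
    (h : B p (x p) * A q (x q) = B q (x q) * A p (x p)) :
    ∃ u v : ℂ, u ≠ 0 ∧ v ≠ 0 ∧ B = A * axisDiag f u v := by
  have hAf := hA.apply_ne_zero f
  have hAp := hA.apply_ne_zero p
  have hAq := hA.apply_ne_zero q
  have hu : B f (x f) / A f (x f) ≠ 0 := div_ne_zero (hB.apply_ne_zero f) hAf
  have hv : B p (x p) / A p (x p) ≠ 0 := div_ne_zero (hB.apply_ne_zero p) hAp
  refine ⟨_, _, hu, hv, ?_⟩
  have hm := hA.mul (isMono_axisDiag (f := f) hu hv)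
  rw [one_mul] at hm
  refine hB.ext hm fun i => ?_
  have hxi : ∀ i, i ≠ f → x i ≠ f := fun i hi h => hi (x.injective (h.trans hxf.symm))
  rw [axisDiag, Matrix.mul_diagonal]
  rcases hcov i with rfl | rfl | rfl
  · rw [if_pos hxf]; field_simp
  · rw [if_neg (hxi _ hpf)]; field_simp
  · rw [if_neg (hxi _ hqf)]; field_simp; linear_combination -h

/-- A number attached to each odd member of the sequence that determines its class, up to a
sign. -/
def HasSignedInvariant (c : Mat3) (f : Fin 3) (M : ℕ → Mat3) (P : ℕ → Prop) : Prop :=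
  ∃ r : ℕ → ℂ, ∀ i, P i → r i ≠ 0 ∧ ∀ j, P j →
    (r i = r j → AxisRel c f (M i) (M j)) ∧ (r i = r j ∨ r i = -r j)

lemma HasSignedInvariant.two_of_three {P : ℕ → Prop} (h : HasSignedInvariant c f M P)
    {i j k : ℕ} (hi : P i) (hj : P j) (hk : P k) :
    AxisRel c f (M i) (M j) ∨ AxisRel c f (M j) (M k) ∨ AxisRel c f (M i) (M k) := by
  obtain ⟨r, hr⟩ := h
  obtain ⟨-, hi'⟩ := hr i hi
  obtain ⟨-, hj'⟩ := hr j hj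
  rcases (hi' j hj).2 with e1 | e1
  · exact Or.inl ((hi' j hj).1 e1)
  rcases (hj' k hk).2 with e2 | e2
  · exact Or.inr (Or.inl ((hj' k hk).1 e2))
  · exact Or.inr (Or.inr ((hi' k hk).1 (by rw [e1, e2, neg_neg])))

end Mixed

end PencilMPS

namespace PencilMPS

/-! ### Invariants that bound the number of classes, and the resulting periods -/

section Mixed

variable {c : Mat3} {M : ℕ → Mat3} {s : ℕ → S3} {N : ℕ} {a : ZMod 3} {f p q : Fin 3}

lemma exists_add_eq_of_periodic {α : Type*} {g : ℕ → α} (hN : 0 < N) (hp : Function.Periodic g N)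
    (k i : ℕ) : ∃ d, g (k + d) = g i := by
  refine ⟨i + k * N - k, ?_⟩
  have : k ≤ k * N := Nat.le_mul_of_pos_right k hN
  rw [show k + (i + k * N - k) = i + k * N by omega, periodic_add_mul hp]

/-- The trace on the plane of p and q vanishes for a reflection, hence for all members. Diagonal
members are therefore proportional to diag(1, −1) on the plane and form one class. Reflections are
classified by the ratio of their two plane entries, and commutators ±1 on the plane fix that ratio
up to sign. -/
lemma signedInvariant_of_axis (hc : IsUnit c.det) (hN : 0 < N) (hpM : Function.Periodic M N)
    (hpf : p ≠ f) (hqf : q ≠ f) (hpq : p ≠ q) (hcov : ∀ x, x = f ∨ x = p ∨ x = q)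
    (haf : refl a f = f) (hap : refl a p = q) (haq : refl a q = p)
    (hM : ∀ k, IsMono (M k) (s k)) (hs : ∀ k, ConjTo c (M k) (M (k + 1)))
    (hE : ∀ i j, commutator (M i) (M j) = 1 ∨ commutator (M i) (M j) = axisDiag f 1 (-1))
    (hcF : c * axisDiag f 1 (-1) = axisDiag f 1 (-1) * c) (hex : ∃ k, s k = refl a) :
    (∀ i j, s i = 1 → s j = 1 → AxisRel c f (M i) (M j)) ∧
      HasSignedInvariant c f M fun k => s k = refl a := by
  have hcD : ∀ x y, c * axisDiag f x y = axisDiag f x y * c := by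
    intro x y
    rw [axisDiag_eq, mul_add, add_mul, mul_smul_comm, smul_mul_assoc, mul_smul_comm,
      smul_mul_assoc, hcF, mul_one, one_mul]
  have rel : ∀ {i j}, (∃ u v : ℂ, u ≠ 0 ∧ v ≠ 0 ∧ M j = M i * axisDiag f u v) →
      AxisRel c f (M i) (M j) := by
    rintro i j ⟨u, v, hu, hv, e⟩
    exact ⟨u, v, hu, hv, hcD u v, 1, one_ne_zero, by rw [one_smul, e]⟩
  -- `axisDiag f 0 2` is 1 − `axisDiag f 1 (-1)`, twice the projection to the plane.
  have htr : ∀ A : Mat3, (A * axisDiag f 0 2).trace = 2 * (A p p + A q q) := by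
    intro A
    rw [Matrix.trace, sum_axes hpf hqf hpq]
    simp only [Matrix.diag_apply, axisDiag, Matrix.mul_diagonal, if_neg hpf, if_neg hqf, if_true]
    ring
  obtain ⟨k, hk⟩ := hex
  have hMk := hM k
  rw [hk] at hMk
  have htr0 : ∀ i, M i p p + M i q q = 0 := by
    intro i
    obtain ⟨d, hd⟩ := exists_add_eq_of_periodic hN hpM k i
    have hcd : IsUnit (c ^ d).det := by rw [Matrix.det_pow]; exact hc.pow d
    have hcDd : c ^ d * axisDiag f 0 2 = axisDiag f 0 2 * c ^ d :=
      (Commute.pow_left (hcD 0 2 : Commute c _) d)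
    obtain ⟨z, hz, e⟩ := ((ConjTo.iterate hs k d).mul
      ⟨1, one_ne_zero, by rw [hcDd, one_smul]⟩).trace hcd
    rw [htr, htr, hd, hMk.apply_eq_zero (by rw [hap]; exact hpq.symm),
      hMk.apply_eq_zero (by rw [haq]; exact hpq)] at e
    simpa [hz] using e
  refine ⟨fun i j hi hj => ?_, fun i => M i p q / M i q p, fun i hi => ?_⟩
  · have h1 := hM i
    have h2 := hM j
    rw [hi] at h1
    rw [hj] at h2
    refine rel (exists_axisDiag_of_ratio hpf hqf hcov h1 h2 rfl ?_)
    simp only [Equiv.Perm.one_apply]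
    linear_combination M j p p * htr0 i - M i p p * htr0 j
  · have h1 := hM i
    rw [hi] at h1
    have hip := h1.apply_ne_zero p
    have hiq := h1.apply_ne_zero q
    rw [hap] at hip
    rw [haq] at hiq
    refine ⟨div_ne_zero hip hiq, fun j hj => ?_⟩
    have h2 := hM j
    rw [hj] at h2
    have hjp := h2.apply_ne_zero p
    have hjq := h2.apply_ne_zero q
    rw [hap] at hjp
    rw [haq] at hjq
    constructor
    · intro e
      refine rel (exists_axisDiag_of_ratio hpf hqf hcov h1 h2 haf ?_)
      rw [hap, haq]
      field_simp at e
      linear_combination -e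
    · have hsw := commutator_mul_swap (hM i).isUnit_det (hM j).isUnit_det
      have e0 : (M i * M j) p p = M i p q * M j q p := by
        rw [h1.mul_apply_left, hap]
      have e1 : (M j * M i) p p = M j p q * M i q p := by
        rw [h2.mul_apply_left, hap]
      rcases hE i j with h | h
      · left
        rw [h, one_mul] at hsw
        have h3 := congrFun (congrFun hsw p) p
        rw [e0, e1] at h3
        field_simp
        linear_combination -h3
      · right
        rw [h] at hsw
        have h3 := congrFun (congrFun hsw p) p
        rw [axisDiag, Matrix.diagonal_mul, if_neg hpf, e0, e1] at h3
        field_simp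
        linear_combination -h3

/-- Commuting with a reflection equalizes the entries at p and q of a diagonal member, and the
eigenvalues λ, μ, −μ then make it a multiple of diag(−1, 1, 1). Its square is scalar, hence so are
the squares of the reflections; together with commutation this fixes the square of the ratio M f f /
M p q. -/
lemma signedInvariant_of_commute (hc : IsUnit c.det) (hN : 0 < N) (hpM : Function.Periodic M N)
    (hpf : p ≠ f) (hqf : q ≠ f) (hpq : p ≠ q) (hcov : ∀ x, x = f ∨ x = p ∨ x = q)
    (haf : refl a f = f) (hap : refl a p = q) (haq : refl a q = p)
    (hM : ∀ k, IsMono (M k) (s k)) (hs : ∀ k, ConjTo c (M k) (M (k + 1)))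
    (hE : ∀ i j, commutator (M i) (M j) = 1) (hex1 : ∃ k, s k = 1) (hex : ∃ k, s k = refl a) :
    (∀ i j, s i = 1 → s j = 1 → AxisRel c f (M i) (M j)) ∧
      HasSignedInvariant c f M fun k => s k = refl a := by
  have hcomm : ∀ i j, M i * M j = M j * M i := by
    intro i j
    rw [← commutator_mul_swap (hM i).isUnit_det (hM j).isUnit_det, hE, one_mul]
  have rel : ∀ {i j}, (∃ z : ℂ, z ≠ 0 ∧ M j = z • M i) → AxisRel c f (M i) (M j) := by
    rintro i j ⟨z, hz, e⟩
    exact ⟨1, 1, one_ne_zero, one_ne_zero, by rw [axisDiag_one, mul_one, one_mul], z, hz,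
      by rw [axisDiag_one, mul_one, e]⟩
  obtain ⟨k, hk⟩ := hex
  have hMk := hM k
  rw [hk] at hMk
  have hkp := hMk.apply_ne_zero p
  rw [hap] at hkp
  have hcd : ∀ d, IsUnit (c ^ d).det := fun d => by rw [Matrix.det_pow]; exact hc.pow d
  have hdiag : ∀ i, s i = 1 → ∃ x : ℂ, x ≠ 0 ∧ M i = x • axisDiag f (-1) 1 := by
    intro i hi
    have hMi := hM i
    rw [hi] at hMi
    have hpp : M i p p = M i q q := by
      have h1 := congrFun (congrFun (hcomm i k) p) q
      rw [hMi.mul_apply_left, hMk.mul_apply_left, hap, Equiv.Perm.one_apply] at h1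
      exact mul_right_cancel₀ hkp (by rw [h1, mul_comm])
    have hx := hMi.apply_ne_zero p
    have hm := hMi.apply_ne_zero f
    rw [Equiv.Perm.one_apply] at hx hm
    have hff : M i f f = - M i p p := by
      obtain ⟨d, hd⟩ := exists_add_eq_of_periodic hN hpM k i
      obtain ⟨w, hw, e3⟩ := (ConjTo.iterate hs k d).trace_pow (hcd d)
      have h4 := hMk.trace_refl_pow_three
      have e4 := e3 1
      rw [pow_one, pow_one, pow_one] at e4
      rw [e3, e4, mul_pow] at h4
      have h5 := mul_left_cancel₀ (pow_ne_zero 3 hw) h4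
      rw [hd, hMi.eq_diagonal, Matrix.diagonal_pow, Matrix.trace_diagonal, Matrix.trace_diagonal,
        sum_axes hpf hqf hpq, sum_axes hpf hqf hpq] at h5
      simp only [Pi.pow_apply, ← hpp] at h5
      -- With entries y, x, x the relation between trace and cube trace reads (y + 2x)³ = y³ + 2x³,
      -- that is 6x(y + x)² = 0.
      have h6 : M i p p * (M i f f + M i p p) ^ 2 = 0 := by linear_combination -h5 / 6
      have h7 := pow_eq_zero_iff (two_ne_zero) |>.1 ((mul_eq_zero.1 h6).resolve_left hx)
      linear_combination h7
    refine ⟨M i p p, hx, ?_⟩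
    refine hMi.ext ((isMono_axisDiag (by norm_num) one_ne_zero).smul hx) fun y => ?_
    rw [Equiv.Perm.one_apply, Matrix.smul_apply, axisDiag, Matrix.diagonal_apply_eq]
    rcases hcov y with rfl | rfl | rfl
    · rw [if_pos rfl, hff]; simp
    · rw [if_neg hpf]; simp
    · rw [if_neg hqf, ← hpp]; simp
  have hsq : ∀ i, s i = refl a → M i f f ^ 2 = M i p q * M i q p := by
    intro i hi
    have hMi := hM i
    rw [hi] at hMi
    obtain ⟨k', hk'⟩ := hex1
    obtain ⟨x, hx, ex⟩ := hdiag k' hk'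
    obtain ⟨d, hd⟩ := exists_add_eq_of_periodic hN hpM k' i
    have h1 := (ConjTo.iterate hs k' d).pow 2
    rw [hd, ex, smul_pow, pow_two (axisDiag f (-1) 1), axisDiag_mul, mul_one, neg_mul_neg,
      mul_one, axisDiag_one] at h1
    obtain ⟨z, hz, e⟩ := ((ConjTo.one (c ^ d)).smul_left (pow_ne_zero 2 hx)).right_unique
      (hcd d) h1
    have e1 := congrFun (congrFun e f) f
    have e2 := congrFun (congrFun e p) p
    rw [pow_two, hMi.mul_apply_left, haf, Matrix.smul_apply, Matrix.one_apply_eq] at e1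
    rw [pow_two, hMi.mul_apply_left, hap, Matrix.smul_apply, Matrix.one_apply_eq] at e2
    rw [pow_two, e1, e2]
  refine ⟨fun i j hi hj => ?_, fun i => M i f f / M i p q, fun i hi => ?_⟩
  · obtain ⟨x, hx, ex⟩ := hdiag i hi
    obtain ⟨y, hy, ey⟩ := hdiag j hj
    exact rel ⟨y / x, div_ne_zero hy hx, by rw [ex, ey, smul_smul, div_mul_cancel₀ _ hx]⟩
  · have h1 := hM i
    rw [hi] at h1
    have hif := h1.apply_ne_zero f
    have hip := h1.apply_ne_zero p
    rw [haf] at hif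
    rw [hap] at hip
    refine ⟨div_ne_zero hif hip, fun j hj => ?_⟩
    have h2 := hM j
    rw [hj] at h2
    have hjf := h2.apply_ne_zero f
    have hjp := h2.apply_ne_zero p
    rw [haf] at hjf
    rw [hap] at hjp
    have h3 := congrFun (congrFun (hcomm i j) p) p
    rw [h1.mul_apply_left, h2.mul_apply_left, hap] at h3
    constructor
    · intro e
      have hz : M j p q / M i p q ≠ 0 := div_ne_zero hjp hip
      refine rel ⟨_, hz, h2.ext (h1.smul hz) fun y => ?_⟩
      rw [Matrix.smul_apply, smul_eq_mul]
      field_simp at e ⊢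
      rcases hcov y with rfl | rfl | rfl
      · rw [haf]; linear_combination -e
      · rw [hap]; ring
      · rw [haq]; linear_combination h3
    · rw [← sq_eq_sq_iff_eq_or_eq_neg]
      have hi2 := hsq i hi
      have hj2 := hsq j hj
      rw [div_pow, div_pow, hi2, hj2]
      field_simp
      linear_combination -h3

/-- If the identity and a reflection occur as patterns, they alternate, or the pattern repeats
after three steps. -/
lemma mixed_period (hc : IsUnit c.det) (hN : 0 < N) (hpM : Function.Periodic M N)
    (hps : Function.Periodic s N)
    (hM : ∀ k, IsMono (M k) (s k)) (hs : ∀ k, ConjTo c (M k) (M (k + 1)))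
    (h1 : ∀ k, s k = 1 ∨ s k = refl a) (hex1 : ∃ k, s k = 1) (hex : ∃ k, s k = refl a) :
    ∃ k, s k = 1 ∧ s (k + 1) = refl a ∧ ((∀ j, s (j + 2) = s j) ∨
      (s (k + 2) = refl a ∧ ∀ j, s (j + 3) = s j)) := by
  obtain ⟨f, p, q, hpf, hqf, hpq, hcov, haf, hap, haq⟩ := exists_refl_axes a
  have hstep : ∃ k, s k = 1 ∧ s (k + 1) ≠ 1 := by
    by_contra hno
    push Not at hno
    obtain ⟨k, hk⟩ := hex1
    obtain ⟨j, hj⟩ := hex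
    obtain ⟨d, hd⟩ := exists_add_eq_of_periodic hN hps k j
    have : ∀ d, s (k + d) = 1 := by
      intro d
      induction d with
      | zero => exact hk
      | succ d ih => exact hno _ ih
    exact refl_ne_one a (by rw [← hj, ← hd, this])
  -- A monomial c would keep the pattern 1 forever, whereas a reflection follows it at some index.
  have hnm : ¬ ∃ ρ, IsMono c ρ := by
    rintro ⟨ρ, hρ⟩
    obtain ⟨k, hk, hk'⟩ := hstep
    have h := (hs k).pattern_eq hρ (hM k) (hM (k + 1))
    rw [hk, mul_one, inv_mul_cancel] at h
    exact hk' h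
  have hor := commutator_eq_or hc hpf hqf hpq hcov haf hM hs h1 hnm
  have hinv : (∀ i j, s i = 1 → s j = 1 → AxisRel c f (M i) (M j)) ∧
      HasSignedInvariant c f M fun k => s k = refl a := by
    by_cases hall : ∀ i j, commutator (M i) (M j) = 1
    · exact signedInvariant_of_commute hc hN hpM hpf hqf hpq hcov haf hap haq hM hs hall hex1 hex
    · push Not at hall
      obtain ⟨i, j, hij⟩ := hall
      exact signedInvariant_of_axis hc hN hpM hpf hqf hpq hcov haf hap haq hM hs
        (fun i j => (hor i j).imp_right And.left) ((hor i j).resolve_left hij).2 hex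
  have hodd : ∀ k, s k ≠ 1 ↔ s k = refl a := fun k =>
    ⟨(h1 k).resolve_left, fun h => h ▸ refl_ne_one a⟩
  have hiff : ∀ i j, (s i = 1 ↔ s j = 1) → s i = s j := by
    intro i j h
    rcases h1 i with hi | hi
    · rw [hi, h.1 hi]
    · rw [hi, (hodd j).1 fun hj => (hodd i).2 hi (h.2 hj)]
  obtain ⟨k, hk, hk'⟩ := hstep
  refine ⟨k, hk, (hodd _).1 hk', ?_⟩
  have h3 := period_of_three_classes (P := fun k => s k = 1)
    (R := fun i j => AxisRel c f (M i) (M j))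
    (fun {i j} h => by rw [h.pattern_eq (hM i) (hM j)])
    (fun i j => AxisRel.step_iff hc (hs i) (hs j)) (fun hi hj => hinv.1 _ _ hi hj)
    (fun hi hj hk => hinv.2.two_of_three ((hodd _).1 hi) ((hodd _).1 hj) ((hodd _).1 hk)) hk hk'
  refine h3.imp (fun h => periodic_of_eventually (p := k) hN hps fun j => hiff _ _ (h j))
    fun h => ⟨(hodd _).1 h.1, periodic_of_eventually (p := k) hN hps fun j => hiff _ _ (h.2 j)⟩

end Mixed

/-- The sequences of permutations that occur as patterns. -/
def IsTableSequence (s : ℕ → S3) : Prop :=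
  (∃ ρ, ∀ k, s (k + 1) = ρ⁻¹ * s k * ρ) ∨
  (∃ (n : ℕ → ZMod 3) (t : ZMod 3), (∀ k, s k = rot (n k)) ∧
    ∀ k, n (k + 2) = t * n (k + 1) - n k) ∨
  (∃ (n : ℕ → ZMod 3) (t : ZMod 3), (∀ k, s k = refl (n k)) ∧
    ∀ k, n (k + 3) - n (k + 2) = t * (n (k + 2) - n (k + 1)) - (n (k + 1) - n k)) ∨
  ∃ a k, s k = 1 ∧ s (k + 1) = refl a ∧ ((∀ j, s (j + 2) = s j) ∨
      (s (k + 2) = refl a ∧ ∀ j, s (j + 3) = s j))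

lemma recurrence_of_eventually {n : ℕ → ZMod 3} {N k₀ : ℕ} {t : ZMod 3} (hN : 0 < N)
    (hp : Function.Periodic n N) (h : ∀ k ≥ k₀, n (k + 2) = t * n (k + 1) - n k) (k : ℕ) :
    n (k + 2) = t * n (k + 1) - n k := by
  have h1 := h (k + k₀ * N) ((Nat.le_mul_of_pos_right k₀ hN).trans (Nat.le_add_left _ _))
  rwa [show k + k₀ * N + 2 = k + 2 + k₀ * N by ring, show k + k₀ * N + 1 = k + 1 + k₀ * N by ring,
    periodic_add_mul hp, periodic_add_mul hp, periodic_add_mul hp] at h1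

/-- The four alternatives are: c monomial; only rotations; only reflections; both kinds present. -/
lemma isTableSequence_of_conj {c : Mat3} {M : ℕ → Mat3} {s : ℕ → S3} {N : ℕ}
    (hc : IsUnit c.det) (hN : 0 < N) (hpM : Function.Periodic M N) (hps : Function.Periodic s N)
    (hM : ∀ k, IsMono (M k) (s k)) (hs : ∀ k, ConjTo c (M k) (M (k + 1))) :
    IsTableSequence s := by
  by_cases hρ : ∃ ρ, IsMono c ρ
  · obtain ⟨ρ, hρ⟩ := hρ
    exact Or.inl ⟨ρ, fun k => (hs k).pattern_eq hρ (hM k) (hM (k + 1))⟩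
  right
  by_cases heven : ∀ k, ∃ a, s k = rot a
  · choose n hn using heven
    obtain ⟨k₀, t, h⟩ := (rotation_recurrence hc (fun k => hn k ▸ hM k) hs).resolve_left hρ
    refine Or.inl ⟨n, t, hn, recurrence_of_eventually hN (fun k => rot_injective ?_) h⟩
    rw [← hn, ← hn, hps]
  right
  by_cases hodd : ∀ k, ∃ a, s k = refl a
  · choose n hn using hodd
    have hnp : Function.Periodic n N := fun k => refl_injective (by rw [← hn, ← hn, hps])
    -- Quotients of successive reflections are rotations and are again mapped to one another by c,
    -- so the recurrence holds for the differences of n.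
    have hM' : ∀ k, IsMono (M (k + 1) * (M k)⁻¹) (rot (n k - n (k + 1))) := by
      intro k
      have h := (hM (k + 1)).mul (hM k).inv
      rwa [hn, hn, refl_inv_mul] at h
    have hs' : ∀ k, ConjTo c (M (k + 1) * (M k)⁻¹) (M (k + 1 + 1) * (M (k + 1))⁻¹) := fun k =>
      (hs (k + 1)).mul ((hs k).inv (hM k).isUnit_det (hM (k + 1)).isUnit_det)
    obtain ⟨k₀, t, h⟩ := (rotation_recurrence hc hM' hs').resolve_left hρ
    refine Or.inl ⟨n, t, hn, fun k => ?_⟩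
    have h1 := recurrence_of_eventually (n := fun k => n k - n (k + 1)) hN
      (fun k => by
        change n (k + N) - n (k + N + 1) = _
        rw [hnp, show k + N + 1 = k + 1 + N by ring, hnp]) h k
    linear_combination -h1
  right
  push Not at heven hodd
  obtain ⟨i, hi⟩ := heven
  obtain ⟨j, hj⟩ := hodd
  obtain ⟨a, ha⟩ := (rot_or_refl (s i)).resolve_left fun ⟨x, hx⟩ => hi x hx
  obtain ⟨b, hb⟩ := (rot_or_refl (s j)).resolve_right fun ⟨x, hx⟩ => hj x hx
  have h1 : ∀ k, s k = 1 ∨ ∃ x, s k = refl x := by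
    intro k
    rcases rot_or_refl (s k) with ⟨x, hx⟩ | h
    -- A nontrivial rotation pattern has trace zero and a reflection pattern does not, so conjugates
    -- up to a scalar cannot show both.
    · left
      by_contra hne
      have hx0 : x ≠ 0 := by
        rintro rfl
        exact hne (hx.trans rot_zero)
      obtain ⟨d, hd⟩ := exists_add_eq_of_periodic hN hpM k i
      have hMk := hM k
      rw [hx] at hMk
      have hMi := hM i
      rw [ha] at hMi
      obtain ⟨z, hz, e⟩ := (ConjTo.iterate hs k d).trace (by
        rw [Matrix.det_pow]; exact hc.pow d)
      rw [hMk.trace_rot hx0, hd] at e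
      exact hMi.trace_refl_ne_zero ((mul_eq_zero.1 e.symm).resolve_left hz)
    · exact Or.inr h
  have hj1 : s j = 1 := (h1 j).resolve_right fun ⟨x, hx⟩ => hj x hx
  have huniq : ∀ k, s k = 1 ∨ s k = refl a := by
    intro k
    refine (h1 k).imp_right ?_
    rintro ⟨x, hx⟩
    rw [hx]
    rcases le_total k i with h | h
    · rw [reflection_unique hc hN hps hM hs h1 ⟨j, hj1⟩ h hx ha]
    · rw [reflection_unique hc hN hps hM hs h1 ⟨j, hj1⟩ h ha hx]
  obtain ⟨k, h⟩ := mixed_period hc hN hpM hps hM hs huniq ⟨j, hj1⟩ ⟨i, ha⟩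
  exact ⟨a, k, h⟩

lemma HasString.isTableSequence {c : Mat3} (hc : IsUnit c.det) {N : ℕ} [NeZero N]
    {σ : Fin N → S3} (h : HasString c σ) : IsTableSequence (unroll σ) := by
  obtain ⟨M, hp, hM, hs⟩ := HasString.iff_unroll.1 h
  exact isTableSequence_of_conj hc (NeZero.pos N) hp (unroll_periodic σ) hM hs

end PencilMPS

namespace PencilMPS

/-! ### Numerical codes for the permutations -/

/-- The permutation with a given code: rotations have codes `0, 1, 2`, reflections `3, 4, 5`. -/
def decode (x : Fin 6) : S3 := if (x : ℕ) < 3 then rot (x : ℕ) else refl (x : ℕ)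

/-- Multiplication of codes. -/
def codeMul (x y : Fin 6) : Fin 6 := Fin.ofNat 6 <|
  bif x.1.blt 3 then (bif y.1.blt 3 then (x.1 + y.1) % 3 else 3 + (x.1 + y.1) % 3)
  else (bif y.1.blt 3 then 3 + (x.1 - y.1) % 3 else (x.1 + 3 - y.1) % 3)

/-- Inversion of codes. -/
def codeInv (x : Fin 6) : Fin 6 := Fin.ofNat 6 (bif x.1.blt 3 then (3 - x.1) % 3 else x.1)

lemma decode_codeMul (x y : Fin 6) : decode (codeMul x y) = decode x * decode y := by
  revert x y; decide

lemma decode_codeInv (x : Fin 6) : decode (codeInv x) = (decode x)⁻¹ := by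
  revert x; decide

lemma decode_injective : Function.Injective decode := by decide

lemma decode_surjective : Function.Surjective decode := by decide

/-- The entries of the table, in codes. -/
def CycleLabel.codes : CycleLabel → List (Fin 6)
  | .C0 => [1]
  | .T0τ => [3]
  | .T0ε => [4]
  | .T0κ => [5]
  | .C1 => [1, 2]
  | .T1τ => [0, 3]
  | .T1ε => [0, 4]
  | .T1κ => [0, 5]
  | .T2τ => [4, 5]
  | .T2ε => [3, 5]
  | .T2κ => [3, 4]
  | .C2 => [0, 1, 2]
  | .T3τ => [0, 3, 3]
  | .T3ε => [0, 4, 4]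
  | .T3κ => [0, 5, 5]
  | .T4ccw => [3, 5, 4]
  | .T4cw => [3, 4, 5]
  | .T5ccw => [3, 3, 5]
  | .T5cw => [3, 3, 4]
  | .C3 => [0, 1, 0, 2]
  | .T6τ => [5, 3, 4, 3]
  | .T6ε => [3, 4, 5, 4]
  | .T6κ => [4, 5, 3, 5]
  | .C4 => [0, 1, 1, 0, 2, 2]
  | .T7τ => [5, 3, 4, 4, 3, 5]
  | .T7ε => [3, 4, 5, 5, 4, 3]
  | .T7κ => [4, 5, 3, 3, 5, 4]

lemma CycleLabel.list_eq (X : CycleLabel) : X.list = X.codes.map decode := by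
  cases X <;> decide

lemma CycleLabel.length_codes (X : CycleLabel) : X.codes.length = X.length := by
  cases X <;> rfl

/-- The labels of the table. -/
def allLabels : List CycleLabel :=
  [.C0, .T0τ, .T0ε, .T0κ, .C1, .T1τ, .T1ε, .T1κ, .T2τ, .T2ε, .T2κ, .C2, .T3τ, .T3ε, .T3κ,
    .T4ccw, .T4cw, .T5ccw, .T5cw, .C3, .T6τ, .T6ε, .T6κ, .C4, .T7τ, .T7ε, .T7κ]

/-- The string of length `m` with the given codes. -/
def codeWord (m : ℕ) (l : List (Fin 6)) (k : Fin m) : S3 := decode (l.getD k 0)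

lemma CycleLabel.word_eq (X : CycleLabel) : X.word = codeWord X.length X.codes := by
  funext k
  have h1 : (k : ℕ) < X.codes.length := by rw [X.length_codes]; exact k.2
  simp [CycleLabel.word, codeWord, X.list_eq, h1]

/-- A sufficient condition for `u` to lie in the group generated by `w`: it is a product of at most
three translates of `w`. -/
def inGen (m : ℕ) (u w : List (Fin 6)) : Bool :=
  let I := List.range m
  (I.any fun a => I.all fun k => u.getD k 0 == w.getD ((k + a) % m) 0) ||
  (I.any fun a => I.any fun b => I.all fun k =>
    u.getD k 0 == codeMul (w.getD ((k + a) % m) 0) (w.getD ((k + b) % m) 0)) ||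
  (I.any fun a => I.any fun b => I.any fun c => I.all fun k =>
    u.getD k 0 == codeMul (w.getD ((k + a) % m) 0)
      (codeMul (w.getD ((k + b) % m) 0) (w.getD ((k + c) % m) 0)))

lemma codeWord_mem_of_inGen {m : ℕ} {u w : List (Fin 6)} (h : inGen m u w = true) :
    codeWord m u ∈ generatedGroup (codeWord m w) := by
  have hT : ∀ a, a < m → (fun k : Fin m => decode (w.getD ((k + a) % m) 0)) ∈
      generatedGroup (codeWord m w) := by
    intro a ha
    refine Subgroup.subset_closure ⟨⟨a, ha⟩, ?_⟩
    funext k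
    simp [codeWord, Fin.val_add]
  simp only [inGen, Bool.or_eq_true, List.any_eq_true, List.mem_range, List.all_eq_true,
    beq_iff_eq] at h
  rcases h with (⟨a, ha, h⟩ | ⟨a, ha, b, hb, h⟩) | ⟨a, ha, b, hb, c, hc, h⟩
  · convert hT a ha using 1
    funext k
    rw [codeWord, h k k.2]
  · convert mul_mem (hT a ha) (hT b hb) using 1
    funext k
    rw [codeWord, h k k.2, decode_codeMul, Pi.mul_apply]
  · convert mul_mem (hT a ha) (mul_mem (hT b hb) (hT c hc)) using 1
    funext k
    rw [codeWord, h k k.2, decode_codeMul, decode_codeMul, Pi.mul_apply, Pi.mul_apply]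

lemma translate_mem_generatedGroup {m : ℕ} {u w : Fin m → S3} (hu : u ∈ generatedGroup w)
    (j : Fin m) : (fun k => u (k + j)) ∈ generatedGroup w := by
  have : NeZero m := ⟨fun h => by subst h; exact j.elim0⟩
  induction hu using Subgroup.closure_induction with
  | mem x hx =>
    obtain ⟨i, rfl⟩ := hx
    exact Subgroup.subset_closure ⟨j + i, by simp only [add_assoc]⟩
  | one => exact one_mem _
  | mul x y _ _ hx hy => exact mul_mem hx hy
  | inv x _ hx => exact inv_mem hx

lemma generatedGroup_le {m : ℕ} {u w : Fin m → S3} (hu : u ∈ generatedGroup w) :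
    generatedGroup u ≤ generatedGroup w := by
  rw [generatedGroup, Subgroup.closure_le]
  rintro _ ⟨j, rfl⟩
  exact translate_mem_generatedGroup hu j

/-! ### Classification of the table sequences -/

/-- A list of twelve codes has period `m`, cyclically. -/
def periodicCode (l : List (Fin 6)) (m : ℕ) : Bool :=
  (List.range 12).all fun k => l.getD ((k + m) % 12) 0 == l.getD k 0

/-- A list of twelve codes has minimal period `m`, and is trivial or equivalent to a table entry. -/
def classifiedAt (l : List (Fin 6)) (m : ℕ) : Bool :=
  periodicCode l m && ([1, 2, 3, 4].all fun p => m.ble p || !periodicCode l p) &&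
  ((m == 1 && l.getD 0 0 == 0) ||
    allLabels.any fun X => X.codes.length == m && inGen m l X.codes && inGen m X.codes l)

/-- A list of twelve codes that is classified at some length. -/
def classified (l : List (Fin 6)) : Bool := [1, 2, 3, 4, 6].any (classifiedAt l)

/-- The periodic sequence with the given codes. -/
def codeSeq (l : List (Fin 6)) (k : ℕ) : S3 := decode (l.getD (k % 12) 0)

lemma periodicCode_iff {l : List (Fin 6)} {m : ℕ} :
    periodicCode l m = true ↔ Function.Periodic (codeSeq l) m := by
  simp only [periodicCode, List.all_eq_true, List.mem_range, beq_iff_eq]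
  constructor
  · intro h k
    have h1 := h (k % 12) (Nat.mod_lt _ (by norm_num))
    rw [codeSeq, codeSeq, ← h1, Nat.mod_add_mod]
  · intro h k hk
    have h1 := decode_injective (h k)
    rwa [Nat.mod_eq_of_lt hk] at h1

lemma periodic_gcd {α : Type*} {f : ℕ → α} (a b : ℕ) :
    Function.Periodic f a → Function.Periodic f b → Function.Periodic f (a.gcd b) := by
  induction a, b using Nat.gcd.induction with
  | H0 b => intro _ h; simpa using h
  | H1 a b ha ih =>
    intro h1 h2
    rw [Nat.gcd_rec]
    refine ih (fun k => ?_) h1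
    rw [← h2 k, ← periodic_add_mul h1 (k + b % a) (b / a), add_assoc, mul_comm (b / a),
      Nat.mod_add_div]

/-- The statement that is proved for all table sequences. -/
def HasClass (s : ℕ → S3) : Prop := ∃ m ∈ ({1, 2, 3, 4, 6} : Set ℕ), Function.Periodic s m ∧
  (∀ p, 0 < p → p < m → ¬ Function.Periodic s p) ∧
  ((∀ k, s k = 1) ∨ ∃ X : CycleLabel, X.length = m ∧
    generatedGroup (fun k : Fin X.length => s k) = generatedGroup X.word)

lemma hasClass_codeSeq {l : List (Fin 6)} (h : classified l = true) : HasClass (codeSeq l) := by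
  obtain ⟨m, hm, h⟩ := List.any_eq_true.1 h
  have hm' : m ∈ ({1, 2, 3, 4, 6} : Set ℕ) := by simpa using hm
  have hm6 : m ≤ 6 ∧ 0 < m := by
    simp only [Set.mem_insert_iff, Set.mem_singleton_iff] at hm'
    omega
  simp only [classifiedAt, Bool.and_eq_true, Bool.or_eq_true, beq_iff_eq] at h
  obtain ⟨⟨hp, hmin⟩, hX⟩ := h
  rw [periodicCode_iff] at hp
  refine ⟨m, hm', hp, ?_, ?_⟩
  · intro p hp0 hpm hper
    have h12 : Function.Periodic (codeSeq l) 12 := fun k => by simp [codeSeq]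
    -- Any shorter period, including 5, may be replaced by its gcd with 12, so testing 1, 2, 3, 4 is
    -- enough.
    have hg := periodic_gcd p 12 hper h12
    rw [← periodicCode_iff] at hg
    have hgp : p.gcd 12 ≤ p := Nat.gcd_le_left _ hp0
    have hg4 : p.gcd 12 ∈ [1, 2, 3, 4] := by
      have : p < 6 := by omega
      interval_cases p <;> decide
    have h1 := List.all_eq_true.1 hmin _ hg4
    rw [hg] at h1
    simp only [Bool.not_true, Bool.or_false] at h1
    have := Nat.le_of_ble_eq_true h1
    omega
  · rcases hX with ⟨h1, h0⟩ | hX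
    · left
      intro k
      subst h1
      have h2 := periodic_add_mul hp 0 k
      rw [zero_add, mul_one] at h2
      rw [h2, codeSeq, Nat.zero_mod, h0]
      decide
    · right
      obtain ⟨X, -, hX⟩ := List.any_eq_true.1 hX
      simp only [Bool.and_eq_true, beq_iff_eq] at hX
      obtain ⟨⟨hl, h1⟩, h2⟩ := hX
      rw [X.length_codes] at hl
      subst hl
      refine ⟨X, rfl, ?_⟩
      have hw : (fun k : Fin X.length => codeSeq l k) = codeWord X.length l := by
        funext k
        have : (k : ℕ) % 12 = k := Nat.mod_eq_of_lt (by have := k.2; omega)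
        rw [codeSeq, codeWord, this]
      rw [hw, X.word_eq]
      exact le_antisymm (generatedGroup_le (codeWord_mem_of_inGen h1))
        (generatedGroup_le (codeWord_mem_of_inGen h2))

/-- The first `n` codes along the orbit of a state. -/
def orbitCodes {α : Type*} (step : α → α) (out : α → Fin 6) (x : α) : ℕ → List (Fin 6)
  | 0 => []
  | n + 1 => out x :: orbitCodes step out (step x) n

lemma getD_orbitCodes {α : Type*} (step : α → α) (out : α → Fin 6) (n : ℕ) :
    ∀ (x : α) (k : ℕ), k < n → (orbitCodes step out x n).getD k 0 = out (step^[k] x) := by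
  induction n with
  | zero => intro x k hk; omega
  | succ n ih =>
    rintro x (_ | k) hk
    · rfl
    · rw [orbitCodes, List.getD_cons_succ, ih _ _ (by omega), Function.iterate_succ_apply]

/-- The orbit closes after twelve steps, so twelve codes determine s and a finite check decides. -/
lemma hasClass_of_orbit {α : Type*} {step : α → α} {out : α → Fin 6} {s : ℕ → S3} {f : ℕ → α}
    (hf : ∀ k, f (k + 1) = step (f k)) (hs : ∀ k, s k = decode (out (f k)))
    (hstep : step^[12] (f 0) = f 0) (h : classified (orbitCodes step out (f 0) 12) = true) :
    HasClass s := by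
  have hfk : ∀ k, f k = step^[k] (f 0) := by
    intro k
    induction k with
    | zero => rfl
    | succ k ih => rw [hf, ih, Function.iterate_succ_apply']
  have h12 : ∀ k, f (k % 12) = f k := by
    have hper : Function.Periodic f 12 := by
      intro k
      rw [hfk, Function.iterate_add_apply, hstep, ← hfk]
    exact fun k => hper.map_mod_nat k
  have hseq : s = codeSeq (orbitCodes step out (f 0) 12) := by
    funext k
    rw [codeSeq, getD_orbitCodes _ _ _ _ _ (Nat.mod_lt _ (by norm_num)), ← hfk, h12, hs]
  rw [hseq]
  exact hasClass_codeSeq h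

/-- The state space steps for the four kinds of table sequences. -/
def conjStep (x : Fin 6 × Fin 6) : Fin 6 × Fin 6 :=
  (x.1, codeMul (codeMul (codeInv x.1) x.2) x.1)

def rotStep (x : ZMod 3 × ZMod 3 × ZMod 3) : ZMod 3 × ZMod 3 × ZMod 3 :=
  (x.1, x.2.2, x.1 * x.2.2 - x.2.1)

def reflStep (x : ZMod 3 × ZMod 3 × ZMod 3 × ZMod 3) : ZMod 3 × ZMod 3 × ZMod 3 × ZMod 3 :=
  (x.1, x.2.2.1, x.2.2.2, x.2.2.2 + x.1 * (x.2.2.2 - x.2.2.1) - (x.2.2.1 - x.2.1))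

/-- Twelve is a common period: permutations have order dividing 6, and over ℤ/3 the companion matrix
of x² − t x + 1 has order 4, 6, 3 for t = 0, 1, 2. The extra factor x − 1 that governs reflections
does not change these orders. -/
lemma conjStep_iterate : ∀ r x, conjStep^[12] (r, x) = (r, x) := by decide +kernel

lemma rotStep_iterate : ∀ t a b, rotStep^[12] (t, a, b) = (t, a, b) := by decide +kernel

lemma reflStep_iterate : ∀ t a b c, reflStep^[12] (t, a, b, c) = (t, a, b, c) := by decide +kernel

lemma classified_conj : ∀ r x, classified (orbitCodes conjStep Prod.snd (r, x) 12) = true := by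
  decide +kernel

/-- The code of a rotation. -/
def rotCode (a : ZMod 3) : Fin 6 := Fin.ofNat 6 a.val

/-- The code of a reflection. -/
def reflCode (a : ZMod 3) : Fin 6 := Fin.ofNat 6 (3 + a.val)

lemma decode_rotCode (a : ZMod 3) : decode (rotCode a) = rot a := by revert a; decide

lemma decode_reflCode (a : ZMod 3) : decode (reflCode a) = refl a := by revert a; decide

lemma classified_rot : ∀ t a b,
    classified (orbitCodes rotStep (fun x => rotCode x.2.1) (t, a, b) 12) = true := by
  decide +kernel

lemma classified_refl : ∀ t a b c,
    classified (orbitCodes reflStep (fun x => reflCode x.2.1) (t, a, b, c) 12) = true := by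
  decide +kernel

end PencilMPS

namespace PencilMPS

/-! ### Mixed sequences, and the classification of all strings -/

lemma periodic_pow_sub {α : Type*} {f : ℕ → α} {p : ℕ} (h : Function.Periodic f p) {i j q : ℕ}
    (e : i = j + q * p) : f i = f j := e ▸ periodic_add_mul h j q

lemma classified_swap : ∀ a, ∀ x ∈ [((0 : Fin 6), reflCode a), (reflCode a, 0)],
    classified (orbitCodes Prod.swap Prod.fst x 12) = true := by
  decide +kernel

/-- Cyclic rotation of triples. -/
def tripleStep (x : Fin 6 × Fin 6 × Fin 6) : Fin 6 × Fin 6 × Fin 6 := (x.2.1, x.2.2, x.1)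

lemma classified_triple : ∀ a, ∀ x ∈ [((0 : Fin 6), reflCode a, reflCode a),
      (reflCode a, 0, reflCode a), (reflCode a, reflCode a, 0)],
    classified (orbitCodes tripleStep Prod.fst x 12) = true := by
  decide +kernel

lemma decode_zero : decode 0 = 1 := by decide

lemma hasClass_of_alternating {s : ℕ → S3} {a : ZMod 3} {k : ℕ} (h0 : s k = 1)
    (h1 : s (k + 1) = refl a) (hp : Function.Periodic s 2) : HasClass s := by
  have key : ∀ x : Fin 6 × Fin 6, x ∈ [((0 : Fin 6), reflCode a), (reflCode a, 0)] →
      s 0 = decode x.1 → s 1 = decode x.2 → HasClass s := by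
    intro x hx e0 e1
    have hf : ∀ k, Prod.swap^[k + 1] x = Prod.swap (Prod.swap^[k] x) := fun k =>
      Function.iterate_succ_apply' _ _ _
    have hs : ∀ k, s k = decode (Prod.swap^[k] x).1 ∧ s (k + 1) = decode (Prod.swap^[k] x).2 := by
      intro k
      induction k with
      | zero => exact ⟨e0, e1⟩
      | succ k ih => rw [hf]; exact ⟨ih.2, (hp k).trans ih.1⟩
    exact hasClass_of_orbit (f := fun k => Prod.swap^[k] x) hf (fun k => (hs k).1) rfl
      (classified_swap a x hx)
  rcases Nat.even_or_odd' k with ⟨q, rfl | rfl⟩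
  · refine key (0, reflCode a) (by simp) ?_ ?_
    · rw [decode_zero, ← h0]; exact (periodic_pow_sub hp (q := q) (by ring)).symm
    · rw [decode_reflCode, ← h1]; exact (periodic_pow_sub hp (q := q) (by ring)).symm
  · refine key (reflCode a, 0) (by simp) ?_ ?_
    · rw [decode_reflCode, ← h1]; exact (periodic_pow_sub hp (q := q + 1) (by ring)).symm
    · rw [decode_zero, ← h0]; exact (periodic_pow_sub hp (q := q) (by ring)).symm

lemma hasClass_of_triple {s : ℕ → S3} {a : ZMod 3} {k : ℕ} (h0 : s k = 1)
    (h1 : s (k + 1) = refl a) (h2 : s (k + 2) = refl a) (hp : Function.Periodic s 3) :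
    HasClass s := by
  have key : ∀ x : Fin 6 × Fin 6 × Fin 6, x ∈ [((0 : Fin 6), reflCode a, reflCode a),
      (reflCode a, 0, reflCode a), (reflCode a, reflCode a, 0)] →
      s 0 = decode x.1 → s 1 = decode x.2.1 → s 2 = decode x.2.2 → HasClass s := by
    intro x hx e0 e1 e2
    have hf : ∀ k, tripleStep^[k + 1] x = tripleStep (tripleStep^[k] x) := fun k =>
      Function.iterate_succ_apply' _ _ _
    have hs : ∀ k, s k = decode (tripleStep^[k] x).1 ∧ s (k + 1) = decode (tripleStep^[k] x).2.1 ∧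
        s (k + 2) = decode (tripleStep^[k] x).2.2 := by
      intro k
      induction k with
      | zero => exact ⟨e0, e1, e2⟩
      | succ k ih => rw [hf]; exact ⟨ih.2.1, ih.2.2, (hp k).trans ih.1⟩
    exact hasClass_of_orbit (f := fun k => tripleStep^[k] x) hf (fun k => (hs k).1) rfl
      (classified_triple a x hx)
  obtain ⟨q, hq⟩ : ∃ q, k = 3 * q ∨ k = 3 * q + 1 ∨ k = 3 * q + 2 := ⟨k / 3, by omega⟩
  rcases hq with rfl | rfl | rfl
  · refine key (0, reflCode a, reflCode a) (by simp) ?_ ?_ ?_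
    · rw [decode_zero, ← h0]; exact (periodic_pow_sub hp (q := q) (by ring)).symm
    · rw [decode_reflCode, ← h1]; exact (periodic_pow_sub hp (q := q) (by ring)).symm
    · rw [decode_reflCode, ← h2]; exact (periodic_pow_sub hp (q := q) (by ring)).symm
  · refine key (reflCode a, 0, reflCode a) (by simp) ?_ ?_ ?_
    · rw [decode_reflCode, ← h2]; exact (periodic_pow_sub hp (q := q + 1) (by ring)).symm
    · rw [decode_zero, ← h0]; exact (periodic_pow_sub hp (q := q) (by ring)).symm
    · rw [decode_reflCode, ← h1]; exact (periodic_pow_sub hp (q := q) (by ring)).symm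
  · refine key (reflCode a, reflCode a, 0) (by simp) ?_ ?_ ?_
    · rw [decode_reflCode, ← h1]; exact (periodic_pow_sub hp (q := q + 1) (by ring)).symm
    · rw [decode_reflCode, ← h2]; exact (periodic_pow_sub hp (q := q + 1) (by ring)).symm
    · rw [decode_zero, ← h0]; exact (periodic_pow_sub hp (q := q) (by ring)).symm

lemma IsTableSequence.hasClass {s : ℕ → S3} (h : IsTableSequence s) : HasClass s := by
  rcases h with ⟨ρ, h⟩ | ⟨n, t, hs, h⟩ | ⟨n, t, hs, h⟩ | ⟨a, k, h0, h1, h | ⟨h2, h⟩⟩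
  · obtain ⟨r, rfl⟩ := decode_surjective ρ
    choose x hx using fun k => decode_surjective (s k)
    refine hasClass_of_orbit (f := fun k => (r, x k)) (step := conjStep) (out := Prod.snd)
      (fun k => ?_) (fun k => (hx k).symm) (conjStep_iterate _ _) (classified_conj _ _)
    rw [conjStep]
    congr 1
    apply decode_injective
    rw [decode_codeMul, decode_codeMul, decode_codeInv, hx, hx, h]
  · refine hasClass_of_orbit (f := fun k => (t, n k, n (k + 1))) (step := rotStep)
      (out := fun x => rotCode x.2.1) (fun k => ?_) (fun k => ?_) (rotStep_iterate _ _ _)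
      (classified_rot _ _ _)
    · simp only [rotStep, ← h]
    · rw [decode_rotCode, hs]
  · refine hasClass_of_orbit (f := fun k => (t, n k, n (k + 1), n (k + 2))) (step := reflStep)
      (out := fun x => reflCode x.2.1) (fun k => ?_) (fun k => ?_) (reflStep_iterate _ _ _ _)
      (classified_refl _ _ _ _)
    · simp only [reflStep, Prod.mk.injEq, true_and]
      linear_combination h k
    · rw [decode_reflCode, hs]
  · exact hasClass_of_alternating h0 h1 h
  · exact hasClass_of_triple h0 h1 h2 h

/-- The classification of the strings of permutations that occur in cycles. -/
theorem HasString.classification {c : Mat3} (hc : IsUnit c.det) {N : ℕ} [NeZero N]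
    {σ : Fin N → S3} (h : HasString c σ) :
    (σ = 1 ∨ ∃ (X : CycleLabel) (w : Fin X.length → S3),
      IsRepetition w σ ∧ generatedGroup w = generatedGroup X.word) ∧
    ∃ n ∈ ({1, 2, 3, 4, 6} : Set ℕ), IsMinimalLength σ n := by
  obtain ⟨m, hm, hp, hmin, hX⟩ := (h.isTableSequence hc).hasClass
  have hm0 : 0 < m := by
    simp only [Set.mem_insert_iff, Set.mem_singleton_iff] at hm
    omega
  -- Otherwise gcd(m, N) would be a period shorter than m.
  have hmN : m ∣ N := by
    by_contra hnd
    have hg := periodic_gcd m N hp (unroll_periodic σ)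
    refine hmin _ (Nat.gcd_pos_of_pos_left _ hm0) ?_ hg
    refine lt_of_le_of_ne (Nat.gcd_le_left _ hm0) fun e => hnd ?_
    rw [← e]; exact Nat.gcd_dvd_right _ _
  have hrep : ∀ n [NeZero n], n ∣ N → Function.Periodic (unroll σ) n →
      IsRepetition (fun k : Fin n => unroll σ k) σ := by
    intro n _ hd hn
    rw [isRepetition_iff, unroll_restrict hn]
    exact ⟨hd, fun _ => rfl⟩
  constructor
  · rcases hX with h1 | ⟨X, rfl, hG⟩
    · left
      funext k
      rw [← unroll_val σ, h1]; rfl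
    · exact Or.inr ⟨X, _, hrep _ hmN hp, hG⟩
  · have : NeZero m := ⟨hm0.ne'⟩
    refine ⟨m, hm, ⟨hm0, _, hrep m hmN hp⟩, ?_⟩
    rintro p ⟨hp0, w, hw⟩
    have : NeZero p := ⟨hp0.ne'⟩
    rw [isRepetition_iff] at hw
    by_contra hlt
    refine hmin p hp0 (not_le.1 hlt) ?_
    rw [show unroll σ = unroll w from funext hw.2]
    exact unroll_periodic w

/-- Only proper divisors p of the length need excluding, because a repetition requires divisibility.
-/
lemma CycleLabel.exists_codes_ne (X : CycleLabel) :
    ((List.range X.codes.length).all fun p => p == 0 || !(X.codes.length % p == 0) ||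
      (List.range X.codes.length).any fun i => (List.range X.codes.length).any fun j =>
        i % p == j % p && !(X.codes.getD i 0 == X.codes.getD j 0)) = true := by
  cases X <;> decide +kernel

lemma CycleLabel.exists_word_ne (X : CycleLabel) {p : ℕ} (hp : p < X.length) (hp0 : 0 < p)
    (hd : p ∣ X.length) : ∃ i j : Fin X.length, (i : ℕ) % p = (j : ℕ) % p ∧
      X.word i ≠ X.word j := by
  have h := List.all_eq_true.1 X.exists_codes_ne p
    (List.mem_range.2 (by rwa [X.length_codes]))
  simp only [X.length_codes, Nat.dvd_iff_mod_eq_zero.1 hd, hp0.ne', Bool.or_eq_true,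
    List.any_eq_true, List.mem_range, Bool.and_eq_true, beq_iff_eq, Bool.not_eq_true',
    beq_eq_false_iff_ne, ne_eq, not_true_eq_false, or_false, false_or] at h
  obtain ⟨i, hi, j, hj, hij, hne⟩ := h
  refine ⟨⟨i, hi⟩, ⟨j, hj⟩, hij, fun e => hne ?_⟩
  rw [X.word_eq] at e
  exact decode_injective e

/-- The table entries have their lengths as minimal lengths. -/
lemma CycleLabel.isMinimalLength (X : CycleLabel) : IsMinimalLength X.word X.length := by
  refine ⟨⟨NeZero.pos _, _, isRepetition_iff.2 ⟨dvd_rfl, fun _ => rfl⟩⟩, ?_⟩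
  rintro p ⟨hp0, w, hd, hw⟩
  by_contra hlt
  obtain ⟨i, j, hij, hne⟩ := X.exists_word_ne (not_le.1 hlt) hp0 hd
  refine hne ?_
  rw [hw i ⟨(i : ℕ) % p, Nat.mod_lt _ hp0⟩ rfl, hw j ⟨(i : ℕ) % p, Nat.mod_lt _ hp0⟩ hij.symm]

end PencilMPS

namespace PencilMPS

/-! ### Linear algebra of three by three matrices -/

/-- An algebra automorphism of the matrix algebra is inner. -/
lemma exists_inner (F : Mat3 →ₐ[ℂ] Mat3) (hF : Function.Bijective F) :
    ∃ w : GL (Fin 3) ℂ, ∀ Y, F Y = (w : Mat3) * Y * ((w⁻¹ : GL (Fin 3) ℂ) : Mat3) := by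
  let e : Mat3 ≃ₐ[ℂ] Mat3 := AlgEquiv.ofBijective F hF
  let t : Mat3 ≃ₐ[ℂ] Module.End ℂ (Fin 3 → ℂ) := Matrix.toLinAlgEquiv'
  obtain ⟨T, hT⟩ := ((t.symm.trans e).trans t).eq_linearEquivConjAlgEquiv
  have h1 : t.symm T.toLinearMap * t.symm T.symm.toLinearMap = 1 := by
    rw [← map_mul, Module.End.mul_eq_comp, LinearEquiv.comp_symm]
    exact map_one t.symm
  have h2 : t.symm T.symm.toLinearMap * t.symm T.toLinearMap = 1 := by
    rw [← map_mul, Module.End.mul_eq_comp, LinearEquiv.symm_comp]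
    exact map_one t.symm
  refine ⟨⟨t.symm T.toLinearMap, t.symm T.symm.toLinearMap, h1, h2⟩, fun Y => ?_⟩
  have h3 : t (F Y) = T.toLinearMap ∘ₗ t Y ∘ₗ T.symm.toLinearMap := by
    have h4 := congrArg (fun f => f (t Y)) hT
    simpa [e, LinearEquiv.conjAlgEquiv_apply] using h4
  apply t.injective
  rw [h3]
  change _ = t (t.symm T.toLinearMap * Y * t.symm T.symm.toLinearMap)
  rw [map_mul, map_mul, t.apply_symm_apply, t.apply_symm_apply]
  rfl

lemma exists_smul_one_of_commute {R : Mat3} (h : ∀ X : Mat3, R * X = X * R) :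
    ∃ z : ℂ, R = z • 1 := by
  obtain ⟨z, hz⟩ := Matrix.mem_range_scalar_iff_commute_single.2
    fun i j _ => (h (Matrix.single i j 1)).symm
  exact ⟨z, by rw [← hz, Matrix.scalar_apply, Matrix.smul_one_eq_diagonal]⟩

lemma exists_trace_form (f : Mat3 →ₗ[ℂ] ℂ) : ∃ X : Mat3, ∀ Y, f Y = (X * Y).trace := by
  refine ⟨Matrix.of fun i j => f (Matrix.single j i 1), fun Y => ?_⟩
  conv_lhs => rw [Matrix.matrix_eq_sum_single Y]
  rw [Matrix.trace_mul_comm]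
  simp only [map_sum, Matrix.trace, Matrix.diag_apply, Matrix.mul_apply, Matrix.of_apply]
  refine Finset.sum_congr rfl fun i _ => Finset.sum_congr rfl fun j _ => ?_
  rw [← mul_one (Y i j), ← smul_eq_mul, ← Matrix.smul_single, map_smul, smul_eq_mul, smul_eq_mul,
    mul_one]

/-- A family of matrices on which the trace form separates points is spanning. -/
lemma span_eq_top_of_trace {ι : Type*} {v : ι → Mat3}
    (h : ∀ X : Mat3, (∀ i, (X * v i).trace = 0) → X = 0) :
    Submodule.span ℂ (Set.range v) = ⊤ := by
  by_contra hne
  obtain ⟨f, hf0, hf⟩ := Submodule.exists_le_ker_of_lt_top _ (lt_top_iff_ne_top.2 hne)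
  obtain ⟨X, hX⟩ := exists_trace_form f
  have hX0 : X = 0 := h X fun i => by
    rw [← hX]
    exact hf (Submodule.subset_span ⟨i, rfl⟩)
  exact hf0 (LinearMap.ext fun Y => by rw [hX, hX0]; simp)

/-! ### Products of site dependent tensors -/

/-- The product of the matrices `B_k^{s_0} B_{k+1}^{s_1} ⋯`. -/
def prodFrom (B : ℕ → Fin 2 → Mat3) : ℕ → List (Fin 2) → Mat3
  | _, [] => 1
  | k, i :: s => B k i * prodFrom B (k + 1) s

lemma prodFrom_append (B : ℕ → Fin 2 → Mat3) (s t : List (Fin 2)) :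
    ∀ k, prodFrom B k (s ++ t) = prodFrom B k s * prodFrom B (k + s.length) t := by
  induction s with
  | nil => intro k; simp [prodFrom]
  | cons i s ih =>
    intro k
    rw [List.cons_append, prodFrom, prodFrom, ih, mul_assoc, List.length_cons,
      show k + 1 + s.length = k + (s.length + 1) by ring]

lemma prodFrom_shift {B B' : ℕ → Fin 2 → Mat3} {d : ℕ} (s : List (Fin 2)) :
    ∀ k, (∀ n ≥ k, B (n + d) = B' n) → prodFrom B (k + d) s = prodFrom B' k s := by
  induction s with
  | nil => intro k _; rfl
  | cons i s ih =>
    intro k h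
    rw [prodFrom, prodFrom, h k le_rfl, ← ih (k + 1) fun n hn => h n (by omega),
      add_right_comm]

lemma tensorProd_eq_prodFrom (A : TriState) {N : ℕ} (s : Fin N → Fin 2) (k : ℕ) :
    tensorProd A s = prodFrom (fun _ => tensor A) k (List.ofFn s) := by
  rw [tensorProd]
  induction N generalizing k with
  | zero => simp [prodFrom]
  | succ N ih =>
    rw [List.ofFn_succ, List.ofFn_succ, List.prod_cons, prodFrom, ← ih (fun i => s i.succ)]

/-- Words of a given length separate matrices through the trace. -/
def Separates (B : ℕ → Fin 2 → Mat3) (k n : ℕ) : Prop :=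
  ∀ X : Mat3, (∀ s : List (Fin 2), s.length = n → (X * prodFrom B k s).trace = 0) → X = 0

lemma IsInjectivityLength.separates {A : TriState} {L : ℕ} (h : IsInjectivityLength A L) (k : ℕ) :
    Separates (fun _ => tensor A) k L := by
  intro X hX
  refine h (funext fun s => ?_)
  simp only [zero_mul, Matrix.trace_zero]
  rw [tensorProd_eq_prodFrom A s k]
  exact hX _ (List.length_ofFn)

lemma Separates.succ {B : ℕ → Fin 2 → Mat3} {k n : ℕ} (h : Separates B (k + 1) n) {i : Fin 2}
    (hi : IsUnit (B k i).det) : Separates B k (n + 1) := by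
  intro X hX
  have h1 : X * B k i = 0 := h _ fun s hs => by
    have h2 := hX (i :: s) (by rw [List.length_cons, hs])
    rwa [prodFrom, ← mul_assoc] at h2
  rw [← Matrix.mul_nonsing_inv_cancel_right (B k i) X hi, h1, zero_mul]

lemma Separates.span_eq_top {B : ℕ → Fin 2 → Mat3} {k n : ℕ} (h : Separates B k n) :
    Submodule.span ℂ (Set.range fun s : {s : List (Fin 2) // s.length = n} => prodFrom B k s) =
      ⊤ :=
  span_eq_top_of_trace fun X hX => h X fun s hs => hX ⟨s, hs⟩

/-- Acting with invertible matrices on the sites does not change the separation property. -/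
lemma Separates.of_local {A : Fin 2 → Mat3} {B : ℕ → Fin 2 → Mat3}
    (hAB : ∀ k, ∃ g : Matrix (Fin 2) (Fin 2) ℂ, ∀ i, A i = ∑ j, g i j • B k j) {n : ℕ} {k : ℕ}
    (h : Separates (fun _ => A) k n) : Separates B k n := by
  intro X hX
  refine h X fun s hs => ?_
  clear h
  induction n generalizing X k s with
  | zero =>
    rw [List.length_eq_zero_iff] at hs
    subst hs
    exact hX [] rfl
  | succ n ih =>
    obtain ⟨i, s, rfl⟩ := List.exists_cons_of_length_eq_add_one hs
    rw [prodFrom, ← mul_assoc]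
    obtain ⟨g, hg⟩ := hAB k
    have h1 : ∀ j, (X * B k j * prodFrom (fun _ => A) (k + 1) s).trace = 0 := fun j =>
      ih (X * B k j) (fun s' hs' => by
        have h2 := hX (j :: s') (by rw [List.length_cons, hs'])
        rwa [prodFrom, ← mul_assoc] at h2) s (by simpa using hs)
    rw [hg i, Finset.mul_sum, Finset.sum_mul, Matrix.trace_sum]
    refine Finset.sum_eq_zero fun j _ => ?_
    rw [mul_smul_comm, smul_mul_assoc, Matrix.trace_smul, h1, smul_zero]

/-! ### Local operators on matrix product states -/

lemma prod_sum_ofFn {N : ℕ} (c : Fin N → Fin 2 → ℂ) (A : Fin 2 → Mat3) :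
    (List.ofFn fun k => ∑ j, c k j • A j).prod =
      ∑ t : Fin N → Fin 2, (∏ k, c k (t k)) • (List.ofFn fun k => A (t k)).prod := by
  induction N with
  | zero => simp
  | succ N ih =>
    rw [List.ofFn_succ, List.prod_cons, ih, Finset.sum_mul_sum, ← Fintype.sum_prod_type',
      ← (Fin.consEquiv fun _ => Fin 2).sum_comp]
    refine Finset.sum_congr rfl fun x _ => ?_
    simp [Fin.prod_univ_succ, Fin.consEquiv, List.ofFn_succ, smul_smul, mul_comm (c 0 x.1)]

/-- The tensors obtained by acting on the physical index. -/
def actTensor (A : TriState) (g : Matrix (Fin 2) (Fin 2) ℂ) (i : Fin 2) : Mat3 :=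
  ∑ j, g i j • tensor A j

lemma localOp_mulVec_mps (A : TriState) {N : ℕ} (g : Fin N → Matrix (Fin 2) (Fin 2) ℂ)
    (s : Fin N → Fin 2) : (localOp g *ᵥ mps A N) s =
      (List.ofFn fun k => actTensor A (g k) (s k)).prod.trace := by
  simp only [actTensor]
  rw [prod_sum_ofFn (fun k j => g k (s k) j) (tensor A), Matrix.trace_sum]
  simp [localOp, Matrix.mulVec, dotProduct, mps, tensorProd]

lemma prod_ofFn_eq_prodFrom {N : ℕ} (C : ℕ → Fin 2 → Mat3) (s : Fin N → Fin 2) (k : ℕ) :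
    (List.ofFn fun i : Fin N => C (k + i) (s i)).prod = prodFrom C k (List.ofFn s) := by
  induction N generalizing k with
  | zero => simp [prodFrom]
  | succ N ih =>
    rw [List.ofFn_succ, List.ofFn_succ, List.prod_cons, prodFrom, ← ih (fun i => s i.succ)]
    simp [add_assoc, add_comm 1]

end PencilMPS

namespace PencilMPS

/-! ### Uniqueness of injective matrix product representations -/

section Gauge

variable {A : Fin 2 → Mat3} {B : ℕ → Fin 2 → Mat3}

lemma prodFrom_const (A : Fin 2 → Mat3) (s : List (Fin 2)) (k : ℕ) :
    prodFrom (fun _ => A) k s = prodFrom (fun _ => A) 0 s := by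
  simpa using prodFrom_shift (B := fun _ => A) (B' := fun _ => A) (d := k) s 0 fun _ _ => rfl

/-- Cyclicity of the trace moves the first site to the end; the right-hand side is unaffected since
A does not depend on the site. The chain has N + 1 sites. -/
lemma trace_prodFrom_eq {N : ℕ} (hN : Function.Periodic B (N + 1))
    (h : ∀ s : List (Fin 2), s.length = N + 1 →
      (prodFrom B 0 s).trace = (prodFrom (fun _ => A) 0 s).trace) (k : ℕ) :
    ∀ s : List (Fin 2), s.length = N + 1 →
      (prodFrom B k s).trace = (prodFrom (fun _ => A) 0 s).trace := by
  induction k with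
  | zero => exact h
  | succ k ih =>
    intro s hs
    obtain ⟨t, j, rfl⟩ : ∃ t j, s = t ++ [j] :=
      ⟨s.dropLast, s.getLast (by rintro rfl; simp at hs),
        (List.dropLast_append_getLast _).symm⟩
    have ht : t.length = N := by simpa using hs
    have h1 := ih (j :: t) (by simp [ht])
    rw [prodFrom_append, ht, prodFrom_append, Matrix.trace_mul_comm, Matrix.trace_mul_comm _
      (prodFrom _ (0 + t.length) [j]), prodFrom_const A [j], show k + 1 + N = k + (N + 1) by ring]
    simp only [prodFrom, mul_one] at h1 ⊢
    rw [hN k, h1, zero_add, prodFrom_const A t 1]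

/-- The linear map sending the words in `A` to the corresponding words in `B`. -/
lemma exists_transfer {k n m : ℕ}
    (h : ∀ s : List (Fin 2), s.length = n + m →
      (prodFrom B k s).trace = (prodFrom (fun _ => A) 0 s).trace)
    (hA : Separates (fun _ => A) 0 n) (hA' : Separates (fun _ => A) 0 m)
    (hB : Separates B (k + n) m) :
    ∃ φ : Mat3 →ₗ[ℂ] Mat3, Function.Bijective φ ∧
      ∀ s : List (Fin 2), s.length = n → φ (prodFrom (fun _ => A) 0 s) = prodFrom B k s := by
  let V := Finsupp.linearCombination ℂ
    fun s : {s : List (Fin 2) // s.length = n} => prodFrom (fun _ => A) 0 s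
  let U := Finsupp.linearCombination ℂ
    fun s : {s : List (Fin 2) // s.length = n} => prodFrom B k s
  -- The words on the complementary m sites test both combinations equally. As these words separate
  -- matrices, U and V have the same kernel, so U factors through V.
  have hUV : ∀ c, ∀ t : List (Fin 2), t.length = m →
      (U c * prodFrom B (k + n) t).trace = (V c * prodFrom (fun _ => A) 0 t).trace := by
    intro c t ht
    simp only [U, V, Finsupp.linearCombination_apply, Finsupp.sum, Finset.sum_mul,
      Matrix.trace_sum, smul_mul_assoc, Matrix.trace_smul]
    refine Finset.sum_congr rfl fun s _ => ?_
    have h1 := h (s ++ t) (by rw [List.length_append, s.2, ht])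
    rw [prodFrom_append, prodFrom_append, s.2, prodFrom_const A t] at h1
    rw [h1]
  obtain ⟨r, hr⟩ := LinearMap.exists_rightInverse_of_surjective V (by
    rw [Finsupp.range_linearCombination]; exact hA.span_eq_top)
  have hr' : ∀ X, V (r X) = X := fun X => congrArg (fun f => f X) hr
  have hker : ∀ c, V c = 0 → U c = 0 := fun c hc => hB _ fun t ht => by
    rw [hUV c t ht, hc, zero_mul, Matrix.trace_zero]
  have hφ : ∀ c, U (r (V c)) = U c := fun c => by
    rw [← sub_eq_zero, ← map_sub]
    exact hker _ (by rw [map_sub, hr', sub_self])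
  have hinj : Function.Injective (U ∘ₗ r) := by
    rw [injective_iff_map_eq_zero]
    intro X hX
    refine hA' X fun t ht => ?_
    rw [← hr' X, ← hUV _ t ht]
    rw [LinearMap.comp_apply] at hX
    rw [hX, zero_mul, Matrix.trace_zero]
  refine ⟨U ∘ₗ r, ⟨hinj, LinearMap.injective_iff_surjective.1 hinj⟩, fun s hs => ?_⟩
  have h1 := hφ (Finsupp.single ⟨s, hs⟩ 1)
  simpa [U, V] using h1

lemma linearMap_ext_words {n : ℕ} (hA : Separates (fun _ => A) 0 n) {f g : Mat3 →ₗ[ℂ] Mat3}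
    (h : ∀ s : List (Fin 2), s.length = n →
      f (prodFrom (fun _ => A) 0 s) = g (prodFrom (fun _ => A) 0 s)) : f = g :=
  LinearMap.ext_on_range hA.span_eq_top fun s => h s s.2

/-- Transfer maps of lengths `L` and `L + 1`, at all sites. -/
structure Transfer (A : Fin 2 → Mat3) (B : ℕ → Fin 2 → Mat3) (L : ℕ)
    (φ ψ : ℕ → Mat3 →ₗ[ℂ] Mat3) : Prop where
  bijective : ∀ k, Function.Bijective (φ k)
  injective_succ : ∀ k, Function.Injective (ψ k)
  right : ∀ k i X, ψ k (X * A i) = φ k X * B (k + L) i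
  left : ∀ k i X, ψ k (A i * X) = B k i * φ (k + 1) X

/-- Words of length L and of length L + 1 both leave at least L sites out of N + 1, and this is
where the bound N ≥ 2L + 1 of the theorem enters. The two ways of extending a word of length L by a
letter give the rules of `Transfer`. -/
lemma exists_transfer_maps {N L : ℕ} (hL : L + L ≤ N)
    (hN : Function.Periodic B (N + 1))
    (h : ∀ s : List (Fin 2), s.length = N + 1 →
      (prodFrom B 0 s).trace = (prodFrom (fun _ => A) 0 s).trace)
    (hA : ∀ n ≥ L, Separates (fun _ => A) 0 n) (hB : ∀ k, ∀ n ≥ L, Separates B k n) :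
    ∃ φ ψ : ℕ → Mat3 →ₗ[ℂ] Mat3, Transfer A B L φ ψ ∧ Function.Periodic φ (N + 1) := by
  have hmod : ∀ k s, prodFrom B (k % (N + 1)) s = prodFrom B k s := fun k s => by
    conv_rhs => rw [← Nat.mod_add_div k (N + 1), mul_comm]
    refine (prodFrom_shift s _ fun n _ => ?_).symm
    exact hN.nat_mul _ n
  have key : ∀ n, L ≤ n → n + L ≤ N + 1 → ∀ k, ∃ φ : Mat3 →ₗ[ℂ] Mat3, Function.Bijective φ ∧
      ∀ s : List (Fin 2), s.length = n → φ (prodFrom (fun _ => A) 0 s) = prodFrom B k s := by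
    intro n hn hn' k
    refine exists_transfer (m := N + 1 - n) (fun s hs => ?_) (hA n hn) (hA _ (by omega))
      (hB _ _ (by omega))
    exact trace_prodFrom_eq hN h k s (by omega)
  choose φ hφb hφ using key L le_rfl (by omega)
  choose ψ hψb hψ using key (L + 1) (by omega) (by omega)
  -- The maps were chosen separately at each site; reducing the index makes φ truly periodic.
  refine ⟨fun k => φ (k % (N + 1)), ψ, ⟨fun k => hφb _, fun k => (hψb k).1, fun k i X => ?_,
    fun k i X => ?_⟩, fun k => by simp⟩
  · refine congrArg (fun f : Mat3 →ₗ[ℂ] Mat3 => f X) (linearMap_ext_words (hA L le_rfl)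
      (f := ψ k ∘ₗ LinearMap.mulRight ℂ (A i))
      (g := LinearMap.mulRight ℂ (B (k + L) i) ∘ₗ φ (k % (N + 1))) fun s hs => ?_)
    have h1 := hψ k (s ++ [i]) (by simp [hs])
    simpa [prodFrom_append, prodFrom, hs, hφ _ s hs, hmod] using h1
  · refine congrArg (fun f : Mat3 →ₗ[ℂ] Mat3 => f X) (linearMap_ext_words (hA L le_rfl)
      (f := ψ k ∘ₗ LinearMap.mulLeft ℂ (A i))
      (g := LinearMap.mulLeft ℂ (B k i) ∘ₗ φ ((k + 1) % (N + 1))) fun s hs => ?_)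
    have h1 := hψ k (i :: s) (by simp [hs])
    simpa [prodFrom, hs, hφ _ s hs, hmod, prodFrom_const A s 1] using h1

lemma isUnit_det_of_mul_left {M : Mat3} (h : ∀ Z : Mat3, M * Z = 0 → Z = 0) : IsUnit M.det := by
  rw [← Matrix.isUnit_iff_isUnit_det]
  have hs : Function.Surjective (LinearMap.mulLeft ℂ M) := by
    rw [← LinearMap.injective_iff_surjective, injective_iff_map_eq_zero]
    exact h
  obtain ⟨Z, hZ⟩ := hs 1
  exact IsUnit.of_mul_eq_one Z hZ

variable {L : ℕ} {φ ψ : ℕ → Mat3 →ₗ[ℂ] Mat3} {b : GL (Fin 3) ℂ}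

namespace Transfer

/-- The letter 1 of A is the invertible b and ψ k is injective, so left multiplication by B k 1 has
no kernel. -/
lemma isUnit_det (h : Transfer A B L φ ψ) (hb : A 1 = b) (k : ℕ) : IsUnit (B k 1).det := by
  refine isUnit_det_of_mul_left fun Z hZ => ?_
  obtain ⟨X, rfl⟩ := (h.bijective (k + 1)).2 Z
  rw [← h.left] at hZ
  have h1 := h.injective_succ k (hZ.trans (map_zero _).symm)
  rw [hb] at h1
  have h2 : X = 0 := by
    calc X = ((b⁻¹ : GL (Fin 3) ℂ) : Mat3) * ((b : Mat3) * X) := by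
          rw [← mul_assoc, GL_inv_mul, one_mul]
      _ = 0 := by rw [h1, mul_zero]
  rw [h2, map_zero]

/-- Matrices by which `φ k` may be multiplied from the right. -/
def Good (φ : ℕ → Mat3 →ₗ[ℂ] Mat3) (k : ℕ) : Submodule ℂ Mat3 where
  carrier := {Y | ∃ Z, ∀ X, φ k (X * Y) = φ k X * Z}
  add_mem' := by
    rintro Y Y' ⟨Z, hZ⟩ ⟨Z', hZ'⟩
    exact ⟨Z + Z', fun X => by rw [mul_add, map_add, hZ, hZ', mul_add]⟩
  zero_mem' := ⟨0, fun X => by simp⟩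
  smul_mem' := by
    rintro c Y ⟨Z, hZ⟩
    exact ⟨c • Z, fun X => by rw [mul_smul_comm, map_smul, hZ, mul_smul_comm]⟩

lemma good_mul {k : ℕ} {Y Y' : Mat3} (h : Y ∈ Good φ k) (h' : Y' ∈ Good φ k) :
    Y * Y' ∈ Good φ k := by
  obtain ⟨Z, hZ⟩ := h
  obtain ⟨Z', hZ'⟩ := h'
  exact ⟨Z * Z', fun X => by rw [← mul_assoc, hZ', hZ, mul_assoc]⟩

/-- Appending the letter 1 inside ψ k cancels b⁻¹ on one side and contributes the invertible B (k +
L) 1 on the other. -/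
lemma apply_mul_letter (h : Transfer A B L φ ψ) (hb : A 1 = b) (k : ℕ) (i : Fin 2) (X : Mat3) :
    φ k (X * (A i * ((b⁻¹ : GL (Fin 3) ℂ) : Mat3))) = φ k X * (B (k + L) i * (B (k + L) 1)⁻¹) := by
  have h1 := h.right k 1 (X * (A i * ((b⁻¹ : GL (Fin 3) ℂ) : Mat3)))
  rw [hb, mul_assoc, mul_assoc, GL_inv_mul, mul_one, h.right] at h1
  rw [← mul_assoc, ← mul_assoc, h1, mul_assoc X,
    Matrix.mul_nonsing_inv_cancel_right _ _ (h.isUnit_det hb _)]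

lemma apply_conj (h : Transfer A B L φ ψ) (hb : A 1 = b) (k : ℕ) (X : Mat3) :
    φ k ((b : Mat3) * X * ((b⁻¹ : GL (Fin 3) ℂ) : Mat3)) =
      B k 1 * φ (k + 1) X * (B (k + L) 1)⁻¹ := by
  have h1 := h.right k 1 ((b : Mat3) * X * ((b⁻¹ : GL (Fin 3) ℂ) : Mat3))
  rw [hb, mul_assoc _ _ (b : Mat3), GL_inv_mul, mul_one, ← hb, h.left] at h1
  rw [← hb, h1, Matrix.mul_nonsing_inv_cancel_right _ _ (h.isUnit_det hb _)]

lemma good_conj (h : Transfer A B L φ ψ) (hb : A 1 = b) {k : ℕ} {Y : Mat3}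
    (hY : Y ∈ Good φ (k + 1)) :
    (b : Mat3) * Y * ((b⁻¹ : GL (Fin 3) ℂ) : Mat3) ∈ Good φ k := by
  obtain ⟨Z, hZ⟩ := hY
  refine ⟨B (k + L) 1 * Z * (B (k + L) 1)⁻¹, fun X => ?_⟩
  have e : X = (b : Mat3) * (((b⁻¹ : GL (Fin 3) ℂ) : Mat3) * X * (b : Mat3)) *
      ((b⁻¹ : GL (Fin 3) ℂ) : Mat3) := by
    simp only [mul_assoc, GL_mul_inv, mul_one]
    rw [← mul_assoc, GL_mul_inv, one_mul]
  have e' : X * ((b : Mat3) * Y * ((b⁻¹ : GL (Fin 3) ℂ) : Mat3)) =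
      (b : Mat3) * (((b⁻¹ : GL (Fin 3) ℂ) : Mat3) * X * (b : Mat3) * Y) *
      ((b⁻¹ : GL (Fin 3) ℂ) : Mat3) := by
    simp only [mul_assoc]
    rw [← mul_assoc (b : Mat3) (((b⁻¹ : GL (Fin 3) ℂ) : Mat3)), GL_mul_inv, one_mul]
  rw [e', h.apply_conj hb, hZ]
  conv_rhs => rw [e, h.apply_conj hb]
  simp only [mul_assoc]
  rw [Matrix.nonsing_inv_mul_cancel_left _ _ (h.isUnit_det hb _)]

lemma word_mem_good (h : Transfer A B L φ ψ) (hb : A 1 = b) (s : List (Fin 2)) : ∀ k,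
    prodFrom (fun _ => A) 0 s * ((b⁻¹ ^ s.length : GL (Fin 3) ℂ) : Mat3) ∈ Good φ k := by
  induction s with
  | nil => exact fun k => ⟨1, fun X => by simp [prodFrom]⟩
  | cons i s ih =>
    intro k
    have h1 : A i * ((b⁻¹ : GL (Fin 3) ℂ) : Mat3) ∈ Good φ k :=
      ⟨_, fun X => h.apply_mul_letter hb k i X⟩
    -- For a word W of length l, A i W b⁻⁽ˡ⁺¹⁾ = (A i b⁻¹) · b (W b⁻ˡ) b⁻¹.
    convert good_mul h1 (h.good_conj hb (ih (k + 1))) using 1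
    rw [prodFrom, prodFrom_const, List.length_cons, pow_succ, Units.val_mul]
    simp only [mul_assoc]
    rw [← mul_assoc (((b⁻¹ : GL (Fin 3) ℂ) : Mat3)), GL_inv_mul, one_mul]

lemma good_eq_top (h : Transfer A B L φ ψ) (hb : A 1 = b) (hA : Separates (fun _ => A) 0 L)
    (k : ℕ) : Good φ k = ⊤ := by
  have h1 : (⊤ : Submodule ℂ Mat3) ≤ (Good φ k).comap
      (LinearMap.mulRight ℂ ((b⁻¹ ^ L : GL (Fin 3) ℂ) : Mat3)) := by
    rw [← hA.span_eq_top, Submodule.span_le]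
    rintro _ ⟨s, rfl⟩
    have h2 := h.word_mem_good hb s k
    rwa [s.2] at h2
  rw [eq_top_iff]
  intro Y _
  have h2 := h1 (Submodule.mem_top (x := Y * ((b ^ L : GL (Fin 3) ℂ) : Mat3)))
  simpa only [Submodule.mem_comap, LinearMap.mulRight_apply, mul_assoc, ← Units.val_mul, inv_pow,
    mul_inv_cancel, Units.val_one, mul_one] using h2

/-- Transfer maps are `Y ↦ φ 1 * (w * Y * w⁻¹)`. -/
lemma exists_gauge (h : Transfer A B L φ ψ) (hb : A 1 = b) (hA : Separates (fun _ => A) 0 L)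
    (k : ℕ) : IsUnit (φ k 1).det ∧ ∃ w : GL (Fin 3) ℂ, ∀ Y,
      φ k Y = φ k 1 * ((w : Mat3) * Y * ((w⁻¹ : GL (Fin 3) ℂ) : Mat3)) := by
  have hg : ∀ Y, ∃ Z, ∀ X, φ k (X * Y) = φ k X * Z := fun Y => by
    have h1 : Y ∈ Good φ k := by rw [h.good_eq_top hb hA]; trivial
    exact h1
  choose F hF using hg
  have hF1 : ∀ Y, φ k Y = φ k 1 * F Y := fun Y => by rw [← hF, one_mul]
  have hu : IsUnit (φ k 1).det := by
    obtain ⟨Y, hY⟩ := (h.bijective k).2 1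
    rw [← Matrix.isUnit_iff_isUnit_det]
    exact IsUnit.of_mul_eq_one (F Y) (by rw [← hF1, hY])
  have hF2 : ∀ Y, F Y = (φ k 1)⁻¹ * φ k Y := fun Y => by
    rw [hF1 Y, Matrix.nonsing_inv_mul_cancel_left _ _ hu]
  -- Every matrix is good, so Y ↦ φ k (1)⁻¹ φ k (Y) is multiplicative, and as an automorphism it is
  -- inner.
  let f : Mat3 →ₐ[ℂ] Mat3 := AlgHom.ofLinearMap (LinearMap.mulLeft ℂ (φ k 1)⁻¹ ∘ₗ φ k)
    (Matrix.nonsing_inv_mul _ hu) fun X Y => by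
      simp only [LinearMap.comp_apply, LinearMap.mulLeft_apply]
      rw [hF, ← hF2 Y, mul_assoc]
  have hf : Function.Injective f := by
    rw [injective_iff_map_eq_zero]
    intro X hX
    have h1 : (φ k 1)⁻¹ * φ k X = 0 := hX
    refine (h.bijective k).1 ?_
    rw [← Matrix.mul_nonsing_inv_cancel_left _ (φ k X) hu, h1, mul_zero, map_zero]
  obtain ⟨w, hw⟩ := exists_inner f ⟨hf,
    (LinearMap.injective_iff_surjective (f := f.toLinearMap)).1 hf⟩
  refine ⟨hu, w, fun Y => ?_⟩
  rw [← hw Y]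
  exact (Matrix.mul_nonsing_inv_cancel_left _ _ hu).symm

/-- Evaluating `apply_mul_letter` at X = 1 gives B (k + L) i = w A i T with T = b⁻¹ w⁻¹ B (k + L) 1.
Comparing the inner automorphisms at k and k + 1 through `apply_conj` shows that T w' is central, so
T is a multiple of w'⁻¹. -/
lemma letter_eq (h : Transfer A B L φ ψ) (hb : A 1 = b) {k : ℕ} (hu : IsUnit (φ k 1).det)
    (hu' : IsUnit (φ (k + 1) 1).det) {w w' : GL (Fin 3) ℂ}
    (hw : ∀ Y, φ k Y = φ k 1 * ((w : Mat3) * Y * ((w⁻¹ : GL (Fin 3) ℂ) : Mat3)))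
    (hw' : ∀ Y, φ (k + 1) Y =
      φ (k + 1) 1 * ((w' : Mat3) * Y * ((w'⁻¹ : GL (Fin 3) ℂ) : Mat3))) :
    ∃ z : ℂ, z ≠ 0 ∧ ∀ i, B (k + L) i =
      z • ((w : Mat3) * A i * ((w'⁻¹ : GL (Fin 3) ℂ) : Mat3)) := by
  obtain ⟨p, hp⟩ : ∃ p : GL (Fin 3) ℂ, (p : Mat3) = φ k 1 :=
    ⟨Matrix.GeneralLinearGroup.mk'' _ hu, rfl⟩
  obtain ⟨p', hp'⟩ : ∃ p : GL (Fin 3) ℂ, (p : Mat3) = φ (k + 1) 1 :=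
    ⟨Matrix.GeneralLinearGroup.mk'' _ hu', rfl⟩
  obtain ⟨l, hl⟩ : ∃ p : GL (Fin 3) ℂ, (p : Mat3) = B k 1 :=
    ⟨Matrix.GeneralLinearGroup.mk'' _ (h.isUnit_det hb k), rfl⟩
  obtain ⟨r, hr⟩ : ∃ p : GL (Fin 3) ℂ, (p : Mat3) = B (k + L) 1 :=
    ⟨Matrix.GeneralLinearGroup.mk'' _ (h.isUnit_det hb _), rfl⟩
  have hri : (B (k + L) 1)⁻¹ = ((r⁻¹ : GL (Fin 3) ℂ) : Mat3) := by
    rw [← hr, Matrix.coe_units_inv]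
  have h0 : ∀ i, B (k + L) i * ((r⁻¹ : GL (Fin 3) ℂ) : Mat3) =
      (w : Mat3) * (A i * ((b⁻¹ : GL (Fin 3) ℂ) : Mat3)) * ((w⁻¹ : GL (Fin 3) ℂ) : Mat3) := by
    intro i
    have h1 := h.apply_mul_letter hb k i 1
    rw [one_mul, hw, hri, ← hp] at h1
    exact (p.isUnit.mul_left_cancel h1).symm
  set R : GL (Fin 3) ℂ := p'⁻¹ * l⁻¹ * p * w * b with hR
  set T : GL (Fin 3) ℂ := b⁻¹ * w⁻¹ * r with hT
  have h1 : ∀ W : Mat3, (R : Mat3) * W * T =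
      (w' : Mat3) * W * ((w'⁻¹ : GL (Fin 3) ℂ) : Mat3) := by
    intro W
    have h2 := h.apply_conj hb k W
    rw [hw, hw' W, hri, ← hp, ← hp', ← hl] at h2
    have h3 : ((p'⁻¹ * l⁻¹ : GL (Fin 3) ℂ) : Mat3) * ((p : Mat3) * ((w : Mat3) * ((b : Mat3) * W *
        ((b⁻¹ : GL (Fin 3) ℂ) : Mat3)) * ((w⁻¹ : GL (Fin 3) ℂ) : Mat3))) * (r : Mat3) =
        ((p'⁻¹ * l⁻¹ : GL (Fin 3) ℂ) : Mat3) * ((l : Mat3) * ((p' : Mat3) * ((w' : Mat3) * W *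
        ((w'⁻¹ : GL (Fin 3) ℂ) : Mat3))) * ((r⁻¹ : GL (Fin 3) ℂ) : Mat3)) * (r : Mat3) := by
      rw [h2]
    have h4 : ((p'⁻¹ * l⁻¹ : GL (Fin 3) ℂ) : Mat3) * (l : Mat3) * (p' : Mat3) = 1 := by
      rw [← Units.val_mul, ← Units.val_mul]; simp
    have h5 : ((r⁻¹ : GL (Fin 3) ℂ) : Mat3) * (r : Mat3) = 1 := GL_inv_mul r
    calc _ = _ := by rw [hR, hT]; simp only [Units.val_mul, mul_assoc]
      _ = _ := h3
      _ = ((p'⁻¹ * l⁻¹ : GL (Fin 3) ℂ) : Mat3) * (l : Mat3) * (p' : Mat3) * ((w' : Mat3) * W *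
        ((w'⁻¹ : GL (Fin 3) ℂ) : Mat3)) * (((r⁻¹ : GL (Fin 3) ℂ) : Mat3) * (r : Mat3)) := by
          simp only [mul_assoc]
      _ = _ := by rw [h4, h5, one_mul, mul_one]
  have h2 : ∀ W : Mat3, ((w'⁻¹ * R : GL (Fin 3) ℂ) : Mat3) * W *
      ((T * w' : GL (Fin 3) ℂ) : Mat3) = W := fun W => by
    calc _ = ((w'⁻¹ : GL (Fin 3) ℂ) : Mat3) * ((R : Mat3) * W * T) * (w' : Mat3) := by
          simp only [Units.val_mul, mul_assoc]
      _ = ((w'⁻¹ : GL (Fin 3) ℂ) : Mat3) * (w' : Mat3) * W *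
          (((w'⁻¹ : GL (Fin 3) ℂ) : Mat3) * (w' : Mat3)) := by rw [h1]; simp only [mul_assoc]
      _ = W := by rw [GL_inv_mul, one_mul, mul_one]
  have h3 : T * w' = (w'⁻¹ * R)⁻¹ := by
    refine (inv_eq_of_mul_eq_one_right (Units.ext ?_)).symm
    have h4 := h2 1
    rwa [mul_one] at h4
  obtain ⟨z, hz⟩ := exists_smul_one_of_commute (R := ((T * w' : GL (Fin 3) ℂ) : Mat3)) fun X => by
    have h4 : ((T * w' : GL (Fin 3) ℂ) : Mat3) * ((w'⁻¹ * R : GL (Fin 3) ℂ) : Mat3) = 1 := by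
      rw [h3, GL_inv_mul]
    conv_lhs => rw [← h2 X]
    rw [← mul_assoc, ← mul_assoc, h4, one_mul]
  have hz0 : z ≠ 0 := by
    rintro rfl
    rw [zero_smul] at hz
    exact (T * w').isUnit.ne_zero hz
  refine ⟨z, hz0, fun i => ?_⟩
  calc B (k + L) i = B (k + L) i * ((r⁻¹ : GL (Fin 3) ℂ) : Mat3) * (r : Mat3) := by
        rw [mul_assoc, GL_inv_mul, mul_one]
    _ = (w : Mat3) * A i * ((T * w' : GL (Fin 3) ℂ) : Mat3) *
        ((w'⁻¹ : GL (Fin 3) ℂ) : Mat3) := by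
        rw [h0, hT]
        simp only [Units.val_mul, mul_assoc]
        rw [GL_mul_inv, mul_one]
    _ = _ := by rw [hz, mul_smul_comm, mul_one, smul_mul_assoc]

end Transfer

end Gauge

end PencilMPS

namespace PencilMPS

/-! ### Symmetries of matrix product states are cycles -/

lemma exists_ofFn_eq {α : Type*} {N : ℕ} (s : List α) (hs : s.length = N) :
    ∃ f : Fin N → α, List.ofFn f = s := by
  subst hs
  exact ⟨s.get, List.ofFn_get s⟩

lemma tensor_fiducial_one (b : GL (Fin 3) ℂ) : tensor (fiducial b) 1 = b := by
  rw [tensor_fiducial, pencil, if_neg one_ne_zero, mul_one]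

lemma IsInjectivityLength.separates_of_le {b : GL (Fin 3) ℂ} {L : ℕ}
    (h : IsInjectivityLength (fiducial b) L) {n : ℕ} (hn : L ≤ n) (k : ℕ) :
    Separates (fun _ => tensor (fiducial b)) k n := by
  induction n, hn using Nat.le_induction generalizing k with
  | base => exact h.separates k
  | succ n _ ih =>
    refine (ih (k + 1)).succ (i := 1) ?_
    rw [tensor_fiducial_one, ← Matrix.isUnit_iff_isUnit_det]
    exact b.isUnit

lemma sum_smul_actTensor (A : TriState) (g : GL (Fin 2) ℂ) (i : Fin 2) :
    tensor A i = ∑ j, ((g⁻¹ : GL (Fin 2) ℂ) : Matrix (Fin 2) (Fin 2) ℂ) i j •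
      actTensor A (g : Matrix (Fin 2) (Fin 2) ℂ) j := by
  simp only [actTensor, Finset.smul_sum, smul_smul]
  rw [Finset.sum_comm]
  simp only [← Finset.sum_smul, ← Matrix.mul_apply]
  rw [← Units.val_mul, inv_mul_cancel]
  simp [Matrix.one_apply]

/-- The site tensors g_k A and the tensor A generate the same state, so they differ by gauge
matrices w_k and scalars z_k. These supply x_k and y_k, and y_k x_{k+1} is the scalar z_k⁻¹ because
neighbours share a gauge matrix. -/
theorem exists_cycle_of_symmetry {b : GL (Fin 3) ℂ} {L : ℕ}
    (hL : IsInjectivityLength (fiducial b) L) {N : ℕ} [NeZero N] (hN : 2 * L + 1 ≤ N)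
    (g : Fin N → GL (Fin 2) ℂ)
    (hg : (localOp fun k => (g k : Matrix (Fin 2) (Fin 2) ℂ)) *ᵥ mps (fiducial b) N =
      mps (fiducial b) N) :
    ∃ h : Fin N → LocalTriple, IsCycle (fiducial b) h ∧ ∀ k, (h k).g = g k := by
  obtain ⟨n, rfl⟩ : ∃ n, N = n + 1 := ⟨N - 1, by omega⟩
  set A := tensor (fiducial b) with hA
  set B : ℕ → Fin 2 → Mat3 := fun k => actTensor (fiducial b) (unroll g k : GL (Fin 2) ℂ) with hB
  have hb : A 1 = b := tensor_fiducial_one b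
  have hsepA : ∀ n ≥ L, Separates (fun _ => A) 0 n := fun n hn => hL.separates_of_le hn 0
  have hsepB : ∀ k, ∀ n ≥ L, Separates B k n := fun k n hn =>
    Separates.of_local (fun j => ⟨_, sum_smul_actTensor (fiducial b) (unroll g j)⟩)
      (hL.separates_of_le hn k)
  have hper : Function.Periodic B (n + 1) := fun k => by
    simp only [hB, unroll_add_self]
  have htr : ∀ s : List (Fin 2), s.length = n + 1 →
      (prodFrom B 0 s).trace = (prodFrom (fun _ => A) 0 s).trace := by
    intro s hs
    obtain ⟨f, rfl⟩ := exists_ofFn_eq s hs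
    have h1 := congrFun hg f
    rw [localOp_mulVec_mps, mps, tensorProd_eq_prodFrom _ f 0] at h1
    rw [← h1, ← prod_ofFn_eq_prodFrom]
    simp only [hB, zero_add, unroll_val]
  obtain ⟨φ, ψ, h, hφ⟩ := exists_transfer_maps (by omega) hper htr hsepA hsepB
  choose hu w₀ hw₀ using h.exists_gauge hb (hsepA L le_rfl)
  have hφm : ∀ k, φ (k % (n + 1)) = φ k := fun k => hφ.map_mod_nat k
  set w : ℕ → GL (Fin 3) ℂ := fun k => w₀ (k % (n + 1)) with hwdef
  have hw : ∀ k Y, φ k Y = φ k 1 * ((w k : Mat3) * Y * (((w k)⁻¹ : GL (Fin 3) ℂ) : Mat3)) :=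
    fun k Y => by rw [← hφm]; exact hw₀ _ Y
  choose z hz hBw using fun k => h.letter_eq hb (hu k) (hu (k + 1)) (hw k) (hw (k + 1))
  -- `letter_eq` describes site k + L through the gauges at k and k + 1; the shift d makes k + d + L
  -- equal to k modulo the number of sites.
  set d := n + 1 - L with hd
  have hBg : ∀ k : Fin (n + 1), B (k + d + L) = actTensor (fiducial b) (g k : GL (Fin 2) ℂ) := by
    intro k
    rw [show (k : ℕ) + d + L = k + (n + 1) by omega, hper]
    simp only [hB, unroll_val]
  refine ⟨fun k => ⟨g k, (w (k + d))⁻¹, Units.mk0 _ (inv_ne_zero (hz (k + d))) • w (k + d + 1)⟩,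
    ⟨fun k => mem_symmetrySet.2 fun i => ?_, fun k => ⟨_, inv_ne_zero (hz (k + d)), ?_⟩⟩,
    fun k => rfl⟩
  · have h1 := hBw (k + d) i
    rw [hBg] at h1
    simp only [actTensor] at h1
    dsimp only
    rw [h1, Units.val_smul, Units.smul_mk0, mul_smul_comm, mul_smul_comm, smul_mul_assoc, smul_smul,
      inv_mul_cancel₀ (hz _), one_smul]
    simp only [← mul_assoc, GL_inv_mul, one_mul]
    rw [mul_assoc, GL_inv_mul, mul_one]
  · have h1 : w (((k + 1 : Fin (n + 1)) : ℕ) + d) = w (k + d + 1) := by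
      have h2 : ((k + 1 : Fin (n + 1)) : ℕ) = (k + 1) % (n + 1) := by simp [Fin.val_add]
      simp only [hwdef]
      rw [h2, Nat.mod_add_mod, add_right_comm]
    dsimp only
    rw [h1, Units.val_smul, Units.smul_mk0, smul_mul_assoc, GL_mul_inv]

/-! ### Cycles are symmetries of matrix product states -/

lemma prodFrom_gauge {A : Fin 2 → Mat3} {B : ℕ → Fin 2 → Mat3} {z : ℕ → ℂ}
    {x : ℕ → GL (Fin 3) ℂ} (h : ∀ k i, B k i =
      z k • ((((x k)⁻¹ : GL (Fin 3) ℂ) : Mat3) * A i * (x (k + 1) : Mat3))) (s : List (Fin 2)) :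
    ∀ k, prodFrom B k s = (∏ j ∈ Finset.range s.length, z (k + j)) •
      ((((x k)⁻¹ : GL (Fin 3) ℂ) : Mat3) * prodFrom (fun _ => A) 0 s *
        (x (k + s.length) : Mat3)) := by
  induction s with
  | nil => intro k; simp [prodFrom]
  | cons i s ih =>
    intro k
    rw [prodFrom, ih, h, List.length_cons, Finset.prod_range_succ', prodFrom, prodFrom_const A s 1,
      smul_mul_smul_comm, mul_comm (z k), add_zero]
    congr 1
    · simp only [add_assoc, add_comm 1]
    · rw [show k + 1 + s.length = k + (s.length + 1) by ring]
      simp only [mul_assoc]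
      rw [← mul_assoc (x (k + 1) : Mat3), GL_mul_inv, one_mul]

/-- The site tensors become multiples of x_k⁻¹ A x_{k+1}, so the product telescopes and the trace
removes the last conjugation. -/
lemma IsCycle.localOp_mulVec {A : TriState} {N : ℕ} [NeZero N] {h : Fin N → LocalTriple}
    (hh : IsCycle A h) : ∃ z : ℂ, z ≠ 0 ∧
      (localOp fun k => ((h k).g : Matrix (Fin 2) (Fin 2) ℂ)) *ᵥ mps A N = z • mps A N := by
  choose c hc hcat using hh.2
  have hy : ∀ k, (((h k).y⁻¹ : GL (Fin 3) ℂ) : Mat3) = (c k)⁻¹ • ((h (k + 1)).x : Mat3) := by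
    intro k
    have h1 := congrArg (fun M => (((h k).y⁻¹ : GL (Fin 3) ℂ) : Mat3) * M) (hcat k)
    simp only [← mul_assoc, GL_inv_mul, one_mul] at h1
    rw [h1, mul_smul_comm, mul_one, smul_smul, inv_mul_cancel₀ (hc k), one_smul]
  have hact : ∀ k i, actTensor A ((h k).g : Matrix (Fin 2) (Fin 2) ℂ) i =
      (c k)⁻¹ • ((((h k).x⁻¹ : GL (Fin 3) ℂ) : Mat3) * tensor A i * ((h (k + 1)).x : Mat3)) := by
    intro k i
    have h1 := mem_symmetrySet.1 (hh.1 k) i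
    rw [← h1, ← mul_smul_comm, ← hy, actTensor]
    simp only [← mul_assoc, GL_inv_mul, one_mul]
    rw [mul_assoc, GL_mul_inv, mul_one]
  set x : ℕ → GL (Fin 3) ℂ := unroll fun k => (h k).x with hx
  refine ⟨∏ j ∈ Finset.range N, unroll (fun k => (c k)⁻¹) (0 + j),
    Finset.prod_ne_zero_iff.2 fun j _ => inv_ne_zero (hc _), funext fun s => ?_⟩
  have h2 := prodFrom_gauge (A := tensor A) (z := unroll fun k => (c k)⁻¹) (x := x)
    (B := fun k => actTensor A ((unroll (fun k => (h k).g) k : GL (Fin 2) ℂ)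
      : Matrix (Fin 2) (Fin 2) ℂ)) (fun k i => by
        rw [hx, unroll_succ]
        exact hact _ i) (List.ofFn s) 0
  rw [← prod_ofFn_eq_prodFrom, List.length_ofFn] at h2
  simp only [zero_add, unroll_val] at h2
  have h3 : x N = x 0 := by simpa using unroll_add_self (fun k => (h k).x) 0
  rw [localOp_mulVec_mps, h2, Matrix.trace_smul, h3, Matrix.trace_mul_comm, ← mul_assoc, GL_mul_inv,
    one_mul, Pi.smul_apply, mps, tensorProd_eq_prodFrom A s 0]
  simp only [zero_add]

end PencilMPS

namespace PencilMPS

/-! ### Local operators -/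

section localOp

variable {N : ℕ}

lemma localOp_mul (g h : Fin N → Matrix (Fin 2) (Fin 2) ℂ) :
    localOp g * localOp h = localOp fun k => g k * h k := by
  ext s t
  simp only [localOp, Matrix.mul_apply, Matrix.of_apply, ← Finset.prod_mul_distrib]
  exact (Fintype.prod_sum fun k j => g k (s k) j * h k j (t k)).symm

lemma localOp_one : localOp (fun _ : Fin N => (1 : Matrix (Fin 2) (Fin 2) ℂ)) = 1 := by
  ext s t
  simp only [localOp, Matrix.of_apply, Matrix.one_apply, Finset.prod_ite_zero, Finset.prod_const_one,
    funext_iff, Finset.mem_univ, forall_const]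

lemma star_localOp (g : Fin N → Matrix (Fin 2) (Fin 2) ℂ) :
    star (localOp g) = localOp fun k => star (g k) := by
  ext s t
  simp [localOp, Matrix.star_apply]

lemma localOp_smul (z : Fin N → ℂ) (g : Fin N → Matrix (Fin 2) (Fin 2) ℂ) :
    localOp (fun k => z k • g k) = (∏ k, z k) • localOp g := by
  ext s t
  simp [localOp, Finset.prod_mul_distrib]

lemma star_qubitOp_mul (σ : S3) : star (qubitOp σ) * qubitOp σ = 1 := by
  have h0 : star ω = ω ^ 2 := star_omega
  have h1 := omega_pow_three
  rw [Complex.star_def] at h0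
  rcases S3_cases σ with rfl | rfl | rfl | rfl | rfl | rfl <;>
    simp only [qubitOp_one, qubitOp_S, qubitOp_S2, qubitOp_τ, qubitOp_ε, qubitOp_κ] <;>
    ext i j <;> fin_cases i <;> fin_cases j <;>
    simp [Matrix.mul_apply, Matrix.star_apply, h0] <;> grind

lemma star_localOp_qubitOp_mul (σ : Fin N → S3) :
    star (localOp fun k => qubitOp (σ k)) * (localOp fun k => qubitOp (σ k)) = 1 := by
  rw [star_localOp, localOp_mul]
  simp only [star_qubitOp_mul, localOp_one]

/-- A multiple of a unitary that fixes a nonzero vector is unitary. -/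
lemma mem_unitaryGroup_of_mulVec {n : Type*} [Fintype n] [DecidableEq n] {U : Matrix n n ℂ}
    (hU : star U * U = 1) {z : ℂ} {v : n → ℂ} (hv : v ≠ 0) (h : (z • U) *ᵥ v = v) :
    z • U ∈ Matrix.unitaryGroup n ℂ := by
  rw [Matrix.mem_unitaryGroup_iff']
  have h1 : star (z • U) * (z • U) = (star z * z) • 1 := by
    rw [star_smul, smul_mul_smul_comm, hU]
  rw [h1]
  have h2 : star v ⬝ᵥ v = (star z * z) * (star v ⬝ᵥ v) := by
    calc star v ⬝ᵥ v = star ((z • U) *ᵥ v) ⬝ᵥ ((z • U) *ᵥ v) := by rw [h]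
      _ = star v ⬝ᵥ ((star (z • U) * (z • U)) *ᵥ v) := by
        rw [Matrix.star_mulVec, ← Matrix.dotProduct_mulVec, Matrix.mulVec_mulVec,
          Matrix.star_eq_conjTranspose]
      _ = _ := by rw [h1, Matrix.smul_mulVec, Matrix.one_mulVec, dotProduct_smul, smul_eq_mul]
  have h3 : star v ⬝ᵥ v ≠ 0 := by
    open scoped ComplexOrder in
    exact fun h => hv (dotProduct_star_self_eq_zero.1 h)
  have h4 : star z * z = 1 := mul_right_cancel₀ h3 (by rw [one_mul, ← h2])
  rw [h4, one_smul]

lemma smul_eq_of_mulVec {n : Type*} [Fintype n] {U : Matrix n n ℂ} {z z' : ℂ} {v : n → ℂ}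
    (hv : v ≠ 0) (h : (z • U) *ᵥ v = v) (h' : (z' • U) *ᵥ v = v) : z = z' := by
  rw [Matrix.smul_mulVec] at h h'
  have h0 : U *ᵥ v ≠ 0 := fun h1 => hv (by rw [← h, h1, smul_zero])
  have h1 : (z - z') • (U *ᵥ v) = 0 := by rw [sub_smul, h, h', sub_self]
  exact sub_eq_zero.1 ((smul_eq_zero.1 h1).resolve_right h0)

end localOp

/-! ### Strings of a normal tensor -/

lemma IsInjectivityLength.mps_ne_zero {b : GL (Fin 3) ℂ} {L : ℕ}
    (hL : IsInjectivityLength (fiducial b) L) {N : ℕ} (hN : L ≤ N) : mps (fiducial b) N ≠ 0 := by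
  intro h
  refine one_ne_zero (hL.separates_of_le hN 0 1 fun s hs => ?_)
  obtain ⟨f, rfl⟩ := exists_ofFn_eq s hs
  rw [one_mul, ← tensorProd_eq_prodFrom]
  exact congrFun h f

/-- For a normal tensor, a diagonal matrix that stays diagonal under repeated conjugation by the
driver is scalar. -/
lemma exists_smul_one_of_conjTo {b : GL (Fin 3) ℂ} (hb : IsNormal (fiducial b)) {E : ℕ → Mat3}
    (hE : ∀ n, IsMono (E n) 1) (h : ∀ n, ConjTo (driver b) (E n) (E (n + 1))) :
    ∃ z : ℂ, E 0 = z • 1 := by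
  obtain ⟨L, hL⟩ := hb
  choose z hz hzE using h
  have hdiag : ∀ n i, pencil i * E n = E n * pencil i := by
    intro n i
    rw [(hE n).eq_diagonal, pencil]
    split_ifs
    · rw [clock, Matrix.diagonal_mul_diagonal, Matrix.diagonal_mul_diagonal]
      simp only [mul_comm]
    · rw [one_mul, mul_one]
  -- Diagonal matrices commute with Ω, so conjugation by b⁻¹Ω is conjugation by b⁻¹ on them, and E n
  -- slides through both letters with the same scalar.
  have hbE : ∀ n i, E n * tensor (fiducial b) i = z n • (tensor (fiducial b) i * E (n + 1)) := by
    intro n i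
    have h1 : clock * E n = z n • ((b : Mat3) * E (n + 1) * ((b⁻¹ : GL (Fin 3) ℂ) : Mat3) *
        clock) := by
      have h2 := congrArg (fun M => (b : Mat3) * M) (hzE n)
      simp only [driver, mul_smul_comm, ← mul_assoc, GL_mul_inv, one_mul] at h2
      exact h2
    have h3 : E n = z n • ((b : Mat3) * E (n + 1) * ((b⁻¹ : GL (Fin 3) ℂ) : Mat3)) := by
      have h4 := hdiag n 0
      rw [pencil, if_pos rfl, h1, ← smul_mul_assoc] at h4
      exact (((Matrix.isUnit_iff_isUnit_det _).2 isMono_clock.isUnit_det).mul_right_cancel h4).symm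
    rw [tensor_fiducial, mul_assoc, hdiag, h3]
    simp only [smul_mul_assoc, mul_assoc]
    rw [← mul_assoc ((b⁻¹ : GL (Fin 3) ℂ) : Mat3), GL_inv_mul, one_mul]
  have hword : ∀ s : List (Fin 2), ∀ n, E n * prodFrom (fun _ => tensor (fiducial b)) 0 s =
      (∏ j ∈ Finset.range s.length, z (n + j)) •
        (prodFrom (fun _ => tensor (fiducial b)) 0 s * E (n + s.length)) := by
    intro s
    induction s with
    | nil => intro n; simp [prodFrom]
    | cons i s ih =>
      intro n
      rw [prodFrom, prodFrom_const, ← mul_assoc, hbE, smul_mul_assoc, mul_assoc, ih,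
        List.length_cons, Finset.prod_range_succ', mul_smul_comm, smul_smul, mul_comm (z n),
        add_zero, mul_assoc]
      simp only [add_assoc, add_comm 1]
  have hall : ∀ W : Mat3, E 0 * W = W * ((∏ j ∈ Finset.range L, z (0 + j)) • E (0 + L)) := by
    intro W
    refine congrArg (fun f : Mat3 →ₗ[ℂ] Mat3 => f W) (linearMap_ext_words (hL.separates 0)
      (f := LinearMap.mulLeft ℂ (E 0)) (g := LinearMap.mulRight ℂ _) fun s hs => ?_)
    rw [LinearMap.mulLeft_apply, LinearMap.mulRight_apply, hword, hs, mul_smul_comm]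
  -- Taking W = 1 identifies the right-hand factor with E 0, which therefore commutes with
  -- everything.
  refine exists_smul_one_of_commute fun X => ?_
  have h1 := hall 1
  rw [mul_one, one_mul] at h1
  rw [hall X, ← h1]

/-- The strings of a normal tensor are determined by their periods. -/
lemma HasString.of_repetition {b : GL (Fin 3) ℂ} (hb : IsNormal (fiducial b)) {m N : ℕ} [NeZero m]
    [NeZero N] {w : Fin m → S3} {σ : Fin N → S3} (h : HasString (driver b) σ)
    (hr : IsRepetition w σ) : HasString (driver b) w := by
  rw [isRepetition_iff] at hr
  obtain ⟨M, -, hM, hc⟩ := iff_unroll.1 h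
  simp only [hr.2] at hM
  -- Matrices m steps apart have the same pattern, so their quotients are diagonal along the whole
  -- sequence, hence scalar by normality.
  obtain ⟨z, hz⟩ := exists_smul_one_of_conjTo hb (E := fun n => M (n + m) * (M n)⁻¹)
    (fun n => by
      have h1 := (hM (n + m)).mul (hM n).inv
      rwa [unroll_add_self, inv_mul_cancel] at h1)
    fun n => by
      rw [add_right_comm]
      exact (hc (n + m)).mul ((hc n).inv (hM n).isUnit_det (hM _).isUnit_det)
  have hMm : M m = z • M 0 := by
    rw [zero_add] at hz
    rw [← Matrix.nonsing_inv_mul_cancel_right (M 0) (M m) (hM 0).isUnit_det, hz, smul_mul_assoc,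
      one_mul]
  have hz0 : z ≠ 0 := by
    rintro rfl
    have h1 := (hM m).apply_ne_zero 0
    rw [hMm] at h1
    simp at h1
  refine ⟨fun k => M k, fun k => by rw [← unroll_val w]; exact hM k, fun k => ?_⟩
  have h1 : ((k + 1 : Fin m) : ℕ) = ((k : ℕ) + 1) % m := by simp [Fin.val_add]
  have h2 := hc k
  change ConjTo _ (M k) (M ((k + 1 : Fin m) : ℕ))
  rcases (Nat.succ_le_of_lt k.2).lt_or_eq with h3 | h3
  · rwa [h1, Nat.mod_eq_of_lt h3]
  · rw [h1, show (k : ℕ) + 1 = m from h3, Nat.mod_self]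
    rw [show (k : ℕ) + 1 = m from h3, hMm] at h2
    have h4 := h2.smul_right (inv_ne_zero hz0)
    rwa [smul_smul, inv_mul_cancel₀ hz0, one_smul] at h4

/-! ### The symmetry group of a normal matrix product state -/

section symmetries

variable {b : GL (Fin 3) ℂ} {L : ℕ} {N : ℕ} [NeZero N]

lemma exists_string_of_symmetry (hL : IsInjectivityLength (fiducial b) L) (hN : 2 * L + 1 ≤ N)
    (g : Fin N → GL (Fin 2) ℂ)
    (hg : (localOp fun k => (g k : Matrix (Fin 2) (Fin 2) ℂ)) *ᵥ mps (fiducial b) N =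
      mps (fiducial b) N) :
    ∃ (σ : Fin N → S3) (z : Fin N → ℂ),
      (∀ k, z k ≠ 0 ∧ (g k : Matrix (Fin 2) (Fin 2) ℂ) = z k • qubitOp (σ k)) ∧
      HasString (driver b) σ := by
  obtain ⟨h, hh, hgh⟩ := exists_cycle_of_symmetry hL hN g hg
  obtain ⟨σ, hσ, hs⟩ := hh.exists_string
  choose z hz hσ using hσ
  exact ⟨σ, z, fun k => ⟨hz k, by rw [← hgh, hσ]⟩, hs⟩

lemma exists_eq_smul_of_mem_localSymmetries
    (hL : IsInjectivityLength (fiducial b) L) (hN : 2 * L + 1 ≤ N)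
    {O : Matrix (Fin N → Fin 2) (Fin N → Fin 2) ℂ}
    (hO : O ∈ localSymmetries (mps (fiducial b) N)) :
    ∃ (c : ℂ) (σ : Fin N → S3), O = c • localOp fun k => qubitOp (σ k) := by
  obtain ⟨⟨g, rfl⟩, hg⟩ := hO
  obtain ⟨σ, z, hz, -⟩ := exists_string_of_symmetry hL hN g hg
  refine ⟨∏ k, z k, σ, ?_⟩
  rw [← localOp_smul]
  simp only [hz]

lemma mem_unitaryGroup_of_mem_localSymmetries
    (hL : IsInjectivityLength (fiducial b) L) (hN : 2 * L + 1 ≤ N)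
    {O : Matrix (Fin N → Fin 2) (Fin N → Fin 2) ℂ}
    (hO : O ∈ localSymmetries (mps (fiducial b) N)) :
    O ∈ Matrix.unitaryGroup (Fin N → Fin 2) ℂ := by
  obtain ⟨c, σ, rfl⟩ := exists_eq_smul_of_mem_localSymmetries hL hN hO
  exact mem_unitaryGroup_of_mulVec (star_localOp_qubitOp_mul σ) (hL.mps_ne_zero (by omega)) hO.2

/-- There are finitely many σ, and fixing the nonzero state leaves at most one scalar for each. -/
lemma finite_localSymmetries (hL : IsInjectivityLength (fiducial b) L) (hN : 2 * L + 1 ≤ N) :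
    (localSymmetries (mps (fiducial b) N)).Finite := by
  have h0 := hL.mps_ne_zero (N := N) (by omega)
  refine Set.Finite.subset (s := ⋃ σ : Fin N → S3,
    {O | (∃ c : ℂ, O = c • localOp fun k => qubitOp (σ k)) ∧
      O *ᵥ mps (fiducial b) N = mps (fiducial b) N})
    (Set.finite_iUnion fun σ => Set.Subsingleton.finite ?_) fun O hO => ?_
  · rintro _ ⟨⟨c, rfl⟩, h⟩ _ ⟨⟨c', rfl⟩, h'⟩
    rw [smul_eq_of_mulVec h0 h h']
  · obtain ⟨c, σ, rfl⟩ := exists_eq_smul_of_mem_localSymmetries hL hN hO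
    exact Set.mem_iUnion.2 ⟨σ, ⟨c, rfl⟩, hO.2⟩

lemma exists_smul_mem_localSymmetries_iff
    (hL : IsInjectivityLength (fiducial b) L) (hN : 2 * L + 1 ≤ N)
    (σ : Fin N → S3) :
    (∃ c : ℂ, (c • localOp fun k => qubitOp (σ k)) ∈ localSymmetries (mps (fiducial b) N)) ↔
      HasString (driver b) σ := by
  have h0 := hL.mps_ne_zero (N := N) (by omega)
  have hGL : ∀ c : ℂ, c ≠ 0 → ∃ g : Fin N → GL (Fin 2) ℂ, (∀ k, ∃ z : ℂ, z ≠ 0 ∧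
      (g k : Matrix (Fin 2) (Fin 2) ℂ) = z • qubitOp (σ k)) ∧
      c • (localOp fun k => qubitOp (σ k)) =
        localOp fun k => (g k : Matrix (Fin 2) (Fin 2) ℂ) := by
    intro c hc
    -- The whole scalar is placed on site 0.
    refine ⟨fun k => Units.mk0 (if k = 0 then c else 1) (by split_ifs <;> simp [hc]) •
      Matrix.GeneralLinearGroup.mk'' (qubitOp (σ k)) (det_qubitOp_ne_zero _).isUnit,
      fun k => ⟨_, Units.ne_zero _, rfl⟩, ?_⟩
    refine Eq.trans ?_ (localOp_smul (fun k => if k = 0 then c else 1) _).symm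
    rw [Finset.prod_ite_eq' Finset.univ (0 : Fin N) fun _ => c, if_pos (Finset.mem_univ _)]
    rfl
  constructor
  · rintro ⟨c, hc⟩
    have hc0 : c ≠ 0 := by
      rintro rfl
      refine h0 ?_
      rw [← hc.2, zero_smul, Matrix.zero_mulVec]
    obtain ⟨g, hg, e⟩ := hGL c hc0
    obtain ⟨ρ, z, hρ, hs⟩ := exists_string_of_symmetry hL hN g (by rw [← e]; exact hc.2)
    have h1 : σ = ρ := by
      funext k
      obtain ⟨y, hy, hgy⟩ := hg k
      refine qubitOp_unique (z := y⁻¹ * z k) ?_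
      rw [mul_smul, ← (hρ k).2, hgy, smul_smul, inv_mul_cancel₀ hy, one_smul]
    rwa [h1]
  · intro hs
    obtain ⟨h, hh, hg⟩ := hs.hasCycle
    obtain ⟨z, hz, e⟩ := hh.localOp_mulVec
    simp only [hg] at e
    obtain ⟨g, -, e'⟩ := hGL z⁻¹ (inv_ne_zero hz)
    refine ⟨z⁻¹, ⟨g, e'⟩, ?_⟩
    rw [Matrix.smul_mulVec, e, smul_smul, inv_mul_cancel₀ hz, one_smul]

lemma hasString_iff_table (hL : IsInjectivityLength (fiducial b) L)
    (σ : Fin N → S3) : HasString (driver b) σ ↔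
    (σ = 1 ∨ ∃ X : CycleLabel, HasCycle (fiducial b) X.word ∧
      ∃ w ∈ generatedGroup X.word, IsRepetition w σ) := by
  constructor
  · intro hs
    refine (hs.classification (isUnit_det_driver b)).1.imp_right ?_
    rintro ⟨X, w, hr, hw⟩
    refine ⟨X, hasCycle_iff.2 ?_, w, hw ▸ mem_generatedGroup_self w, hr⟩
    refine (hs.of_repetition ⟨L, hL⟩ hr).of_mem_generatedGroup ?_
    rw [hw]
    exact mem_generatedGroup_self _
  · rintro (rfl | ⟨X, hX, w, hw, hr⟩)
    · exact HasString.one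
    · exact ((hasCycle_iff.1 hX).of_mem_generatedGroup hw).repetition hr

end symmetries

end PencilMPS

namespace PencilMPS

/-! ### Normality in terms of the driver -/

lemma Separates.conj {A B : Fin 2 → Mat3} {n : ℕ} (h : Separates (fun _ => A) 0 n)
    (x : GL (Fin 3) ℂ)
    (hB : ∀ i, B i = (((x⁻¹ : GL (Fin 3) ℂ) : Mat3) * A i * (x : Mat3))) :
    Separates (fun _ => B) 0 n := by
  intro X hX
  have h1 : (x : Mat3) * X * ((x⁻¹ : GL (Fin 3) ℂ) : Mat3) = 0 := h _ fun s hs => by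
    have h2 := hX s hs
    rw [prodFrom_gauge (A := A) (z := fun _ => 1) (x := fun _ => x) (fun _ i => by
      rw [one_smul, hB]) s 0, Finset.prod_const_one, one_smul, ← mul_assoc,
      Matrix.trace_mul_comm] at h2
    simpa only [mul_assoc] using h2
  calc X = ((x⁻¹ : GL (Fin 3) ℂ) : Mat3) * ((x : Mat3) * X * ((x⁻¹ : GL (Fin 3) ℂ) : Mat3)) *
        (x : Mat3) := by
        simp only [mul_assoc, GL_inv_mul, mul_one]
        rw [← mul_assoc, GL_inv_mul, one_mul]
    _ = 0 := by rw [h1, mul_zero, zero_mul]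

/-- The words in `c⁻¹ Ω²` and `c⁻¹ Ω` of some length are spanning. -/
def IsGenerating (c : Mat3) : Prop :=
  ∃ n, Separates (fun _ i => c⁻¹ * clock ^ (2 - (i : ℕ))) 0 n

/-- Take b = Ωc⁻¹. Conjugating its tensors Ωc⁻¹Ω and Ωc⁻¹ by Ω gives c⁻¹Ω² and c⁻¹Ω. -/
lemma IsGenerating.exists_isNormal {c : Mat3} (hc : IsUnit c.det) (h : IsGenerating c) :
    ∃ b : GL (Fin 3) ℂ, driver b = c ∧ IsNormal (fiducial b) := by
  obtain ⟨u, hu⟩ : ∃ u : GL (Fin 3) ℂ, (u : Mat3) = c :=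
    ⟨Matrix.GeneralLinearGroup.mk'' _ hc, rfl⟩
  obtain ⟨t, ht⟩ : ∃ t : GL (Fin 3) ℂ, (t : Mat3) = clock :=
    ⟨Matrix.GeneralLinearGroup.mk'' _ isMono_clock.isUnit_det, rfl⟩
  refine ⟨t * u⁻¹, ?_, ?_⟩
  · rw [driver, mul_inv_rev, inv_inv, Units.val_mul, hu, mul_assoc, ← ht, GL_inv_mul, mul_one]
  · obtain ⟨n, hn⟩ := h
    have h1 : Separates (fun _ => tensor (fiducial (t * u⁻¹))) 0 n := by
      refine hn.conj t⁻¹ fun i => ?_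
      have h3 : clock ^ (2 - (i : ℕ)) = pencil i * clock := by
        fin_cases i
        · simp [pencil, pow_two]
        · simp [pencil]
      rw [inv_inv, h3, tensor_fiducial, Units.val_mul, ← hu, ← Matrix.coe_units_inv, ht]
      simp only [mul_assoc]
      rw [← ht, GL_mul_inv, mul_one]
    refine ⟨n, fun X Y hXY => ?_⟩
    rw [← sub_eq_zero]
    refine h1 _ fun s hs => ?_
    obtain ⟨f, rfl⟩ := exists_ofFn_eq s hs
    have h2 := congrFun hXY f
    simp only at h2
    rw [← tensorProd_eq_prodFrom, sub_mul, Matrix.trace_sub, h2, sub_self]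

/-! ### The Heisenberg group -/

/-- The third roots of unity, as a character of `ℤ/3`. -/
noncomputable def ζ (a : ZMod 3) : ℂ := ω ^ a.val

lemma ζ_add (a b : ZMod 3) : ζ (a + b) = ζ a * ζ b := by
  rw [ζ, ζ, ζ, ← pow_add, ZMod.val_add]
  conv_rhs => rw [← Nat.div_add_mod (a.val + b.val) 3, pow_add, pow_mul, omega_pow_three, one_pow,
    one_mul]

lemma ζ_ne_zero (a : ZMod 3) : ζ a ≠ 0 := pow_ne_zero _ omega_ne_zero

/-- The element of `ℤ/3` that a basis vector is labelled with. -/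
def residue (i : Fin 3) : ZMod 3 := (i : ℕ)

lemma residue_rot (b : ZMod 3) (i : Fin 3) : residue (rot b i) = residue i + b := by
  revert b i; decide

/-- The Heisenberg matrices, products of powers of clock and shift matrices. -/
noncomputable def heis (v : ZMod 3 × ZMod 3) : Mat3 :=
  Matrix.of fun i j => if rot v.2 i = j then ζ (v.1 * residue i) else 0

lemma isMono_heis (v : ZMod 3 × ZMod 3) : IsMono (heis v) (rot v.2) := by
  intro i j
  simp [heis, ζ_ne_zero]

lemma heis_mul (u v : ZMod 3 × ZMod 3) : heis u * heis v = ζ (v.1 * u.2) • heis (u + v) := by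
  ext i j
  rw [(isMono_heis u).mul_apply_left]
  simp only [heis, Matrix.of_apply, if_true, Matrix.smul_apply, residue_rot, Prod.fst_add,
    Prod.snd_add, add_comm u.2, rot_add, Equiv.Perm.mul_apply, smul_eq_mul, mul_ite, mul_zero,
    ← ζ_add]
  congr 2
  ring

lemma heis_zero : heis 0 = 1 := by
  ext i j
  simp [heis, rot_zero, Matrix.one_apply, ζ]

lemma heis_clock : heis (1, 0) = clock := by
  ext i j
  rw [clock_apply]
  fin_cases i <;> simp [heis, rot_zero, ζ, residue]

lemma ConjTo.heis_add {c : Mat3} {u v u' v' : ZMod 3 × ZMod 3} (h : ConjTo c (heis u) (heis u'))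
    (h' : ConjTo c (heis v) (heis v')) : ConjTo c (heis (u + v)) (heis (u' + v')) := by
  have h1 := h.mul h'
  rw [heis_mul, heis_mul] at h1
  have h2 := (h1.smul_left (inv_ne_zero (ζ_ne_zero (v.1 * u.2)))).smul_right
    (inv_ne_zero (ζ_ne_zero (v'.1 * u'.2)))
  rwa [smul_smul, smul_smul, inv_mul_cancel₀ (ζ_ne_zero _), inv_mul_cancel₀ (ζ_ne_zero _),
    one_smul, one_smul] at h2

/-- The endomorphism of `(ℤ/3)²` with given values at the standard basis. -/
def linMap (p : (ZMod 3 × ZMod 3) × (ZMod 3 × ZMod 3)) (v : ZMod 3 × ZMod 3) : ZMod 3 × ZMod 3 :=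
  (v.1 * p.1.1 + v.2 * p.2.1, v.1 * p.1.2 + v.2 * p.2.2)

/-- Conjugation by `c` acts on the Heisenberg matrices by the endomorphism given by `p`. -/
def IsClifford (c : Mat3) (p : (ZMod 3 × ZMod 3) × (ZMod 3 × ZMod 3)) : Prop :=
  ∀ v, ConjTo c (heis v) (heis (linMap p v))

/-- The matrices `heis` multiply like (ℤ/3)² up to scalars, so two generators suffice. -/
lemma isClifford_of_generators {c : Mat3} {p : (ZMod 3 × ZMod 3) × (ZMod 3 × ZMod 3)}
    (h1 : ConjTo c (heis (1, 0)) (heis p.1)) (h2 : ConjTo c (heis (0, 1)) (heis p.2)) :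
    IsClifford c p := by
  have key : ∀ {u u'} (n : ℕ), ConjTo c (heis u) (heis u') →
      ConjTo c (heis (n • u)) (heis (n • u')) := by
    intro u u' n h
    induction n with
    | zero => rw [zero_smul, zero_smul, heis_zero]; exact ConjTo.one c
    | succ n ih => rw [succ_nsmul, succ_nsmul]; exact ih.heis_add h
  intro v
  convert (key v.1.val h1).heis_add (key v.2.val h2) using 2
  · ext <;> simp
  · ext <;> simp [linMap]

lemma eq_zero_of_fourier {x y z : ℂ} (h0 : x + y + z = 0) (h1 : x + ω * y + ω ^ 2 * z = 0)
    (h2 : x + ω ^ 2 * y + ω * z = 0) : x = 0 ∧ y = 0 ∧ z = 0 := by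
  have h := omega_sq
  have h3 : (3 : ℂ) ≠ 0 := by norm_num
  refine ⟨mul_left_cancel₀ h3 ?_, mul_left_cancel₀ h3 ?_, mul_left_cancel₀ h3 ?_⟩ <;> grind

/-- For fixed b, the traces against `heis (a, b)` form the discrete Fourier transform of one cyclic
diagonal of Y. -/
lemma eq_zero_of_trace_heis {Y : Mat3} (h : ∀ v, (Y * heis v).trace = 0) : Y = 0 := by
  have key : ∀ a b : ZMod 3, ∑ i, Y (rot b i) i * ζ (a * residue i) = 0 := by
    intro a b
    rw [← h (a, b), Matrix.trace_mul_comm]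
    refine Finset.sum_congr rfl fun i _ => ?_
    rw [Matrix.diag_apply, (isMono_heis (a, b)).mul_apply_left, mul_comm]
    simp [heis]
  have h1 : ∀ (b : ZMod 3) (i : Fin 3), Y (rot b i) i = 0 := by
    intro b
    have h0 := key 0 b
    have h1 := key 1 b
    have h2 := key 2 b
    have e : (4 : ZMod 3).val = 1 := by decide
    have e' : (2 : ZMod 3).val = 2 := by decide
    have e'' : (1 : ZMod 3).val = 1 := by decide
    simp only [Fin.sum_univ_three, residue, ζ] at h0 h1 h2
    norm_num [e, e', e''] at h0 h1 h2
    obtain ⟨h3, h4, h5⟩ := eq_zero_of_fourier h0 (by linear_combination h1)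
      (by linear_combination h2)
    intro i
    fin_cases i <;> assumption
  ext i j
  obtain ⟨b, rfl⟩ : ∃ b, rot b j = i := by revert i j; decide
  exact h1 b j

/-- Moving every c⁻¹ to the right turns a word of length n into a multiple of `heis (vec s) * c⁻¹ ^
n`. If all nine vectors are reached, the words span. -/
lemma IsClifford.isGenerating {c : Mat3} {p q : (ZMod 3 × ZMod 3) × (ZMod 3 × ZMod 3)}
    (h : IsClifford c p) (hc : IsUnit c.det) (hpq : ∀ v, linMap p (linMap q v) = v)
    {vec : List (Fin 2) → ZMod 3 × ZMod 3} (hnil : vec [] = 0)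
    (hcons : ∀ i s, vec (i :: s) = linMap q ((2 - ((i : ℕ) : ZMod 3), 0) + vec s)) {n : ℕ}
    (hn : ∀ v, ∃ s : Fin n → Fin 2, vec (List.ofFn s) = v) : IsGenerating c := by
  have hclock : ∀ i : Fin 2, clock ^ (2 - (i : ℕ)) = heis (2 - ((i : ℕ) : ZMod 3), 0) := by
    intro i
    fin_cases i
    · simp only [Nat.cast_zero, sub_zero]
      rw [pow_two, ← heis_clock, heis_mul]
      simp [ζ, show (1 : ZMod 3) + 1 = 2 from rfl]
    · rw [← heis_clock]
      simp [show (2 : ZMod 3) - 1 = 1 from rfl]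
  have hinv : ∀ v, ∃ z : ℂ, z ≠ 0 ∧ c⁻¹ * heis v = z • (heis (linMap q v) * c⁻¹) := by
    intro v
    obtain ⟨z, hz, e⟩ := h (linMap q v)
    rw [hpq] at e
    refine ⟨z⁻¹, inv_ne_zero hz, ?_⟩
    have h1 : c⁻¹ * (c * heis (linMap q v)) * c⁻¹ = c⁻¹ * (z • (heis v * c)) * c⁻¹ := by rw [e]
    rw [Matrix.nonsing_inv_mul_cancel_left _ _ hc, mul_smul_comm, smul_mul_assoc, ← mul_assoc,
      Matrix.mul_nonsing_inv_cancel_right _ _ hc] at h1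
    rw [h1, smul_smul, inv_mul_cancel₀ hz, one_smul]
  have hword : ∀ s : List (Fin 2), ∃ z : ℂ, z ≠ 0 ∧
      prodFrom (fun _ i => c⁻¹ * clock ^ (2 - (i : ℕ))) 0 s =
        z • (heis (vec s) * c⁻¹ ^ s.length) := by
    intro s
    induction s with
    | nil => exact ⟨1, one_ne_zero, by simp [prodFrom, hnil, heis_zero]⟩
    | cons i s ih =>
      obtain ⟨z, hz, e⟩ := ih
      obtain ⟨y, hy, e'⟩ := hinv ((2 - ((i : ℕ) : ZMod 3), 0) + vec s)
      refine ⟨z * (ζ ((vec s).1 * 0) * y),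
        mul_ne_zero hz (mul_ne_zero (ζ_ne_zero _) hy), ?_⟩
      rw [prodFrom, prodFrom_const (fun i : Fin 2 => c⁻¹ * clock ^ (2 - (i : ℕ))) s 1, e, hcons,
        hclock, mul_smul_comm, ← mul_assoc, mul_assoc c⁻¹, heis_mul, mul_smul_comm, e',
        smul_smul, smul_mul_assoc, smul_smul, List.length_cons, pow_succ', mul_assoc]
  refine ⟨n, fun X hX => ?_⟩
  have hu : IsUnit (c⁻¹ ^ n).det := by
    rw [Matrix.det_pow]
    exact ((Matrix.isUnit_nonsing_inv_det_iff).2 hc).pow n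
  have h0 : c⁻¹ ^ n * X = 0 := eq_zero_of_trace_heis fun v => by
    obtain ⟨s, rfl⟩ := hn v
    obtain ⟨z, hz, e⟩ := hword (List.ofFn s)
    have h1 := hX (List.ofFn s) List.length_ofFn
    rw [e, mul_smul_comm, Matrix.trace_smul, List.length_ofFn, ← mul_assoc,
      Matrix.trace_mul_comm, ← mul_assoc, smul_eq_zero] at h1
    exact h1.resolve_left hz
  rw [← Matrix.nonsing_inv_mul_cancel_left _ X hu, h0, mul_zero]

/-! ### Clifford matrices -/

/-- The permutation matrix of the parity `i ↦ -i`. -/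
noncomputable def parity : Mat3 := Matrix.of fun i j => if τ i = j then 1 else 0

lemma isMono_parity : IsMono parity τ := by
  intro i j
  simp [parity]

/-- The matrix of the Fourier transform. -/
noncomputable def fourier : Mat3 := Matrix.of fun i j => ζ (residue i * residue j)

/-- The circulant matrix with entries `1, ω, ω`. -/
noncomputable def chirp : Mat3 := Matrix.of fun i j => ζ ((residue i - residue j) ^ 2)

lemma conjTo_of_apply {c M M' : Mat3} {σ ρ : S3} (hM : IsMono M σ) (hM' : IsMono M' ρ) {z : ℂ}
    (hz : z ≠ 0)
    (h : ∀ i j, c i j * M j (σ j) = z * (M' i (ρ i) * c (ρ i) (σ j))) : ConjTo c M M' := by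
  refine ⟨z, hz, ?_⟩
  ext i j
  obtain ⟨j, rfl⟩ := σ.surjective j
  rw [hM.mul_apply_right, Matrix.smul_apply, hM'.mul_apply_left, h, smul_eq_mul]

lemma residue_τ (i : Fin 3) : residue (τ i) = -residue i := by revert i; decide

lemma conjTo_parity (v : ZMod 3 × ZMod 3) : ConjTo parity (heis v) (heis (-v)) := by
  refine conjTo_of_apply (isMono_heis _) (isMono_heis _) one_ne_zero fun i j => ?_
  have h1 : ∀ (b : ZMod 3) (i j : Fin 3), τ (rot (-b) i) = rot b j ↔ τ i = j := by decide
  simp only [parity, heis, Matrix.of_apply, if_true, one_mul, Prod.fst_neg, Prod.snd_neg, h1]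
  split_ifs with h
  · rw [← h, residue_τ, one_mul, mul_one, mul_neg, neg_mul]
  · rw [zero_mul, mul_zero]

lemma fourier_isClifford : IsClifford fourier ((0, 1), (2, 0)) := by
  refine isClifford_of_generators (conjTo_of_apply (isMono_heis _) (isMono_heis _) one_ne_zero ?_)
    (conjTo_of_apply (isMono_heis _) (isMono_heis _) one_ne_zero ?_) <;>
  · intro i j
    simp only [fourier, heis, Matrix.of_apply, if_true, one_mul, ← ζ_add, residue_rot]
    congr 1
    revert i j
    decide

lemma chirp_isClifford : IsClifford chirp ((1, 1), (0, 1)) := by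
  refine isClifford_of_generators
    (conjTo_of_apply (isMono_heis _) (isMono_heis _) (ζ_ne_zero 2) ?_)
    (conjTo_of_apply (isMono_heis _) (isMono_heis _) (ζ_ne_zero 0) ?_) <;>
  · intro i j
    simp only [chirp, heis, Matrix.of_apply, if_true, ← ζ_add, residue_rot]
    congr 1
    revert i j
    decide

lemma fourier_conjTo_parity : ConjTo fourier parity parity := by
  refine conjTo_of_apply isMono_parity isMono_parity one_ne_zero fun i j => ?_
  simp only [fourier, parity, Matrix.of_apply, if_true, one_mul, mul_one, residue_τ]
  congr 1
  ring

lemma chirp_conjTo_parity : ConjTo chirp parity parity := by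
  refine conjTo_of_apply isMono_parity isMono_parity one_ne_zero fun i j => ?_
  simp only [chirp, parity, Matrix.of_apply, if_true, one_mul, mul_one, residue_τ]
  congr 1
  ring

end PencilMPS

namespace PencilMPS

/-! ### Realization of table entries by Clifford matrices -/

lemma det_fourier : fourier.det ≠ 0 := by
  have h := omega_sq
  have h0 : fourier = !![1, 1, 1; 1, ω, ω ^ 2; 1, ω ^ 2, ω] := by
    ext i j
    fin_cases i <;> fin_cases j <;>
      simp [fourier, residue, ζ, show ((2 : ZMod 3) * 2).val = 1 from rfl,
        show (1 : ZMod 3).val = 1 from rfl, show (2 : ZMod 3).val = 2 from rfl]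
  rw [h0, Matrix.det_fin_three]
  intro h1
  simp at h1
  grind

lemma det_chirp : chirp.det ≠ 0 := by
  have h := omega_sq
  have h0 : chirp = !![1, ω, ω; ω, 1, ω; ω, ω, 1] := by
    ext i j
    fin_cases i <;> fin_cases j <;> simp [chirp, residue, ζ] <;>
      exact pow_one ω
  rw [h0, Matrix.det_fin_three]
  intro h1
  simp at h1
  grind

/-- The label `X` occurs for a normal tensor. -/
def CycleLabel.Occurs (X : CycleLabel) : Prop :=
  ∃ b : GL (Fin 3) ℂ, IsNormal (fiducial b) ∧ HasString (driver b) X.word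

lemma IsGenerating.occurs {c : Mat3} (h : IsGenerating c) (hc : IsUnit c.det) {X : CycleLabel}
    (hX : HasString c X.word) : X.Occurs := by
  obtain ⟨b, rfl, hb⟩ := h.exists_isNormal hc
  exact ⟨b, hb, hX⟩

lemma conjTo_heis (u w : ZMod 3 × ZMod 3) : ConjTo (heis u) (heis w) (heis w) := by
  refine ⟨ζ (w.1 * u.2 - u.1 * w.2), ζ_ne_zero _, ?_⟩
  rw [heis_mul, heis_mul, smul_smul, ← ζ_add, sub_add_cancel, add_comm]

lemma conjTo_heis_parity (u : ZMod 3 × ZMod 3) :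
    ConjTo (heis u) parity (heis (u + u) * parity) := by
  obtain ⟨z, hz, e⟩ := conjTo_parity u
  refine ⟨(z * ζ ((-u).1 * (u + u).2))⁻¹, inv_ne_zero (mul_ne_zero hz (ζ_ne_zero _)), ?_⟩
  rw [mul_assoc, e, mul_smul_comm, ← mul_assoc, heis_mul, smul_mul_assoc, smul_smul, smul_smul,
    mul_assoc _ z, inv_mul_cancel₀ (mul_ne_zero hz (ζ_ne_zero _)), one_smul,
    add_neg_cancel_right]

lemma IsClifford.heis_mul {c : Mat3} {p : (ZMod 3 × ZMod 3) × (ZMod 3 × ZMod 3)}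
    (h : IsClifford c p) (u : ZMod 3 × ZMod 3) : IsClifford (heis u * c) p :=
  fun v => (h v).comp (conjTo_heis u _)

/-- The vectors of the words in `c⁻¹ Ω²` and `c⁻¹ Ω`. -/
def wordVec (q : (ZMod 3 × ZMod 3) × (ZMod 3 × ZMod 3)) : List (Fin 2) → ZMod 3 × ZMod 3
  | [] => 0
  | i :: s => linMap q ((2 - ((i : ℕ) : ZMod 3), 0) + wordVec q s)

/-- The vectors of a string of reflections. -/
def reflectionVec (p : (ZMod 3 × ZMod 3) × (ZMod 3 × ZMod 3)) (u v : ZMod 3 × ZMod 3) :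
    ℕ → ZMod 3 × ZMod 3
  | 0 => v
  | n + 1 => linMap p (reflectionVec p u v n) + (u + u)

/-- Conjugation by `heis u * c` sends `heis v * parity` to a multiple of `heis (linMap p v + 2u) *
parity`, whose pattern is a reflection read off from the second coordinate. The second condition in
hX says that the orbit closes up. -/
lemma IsClifford.occurs {c : Mat3} {p q : (ZMod 3 × ZMod 3) × (ZMod 3 × ZMod 3)}
    (h : IsClifford c p) (hc : c.det ≠ 0) (hpar : ConjTo c parity parity)
    (hpq : ∀ v, linMap p (linMap q v) = v)
    (hn : ∀ v, ∃ s : Fin 4 → Fin 2, wordVec q (List.ofFn s) = v)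
    (u v : ZMod 3 × ZMod 3) {X : CycleLabel}
    (hX : ∀ k : Fin X.length, X.word k = τ * rot (reflectionVec p u v k).2 ∧
      reflectionVec p u v (k + 1 : Fin X.length) = reflectionVec p u v ((k : ℕ) + 1)) :
    X.Occurs := by
  have hu : IsUnit (heis u * c).det := by
    rw [Matrix.det_mul]
    exact (isMono_heis u).isUnit_det.mul hc.isUnit
  refine ((h.heis_mul u).isGenerating hu hpq rfl (fun _ _ => rfl) hn).occurs hu
    ⟨fun k => heis (reflectionVec p u v k) * parity, fun k => ?_, fun k => ?_⟩
  · rw [(hX k).1]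
    exact (isMono_heis _).mul isMono_parity
  · have h1 := ((h (reflectionVec p u v k)).mul hpar).comp
      ((conjTo_heis u _).mul (conjTo_heis_parity u))
    dsimp only
    rw [(hX k).2, reflectionVec]
    rw [← mul_assoc, PencilMPS.heis_mul, smul_mul_assoc] at h1
    have h2 := h1.smul_right (inv_ne_zero
      (ζ_ne_zero ((u + u).1 * (linMap p (reflectionVec p u v k)).2)))
    rwa [smul_smul, inv_mul_cancel₀ (ζ_ne_zero _), one_smul] at h2

/-- The linear maps of `fourier`, `chirp` and `chirp * parity` have orders 4, 3 and 6, matching the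
lengths of T6, of T4 and T5, and of T7. Here q inverts p, and words of length four reach all nine
vectors. -/
lemma occurs_of_fourier (u v : ZMod 3 × ZMod 3) {X : CycleLabel}
    (hX : ∀ k : Fin X.length,
      X.word k = τ * rot (reflectionVec ((0, 1), (2, 0)) u v k).2 ∧
      reflectionVec ((0, 1), (2, 0)) u v (k + 1 : Fin X.length) =
        reflectionVec ((0, 1), (2, 0)) u v ((k : ℕ) + 1)) : X.Occurs :=
  fourier_isClifford.occurs (q := ((0, 2), (1, 0))) det_fourier fourier_conjTo_parity (by decide)
    (by decide +kernel) u v hX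

lemma occurs_of_chirp (u v : ZMod 3 × ZMod 3) {X : CycleLabel}
    (hX : ∀ k : Fin X.length,
      X.word k = τ * rot (reflectionVec ((1, 1), (0, 1)) u v k).2 ∧
      reflectionVec ((1, 1), (0, 1)) u v (k + 1 : Fin X.length) =
        reflectionVec ((1, 1), (0, 1)) u v ((k : ℕ) + 1)) : X.Occurs :=
  chirp_isClifford.occurs (q := ((1, 2), (0, 1))) det_chirp chirp_conjTo_parity (by decide)
    (by decide +kernel) u v hX

lemma occurs_of_chirp_parity (u v : ZMod 3 × ZMod 3) {X : CycleLabel}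
    (hX : ∀ k : Fin X.length,
      X.word k = τ * rot (reflectionVec ((2, 2), (0, 2)) u v k).2 ∧
      reflectionVec ((2, 2), (0, 2)) u v (k + 1 : Fin X.length) =
        reflectionVec ((2, 2), (0, 2)) u v ((k : ℕ) + 1)) : X.Occurs := by
  have h : IsClifford (chirp * parity) ((2, 2), (0, 2)) := fun v => by
    convert (conjTo_parity v).comp (chirp_isClifford (-v)) using 2
    revert v
    decide
  refine h.occurs (q := ((2, 1), (0, 2))) ?_ ?_ (by decide) (by decide +kernel) u v hX
  · rw [Matrix.det_mul]
    exact mul_ne_zero det_chirp isMono_parity.isUnit_det.ne_zero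
  · exact ConjTo.comp ⟨1, one_ne_zero, by rw [one_smul]⟩ chirp_conjTo_parity

lemma occurs_T4ccw : CycleLabel.T4ccw.Occurs :=
  occurs_of_chirp (0, 0) (1, 0) (by decide +kernel)

lemma occurs_T4cw : CycleLabel.T4cw.Occurs :=
  occurs_of_chirp (0, 0) (2, 0) (by decide +kernel)

lemma occurs_T5ccw : CycleLabel.T5ccw.Occurs :=
  occurs_of_chirp (2, 0) (0, 0) (by decide +kernel)

lemma occurs_T5cw : CycleLabel.T5cw.Occurs :=
  occurs_of_chirp (1, 0) (0, 0) (by decide +kernel)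

lemma occurs_T6τ : CycleLabel.T6τ.Occurs :=
  occurs_of_fourier (0, 0) (0, 1) (by decide +kernel)

lemma occurs_T6ε : CycleLabel.T6ε.Occurs :=
  occurs_of_fourier (0, 2) (1, 0) (by decide +kernel)

lemma occurs_T6κ : CycleLabel.T6κ.Occurs :=
  occurs_of_fourier (0, 1) (2, 2) (by decide +kernel)

lemma occurs_T7τ : CycleLabel.T7τ.Occurs :=
  occurs_of_chirp_parity (0, 0) (2, 1) (by decide +kernel)

lemma occurs_T7ε : CycleLabel.T7ε.Occurs :=
  occurs_of_chirp_parity (0, 2) (2, 0) (by decide +kernel)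

lemma occurs_T7κ : CycleLabel.T7κ.Occurs :=
  occurs_of_chirp_parity (0, 1) (2, 2) (by decide +kernel)

/-- A label of which the repetition lies in the group of another one. -/
lemma CycleLabel.Occurs.of_inGen {X Y : CycleLabel} (h : X.Occurs) (u : List (Fin 6))
    (hu : inGen X.length u X.codes = true) (hd : Y.length ∣ X.length)
    (hY : ∀ (k : Fin X.length) (j : Fin Y.length), (k : ℕ) % Y.length = j →
      codeWord X.length u k = Y.word j) : Y.Occurs := by
  obtain ⟨b, hb, hX⟩ := h
  refine ⟨b, hb, HasString.of_repetition (σ := codeWord X.length u) hb ?_ ⟨hd, hY⟩⟩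
  refine hX.of_mem_generatedGroup ?_
  rw [X.word_eq]
  exact codeWord_mem_of_inGen hu

/-! ### Entries found, as repetitions, in the group of an entry already realized -/

lemma occurs_T0τ : CycleLabel.T0τ.Occurs :=
  occurs_T7τ.of_inGen [3, 3, 3, 3, 3, 3] (by decide +kernel) (by decide) (by decide +kernel)

lemma occurs_T0ε : CycleLabel.T0ε.Occurs :=
  occurs_T7ε.of_inGen [4, 4, 4, 4, 4, 4] (by decide +kernel) (by decide) (by decide +kernel)

lemma occurs_T0κ : CycleLabel.T0κ.Occurs :=
  occurs_T7κ.of_inGen [5, 5, 5, 5, 5, 5] (by decide +kernel) (by decide) (by decide +kernel)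

lemma occurs_C1 : CycleLabel.C1.Occurs :=
  occurs_T7τ.of_inGen [1, 2, 1, 2, 1, 2] (by decide +kernel) (by decide) (by decide +kernel)

lemma occurs_T2τ : CycleLabel.T2τ.Occurs :=
  occurs_T7τ.of_inGen [4, 5, 4, 5, 4, 5] (by decide +kernel) (by decide) (by decide +kernel)

lemma occurs_T2ε : CycleLabel.T2ε.Occurs :=
  occurs_T7ε.of_inGen [3, 5, 3, 5, 3, 5] (by decide +kernel) (by decide) (by decide +kernel)

lemma occurs_T2κ : CycleLabel.T2κ.Occurs :=
  occurs_T7κ.of_inGen [3, 4, 3, 4, 3, 4] (by decide +kernel) (by decide) (by decide +kernel)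

lemma occurs_C2 : CycleLabel.C2.Occurs :=
  occurs_T5ccw.of_inGen [0, 1, 2] (by decide +kernel) (by decide) (by decide +kernel)

lemma occurs_C0 : CycleLabel.C0.Occurs :=
  occurs_C2.of_inGen [1, 1, 1] (by decide +kernel) (by decide) (by decide +kernel)

lemma occurs_C3 : CycleLabel.C3.Occurs :=
  occurs_T6τ.of_inGen [0, 1, 0, 2] (by decide +kernel) (by decide) (by decide +kernel)

lemma occurs_C4 : CycleLabel.C4.Occurs :=
  occurs_T7τ.of_inGen [0, 1, 1, 0, 2, 2] (by decide +kernel) (by decide) (by decide +kernel)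

end PencilMPS

namespace PencilMPS

/-! ### Strings with one diagonal entry -/

/-- Ω and Ω² span the traceless diagonal matrices, so an invertible change of physical basis
replaces them by integer ones. The factor 4 in the coefficients compensates c⁻¹ = d/4. -/
lemma isGenerating_of_real {c d : Mat3} (hcd : d * c = (4 : ℂ) • 1) {n : ℕ}
    (h : Separates (fun _ i => d * ![Matrix.diagonal ![1, -1, 0], Matrix.diagonal ![0, 1, -1]] i)
      0 n) : IsGenerating c := by
  have hc : c⁻¹ = (1 / 4 : ℂ) • d := by
    refine Matrix.inv_eq_left_inv ?_
    rw [smul_mul_assoc, hcd, smul_smul]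
    norm_num
  refine ⟨n, Separates.of_local (A := fun i => d * ![Matrix.diagonal ![1, -1, 0],
    Matrix.diagonal ![0, 1, -1]] i) (fun k => ⟨!![4 * ((1 - ω) / 3), 4 * ((2 + ω) / 3);
      4 * ((1 + 2 * ω) / 3), -4 * ((1 + 2 * ω) / 3)], fun i => ?_⟩) h⟩
  have h1 := omega_sq
  rw [hc]
  simp only [smul_mul_assoc, ← mul_smul_comm, ← Finset.mul_sum]
  congr 1
  ext a b
  fin_cases i <;> fin_cases a <;> fin_cases b <;>
    simp [Fin.sum_univ_two, clock, pow_two] <;> grind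

/-- Nine of the sixteen words of length four already give independent equations for the nine entries
of X. -/
lemma separates_swap : Separates (fun _ i => (!![0, 1, -1; 1, 1, 1; -1, 1, 1] : Mat3) *
    ![Matrix.diagonal ![1, -1, 0], Matrix.diagonal ![0, 1, -1]] i) 0 4 := by
  intro X hX
  have hd : ∀ i : Fin 2, (!![0, 1, -1; 1, 1, 1; -1, 1, 1] : Mat3) *
      ![Matrix.diagonal ![1, -1, 0], Matrix.diagonal ![0, 1, -1]] i =
      ![!![0, -1, 0; 1, -1, 0; -1, -1, 0], !![0, 1, 1; 0, 1, -1; 0, 1, -1]] i := by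
    intro i
    ext a b
    fin_cases i <;> fin_cases a <;> fin_cases b <;> simp
  simp only [hd] at hX
  rw [Matrix.eta_fin_three X] at hX
  have h0 := hX [0, 0, 0, 0] rfl
  have h1 := hX [0, 0, 0, 1] rfl
  have h2 := hX [0, 0, 1, 0] rfl
  have h3 := hX [0, 0, 1, 1] rfl
  have h4 := hX [0, 1, 0, 0] rfl
  have h5 := hX [0, 1, 0, 1] rfl
  have h6 := hX [1, 0, 0, 0] rfl
  have h7 := hX [1, 0, 0, 1] rfl
  have h8 := hX [1, 0, 1, 0] rfl
  clear hX hd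
  simp [prodFrom, Matrix.trace_fin_three] at h0 h1 h2 h3 h4 h5 h6 h7 h8
  ext i j
  fin_cases i <;> fin_cases j <;> simp <;> grind

lemma separates_cycle : Separates (fun _ i => (!![0, 1, 1; 1, 1, -1; -1, 1, -1] : Mat3) *
    ![Matrix.diagonal ![1, -1, 0], Matrix.diagonal ![0, 1, -1]] i) 0 4 := by
  intro X hX
  have hd : ∀ i : Fin 2, (!![0, 1, 1; 1, 1, -1; -1, 1, -1] : Mat3) *
      ![Matrix.diagonal ![1, -1, 0], Matrix.diagonal ![0, 1, -1]] i =
      ![!![0, -1, 0; 1, -1, 0; -1, -1, 0], !![0, 1, -1; 0, 1, 1; 0, 1, 1]] i := by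
    intro i
    ext a b
    fin_cases i <;> fin_cases a <;> fin_cases b <;> simp
  simp only [hd] at hX
  rw [Matrix.eta_fin_three X] at hX
  have h0 := hX [0, 0, 0, 0] rfl
  have h1 := hX [0, 0, 0, 1] rfl
  have h2 := hX [0, 0, 1, 0] rfl
  have h3 := hX [0, 0, 1, 1] rfl
  have h4 := hX [0, 1, 0, 0] rfl
  have h5 := hX [0, 1, 0, 1] rfl
  have h6 := hX [1, 0, 0, 0] rfl
  have h7 := hX [1, 0, 0, 1] rfl
  have h8 := hX [1, 0, 1, 0] rfl
  clear hX hd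
  simp [prodFrom, Matrix.trace_fin_three] at h0 h1 h2 h3 h4 h5 h6 h7 h8
  ext i j
  fin_cases i <;> fin_cases j <;> simp <;> grind

/-- The sign change of the first basis vector. -/
def signFlip : Mat3 := !![-1, 0, 0; 0, 1, 0; 0, 0, 1]

/-- The reflection in the vector `e₁ - e₂`. -/
def swapFlip : Mat3 := !![1, 0, 0; 0, 0, 1; 0, 1, 0]

/-- The reflection in the vector `e₁ + e₂`. -/
def negSwapFlip : Mat3 := !![1, 0, 0; 0, 0, -1; 0, -1, 0]

lemma isMono_signFlip : IsMono signFlip 1 := by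
  intro i j
  fin_cases i <;> fin_cases j <;> simp [signFlip]

lemma isMono_swapFlip : IsMono swapFlip τ := by
  intro i j
  fin_cases i <;> fin_cases j <;> simp [swapFlip] <;> decide

lemma isMono_negSwapFlip : IsMono negSwapFlip τ := by
  intro i j
  fin_cases i <;> fin_cases j <;> simp [negSwapFlip] <;> decide

/-- This c exchanges the lines of e₀ and e₁ − e₂ and also their orthogonal planes, hence the two
reflections. -/
lemma hasString_swap :
    HasString (!![0, 2, -2; 2, 1, 1; -2, 1, 1] : Mat3) CycleLabel.T1τ.word := by
  refine ⟨fun k : Fin 2 => ![signFlip, swapFlip] k, fun k : Fin 2 => ?_, fun k : Fin 2 => ?_⟩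
  · fin_cases k
    · exact isMono_signFlip
    · exact isMono_swapFlip
  · refine ⟨1, one_ne_zero, ?_⟩
    fin_cases k <;> simp [signFlip, swapFlip]

/-- This c permutes the lines of e₀, e₁ + e₂, e₁ − e₂ cyclically, and their orthogonal planes
accordingly. -/
lemma hasString_cycle :
    HasString (!![0, 2, -2; 2, 1, 1; 2, -1, -1] : Mat3) CycleLabel.T3τ.word := by
  refine ⟨fun k : Fin 3 => ![signFlip, negSwapFlip, swapFlip] k, fun k : Fin 3 => ?_,
    fun k : Fin 3 => ?_⟩
  · fin_cases k
    · exact isMono_signFlip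
    · exact isMono_negSwapFlip
    · exact isMono_swapFlip
  · refine ⟨1, one_ne_zero, ?_⟩
    fin_cases k <;> simp [signFlip, swapFlip, negSwapFlip]

/-! ### Conjugation with the shift matrices -/

lemma heis_clock_pow (r : ZMod 3) (n : ℕ) : ∃ z : ℂ, z ≠ 0 ∧
    heis (0, r) * clock ^ n = z • (clock ^ n * heis (0, r)) := by
  obtain ⟨z, hz, e⟩ := (heis_clock ▸ conjTo_heis (0, r) (1, 0)).pow n
  exact ⟨z, hz, e⟩

/-- A shift matrix commutes with Ω up to a scalar, so conjugating c by it conjugates the letters up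
to scalars. This carries the entries for τ to those for ε and κ. -/
lemma IsGenerating.conj {c : Mat3} (h : IsGenerating c) (r : ZMod 3) :
    IsGenerating (heis (0, r) * c * (heis (0, r))⁻¹) := by
  obtain ⟨n, hn⟩ := h
  set P := heis (0, r) with hP
  have hu : IsUnit P.det := (isMono_heis (0, r)).isUnit_det
  obtain ⟨u, hu'⟩ : ∃ u : GL (Fin 3) ℂ, (u : Mat3) = P :=
    ⟨Matrix.GeneralLinearGroup.mk'' _ hu, rfl⟩
  choose z hz e using heis_clock_pow r
  have h1 := hn.conj u⁻¹ (B := fun i => P * (c⁻¹ * clock ^ (2 - (i : ℕ))) * P⁻¹)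
    (fun i => by rw [inv_inv, hu', Matrix.coe_units_inv, hu'])
  refine ⟨n, Separates.of_local (fun k => ⟨Matrix.diagonal fun i => z (2 - (i : ℕ)), fun i => ?_⟩)
    h1⟩
  have h2 : (P * c * P⁻¹)⁻¹ = P * c⁻¹ * P⁻¹ := by
    rw [Matrix.mul_inv_rev, Matrix.mul_inv_rev, Matrix.nonsing_inv_nonsing_inv _ hu, mul_assoc]
  have h3 : ∀ n, clock ^ n * P⁻¹ = z n • (P⁻¹ * clock ^ n) := fun n => by
    calc clock ^ n * P⁻¹ = P⁻¹ * (P * clock ^ n) * P⁻¹ := by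
          rw [Matrix.nonsing_inv_mul_cancel_left _ _ hu]
      _ = _ := by
          rw [e, mul_smul_comm, smul_mul_assoc, ← mul_assoc,
            Matrix.mul_nonsing_inv_cancel_right _ _ hu]
  rw [Finset.sum_eq_single i (fun j _ hj => by
      rw [Matrix.diagonal_apply_ne _ hj.symm, zero_smul]) (fun hi => (hi (Finset.mem_univ i)).elim),
    Matrix.diagonal_apply_eq, h2, mul_assoc, mul_assoc, h3, mul_smul_comm, mul_smul_comm]
  simp only [mul_assoc]

lemma HasString.conj {c : Mat3} {N : ℕ} [NeZero N] {σ : Fin N → S3} (h : HasString c σ)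
    (r : ZMod 3) : HasString (heis (0, r) * c * (heis (0, r))⁻¹)
      fun k => (rot r)⁻¹ * (σ k * rot r) := by
  have hr := isMono_heis (0, r)
  obtain ⟨M, hM, hc⟩ := h
  have hP : ∀ M : Mat3, ConjTo (heis (0, r)) M (heis (0, r) * M * (heis (0, r))⁻¹) := fun M =>
    ⟨1, one_ne_zero, by rw [one_smul, Matrix.nonsing_inv_mul_cancel_right _ _ hr.isUnit_det]⟩
  have hP' : ∀ M : Mat3, ConjTo (heis (0, r))⁻¹ (heis (0, r) * M * (heis (0, r))⁻¹) M := fun M =>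
    ⟨1, one_ne_zero, by
      rw [one_smul, mul_assoc, Matrix.nonsing_inv_mul_cancel_left _ _ hr.isUnit_det]⟩
  refine ⟨fun k => heis (0, r) * M k * (heis (0, r))⁻¹, fun k => (hr.mul (hM k)).mul hr.inv,
    fun k => ?_⟩
  rw [mul_assoc]
  exact ((hP' _).comp (hc k)).comp (hP _)

lemma occurs_of_conj {c : Mat3} (h : IsGenerating c) (hc : IsUnit c.det) {X : CycleLabel} {N : ℕ}
    [NeZero N] {σ : Fin N → S3} (hs : HasString c σ) (r : ZMod 3) (hN : X.length = N)
    (hX : ∀ (k : Fin X.length) (j : Fin N), (k : ℕ) = j → X.word k = (rot r)⁻¹ * (σ j * rot r)) :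
    X.Occurs := by
  subst hN
  refine (h.conj r).occurs ?_ ?_
  · rw [Matrix.det_mul, Matrix.det_mul]
    exact ((isMono_heis _).isUnit_det.mul hc).mul (isMono_heis _).inv.isUnit_det
  · convert hs.conj r using 1
    funext k
    exact hX k k rfl

lemma isGenerating_swap : IsGenerating !![0, 2, -2; 2, 1, 1; -2, 1, 1] := by
  refine isGenerating_of_real ?_ separates_swap
  ext i j
  fin_cases i <;> fin_cases j <;> norm_num [Matrix.mul_fin_three]

lemma isGenerating_cycle : IsGenerating !![0, 2, -2; 2, 1, 1; 2, -1, -1] := by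
  refine isGenerating_of_real ?_ separates_cycle
  ext i j
  fin_cases i <;> fin_cases j <;> norm_num [Matrix.mul_fin_three]

lemma occurs_T1 (r : ZMod 3) {X : CycleLabel} (hN : X.length = CycleLabel.T1τ.length)
    (hX : ∀ (k : Fin X.length) (j : Fin CycleLabel.T1τ.length), (k : ℕ) = j →
      X.word k = (rot r)⁻¹ * (CycleLabel.T1τ.word j * rot r)) : X.Occurs := by
  refine occurs_of_conj isGenerating_swap ?_ hasString_swap r hN hX
  rw [Matrix.det_fin_three, isUnit_iff_ne_zero]
  simp
  norm_num

lemma occurs_T3 (r : ZMod 3) {X : CycleLabel} (hN : X.length = CycleLabel.T3τ.length)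
    (hX : ∀ (k : Fin X.length) (j : Fin CycleLabel.T3τ.length), (k : ℕ) = j →
      X.word k = (rot r)⁻¹ * (CycleLabel.T3τ.word j * rot r)) : X.Occurs := by
  refine occurs_of_conj isGenerating_cycle ?_ hasString_cycle r hN hX
  rw [Matrix.det_fin_three, isUnit_iff_ne_zero]
  simp
  norm_num

/-- Every entry of the table occurs for a normal tensor. -/
theorem CycleLabel.exists_normal_hasCycle (X : CycleLabel) :
    ∃ b : GL (Fin 3) ℂ, IsNormal (fiducial b) ∧ HasCycle (fiducial b) X.word := by
  have h : X.Occurs := by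
    cases X
    case T1τ => exact occurs_T1 0 rfl (by decide)
    case T1ε => exact occurs_T1 1 rfl (by decide)
    case T1κ => exact occurs_T1 2 rfl (by decide)
    case T3τ => exact occurs_T3 0 rfl (by decide)
    case T3ε => exact occurs_T3 1 rfl (by decide)
    case T3κ => exact occurs_T3 2 rfl (by decide)
    case C0 => exact occurs_C0
    case C1 => exact occurs_C1
    case C2 => exact occurs_C2
    case C3 => exact occurs_C3
    case C4 => exact occurs_C4
    case T0τ => exact occurs_T0τ
    case T0ε => exact occurs_T0ε
    case T0κ => exact occurs_T0κ
    case T2τ => exact occurs_T2τ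
    case T2ε => exact occurs_T2ε
    case T2κ => exact occurs_T2κ
    case T4ccw => exact occurs_T4ccw
    case T4cw => exact occurs_T4cw
    case T5ccw => exact occurs_T5ccw
    case T5cw => exact occurs_T5cw
    case T6τ => exact occurs_T6τ
    case T6ε => exact occurs_T6ε
    case T6κ => exact occurs_T6κ
    case T7τ => exact occurs_T7τ
    case T7ε => exact occurs_T7ε
    case T7κ => exact occurs_T7κ
  obtain ⟨b, hb, hX⟩ := h
  exact ⟨b, hb, hX.hasCycle⟩

end PencilMPS
theorem mainTheorem3 :
    -- every cycle is, up to scalars, given by a string that is trivial or generates a listed group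
    (∀ (b : GL (Fin 3) ℂ) (N : ℕ) [NeZero N] (h : Fin N → PencilMPS.LocalTriple),
      PencilMPS.IsCycle (PencilMPS.fiducial b) h →
      ∃ σ : Fin N → PencilMPS.S3,
        (∀ k, ∃ c : ℂ, c ≠ 0 ∧
          ((h k).g : Matrix (Fin 2) (Fin 2) ℂ) = c • PencilMPS.qubitOp (σ k)) ∧
        (σ = 1 ∨ ∃ (X : PencilMPS.CycleLabel) (w : Fin X.length → PencilMPS.S3),
          PencilMPS.IsRepetition w σ ∧
          PencilMPS.generatedGroup w = PencilMPS.generatedGroup X.word) ∧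
        ∃ n ∈ ({1, 2, 3, 4, 6} : Set ℕ), PencilMPS.IsMinimalLength σ n) ∧
    -- every listed cycle occurs, with its listed length as minimal length
    (∀ X : PencilMPS.CycleLabel, PencilMPS.IsMinimalLength X.word X.length ∧
      ∃ b : GL (Fin 3) ℂ, PencilMPS.IsNormal (PencilMPS.fiducial b) ∧
        PencilMPS.HasCycle (PencilMPS.fiducial b) X.word) ∧
    -- symmetries of the normal matrix product states
    (∀ (b : GL (Fin 3) ℂ) (L : ℕ),
      PencilMPS.IsInjectivityLength (PencilMPS.fiducial b) L → ∀ N : ℕ, 2 * L + 1 ≤ N →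
      (PencilMPS.localSymmetries (PencilMPS.mps (PencilMPS.fiducial b) N)).Finite ∧
      (∀ O ∈ PencilMPS.localSymmetries (PencilMPS.mps (PencilMPS.fiducial b) N),
        O ∈ Matrix.unitaryGroup (Fin N → Fin 2) ℂ ∧
        ∃ (c : ℂ) (σ : Fin N → PencilMPS.S3),
          O = c • PencilMPS.localOp fun k => PencilMPS.qubitOp (σ k)) ∧
      ∀ σ : Fin N → PencilMPS.S3,
        (∃ c : ℂ, (c • PencilMPS.localOp fun k => PencilMPS.qubitOp (σ k)) ∈
          PencilMPS.localSymmetries (PencilMPS.mps (PencilMPS.fiducial b) N)) ↔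
        (σ = 1 ∨ ∃ X : PencilMPS.CycleLabel,
          PencilMPS.HasCycle (PencilMPS.fiducial b) X.word ∧
          ∃ w ∈ PencilMPS.generatedGroup X.word, PencilMPS.IsRepetition w σ)) := by
  refine ⟨fun b N _ h hh => ?_, fun X => ⟨X.isMinimalLength, X.exists_normal_hasCycle⟩,
    fun b L hL N hN => ?_⟩
  · obtain ⟨σ, hσ, hs⟩ := hh.exists_string
    exact ⟨σ, hσ, hs.classification (PencilMPS.isUnit_det_driver b)⟩
  · have : NeZero N := ⟨by omega⟩
    exact ⟨PencilMPS.finite_localSymmetries hL hN,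
      fun O hO => ⟨PencilMPS.mem_unitaryGroup_of_mem_localSymmetries hL hN hO,
        PencilMPS.exists_eq_smul_of_mem_localSymmetries hL hN hO⟩,
      fun σ => (PencilMPS.exists_smul_mem_localSymmetries_iff hL hN σ).trans
        (PencilMPS.hasString_iff_table hL σ)⟩
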